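/- A foliation of degree $N$ on $\mathbb{P}^2(\mathbb{C})$ is given, up to a nonzero constant, by a $1$-form $\omega=a\,\mathrm{d}X+b\,\mathrm{d}Y+c\,\mathrm{d}Z$ on $\mathbb{C}^3$ whose coefficients are homogeneous polynomials of degree $N+1$ without common factor satisfying $aX+bY+cZ=0$; we also write $\omega$ in the affine chart $x=X/Z$, $y=Y/Z$. Let $\mathscr{F}(2;2)$ be the space of foliations of degree $2$ (quadratic foliations), with its ordinary topology as an open subset of $\mathbb{P}^{14}(\mathbb{C})$. The group $\mathrm{Aut}(\mathbb{P}^2(\mathbb{C}))=\mathrm{PGL}_3(\mathbb{C})$ acts on it; $\mathcal{O}(\mathcal{F})$ denotes the orbit of $\mathcal{F}$, of dimension $8-\dim\mathrm{Iso}(\mathcal{F})$ where $\mathrm{Iso}(\mathcal{F})$ is the stabilizer of $\mathcal{F}$, and two foliations are conjugate if they have the same orbit. We say that $\mathcal{F}$ degenerates onto $\mathcal{F}'$ if the closure of $\mathcal{O}(\mathcal{F})$ in $\mathscr{F}(2;2)$ contains $\mathcal{O}(\mathcal{F}')$ and $\mathcal{O}(\mathcal{F})\neq\mathcal{O}(\mathcal{F}')$.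 At a singular point $m$, if $\mathcal{F}$ is given in local coordinates $(u,v)$ centred at $m$ by $E\,\mathrm{d}u+F\,\mathrm{d}v$, the multiplicity of $m$ is $\dim_{\mathbb{C}}\mathbb{C}\{u,v\}/\langle E,F\rangle$; when it is $1$, the Baum–Bott invariant is $\mathrm{BB}(\mathcal{F};m)=\mathrm{tr}(J)^2/\det(J)$, where $J$ is the linear part at $m$ of the vector field $F\,\partial_u-E\,\partial_v$. Let $\mathcal{F}_5$ be the foliation given by $x^2\mathrm{d}y+y^2(x\,\mathrm{d}y-y\,\mathrm{d}x)$ and, for $\lambda\in\mathbb{C}^*$, let $\mathcal{F}_0(\lambda)$ be the foliation given by $y\,\mathrm{d}x+(\lambda x+y^2)\,\mathrm{d}y$. **Theorem.** Let $\mathcal{F}\in\mathscr{F}(2;2)$ be a foliation without invariant line. 1. $\mathcal{F}$ degenerates onto $\mathcal{F}_5$ if and only if $\mathcal{F}$ has a singular point $m$ of multiplicity $1$ with $\mathrm{BB}(\mathcal{F};m)=4$. 2. Let $\lambda\in\mathbb{C}^*$. If $\mathcal{F}$ has a singular point $m$ of multiplicity $1$ with $\mathrm{BB}(\mathcal{F};m)=2-\lambda-\frac{1}{\lambda}$,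 then $\mathcal{F}$ degenerates onto $\mathcal{F}_0(\lambda)$. In particular, a generic $\mathcal{F}\in\mathscr{F}(2;2)$ (that is, every $\mathcal{F}$ outside some proper algebraic subset of $\mathscr{F}(2;2)$) degenerates onto at least seven pairwise non-conjugate foliations whose orbits have dimension $7$. -/

import Mathlib

open scoped LinearAlgebra.Projectivization Topology

noncomputable section

/-- A polynomial `1`-form `ω 0 dX + ω 1 dY + ω 2 dZ` on `ℂ³`; the variables `X, Y, Z` are
`X 0, X 1, X 2`. -/
abbrev OneForm : Type := Fin 3 → MvPolynomial (Fin 3) ℂ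

/-- `ω` defines a foliation of degree `N` on `ℙ²(ℂ)`: its coefficients are homogeneous of degree
`N + 1`, satisfy Euler's identity, and have no common factor (in particular `ω ≠ 0`). -/
def DefinesFoliation (N : ℕ) (ω : OneForm) : Prop :=
  (∀ i, (ω i).IsHomogeneous (N + 1)) ∧
  (∑ i, MvPolynomial.X i * ω i = 0) ∧
  ∀ d : MvPolynomial (Fin 3) ℂ, (∀ i, d ∣ ω i) → IsUnit d

/-- The homogeneous `1`-forms which define a foliation of degree `N`. -/
def FoliationForm (N : ℕ) : Type := {ω : OneForm // DefinesFoliation N ω}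

/-- The coordinates of a form: the coefficients of its three components. -/
def OneForm.coords (ω : OneForm) : Fin 3 × (Fin 3 →₀ ℕ) → ℂ :=
  fun q => MvPolynomial.coeff q.2 (ω q.1)

/-- The ordinary topology (forms of a given degree form a finite dimensional complex vector
space): convergence is convergence of all coefficients. -/
instance (N : ℕ) : TopologicalSpace (FoliationForm N) :=
  TopologicalSpace.induced (fun ω => OneForm.coords ω.1) inferInstance

/-- Two forms define the same foliation when they agree up to a nonzero constant. -/
instance FoliationForm.setoid (N : ℕ) : Setoid (FoliationForm N) where
  r ω η := ∃ c : ℂ, c ≠ 0 ∧ η.1 = c • ω.1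
  iseqv :=
    { refl := fun ω => ⟨1, one_ne_zero, (one_smul ℂ ω.1).symm⟩
      symm := by
        rintro ω η ⟨c, hc, h⟩
        exact ⟨c⁻¹, inv_ne_zero hc, by rw [h, smul_smul, inv_mul_cancel₀ hc, one_smul]⟩
      trans := by
        rintro ω η θ ⟨c, hc, h⟩ ⟨e, he, h'⟩
        exact ⟨e * c, mul_ne_zero he hc, by rw [h', h, smul_smul]⟩ }

/-- The space of foliations of degree `N` on `ℙ²(ℂ)`: an open subset of the projective space of
homogeneous forms of degree `N + 1` satisfying Euler's identity. -/
def Foliation (N : ℕ) : Type := Quotient (FoliationForm.setoid N)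

instance (N : ℕ) : TopologicalSpace (Foliation N) :=
  inferInstanceAs (TopologicalSpace (Quotient (FoliationForm.setoid N)))

/-- The foliation defined by a form. -/
def FoliationForm.toFoliation {N : ℕ} (ω : FoliationForm N) : Foliation N :=
  Quotient.mk (FoliationForm.setoid N) ω

/-- The pull-back `g^* ω` of a form by the linear map `v ↦ g v` of `ℂ³`. -/
def OneForm.pullback (g : Matrix (Fin 3) (Fin 3) ℂ) (ω : OneForm) : OneForm := fun j =>
  ∑ i, MvPolynomial.C (g i j) *
    MvPolynomial.bind₁ (fun k => ∑ l, MvPolynomial.C (g k l) * MvPolynomial.X l) (ω i)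

namespace Foliation

variable {N : ℕ}

/-- A homogeneous form defining the foliation (unique up to a nonzero constant). -/
def form (F : Foliation N) : OneForm := (Quotient.out F).1

/-- The orbit of a foliation under `Aut(ℙ²(ℂ)) = PGL₃(ℂ)`, that is, its conjugacy class. -/
def orbit (F : Foliation N) : Set (Foliation N) :=
  {G | ∃ g : GL (Fin 3) ℂ, ∃ c : ℂ, c ≠ 0 ∧ G.form = c • F.form.pullback g.1}

/-- `F` degenerates onto `G`: the closure of the orbit of `F` in the space of foliations contains
the orbit of `G`, and the two orbits are different. -/
def DegeneratesOnto (F G : Foliation N) : Prop :=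
  G.orbit ⊆ closure F.orbit ∧ F.orbit ≠ G.orbit

/-- The line of equation `a₀ X + a₁ Y + a₂ Z = 0` is invariant: at each of its points its tangent
direction lies in the kernel of the form. -/
def HasInvariantLine (F : Foliation N) : Prop :=
  ∃ a : Fin 3 → ℂ, a ≠ 0 ∧ ∀ p v : Fin 3 → ℂ, a ⬝ᵥ p = 0 → a ⬝ᵥ v = 0 →
    ∑ i, MvPolynomial.eval p (F.form i) * v i = 0

/-- The singular points: common zeros of the three coefficients. -/
def IsSingular (F : Foliation N) (m : ℙ ℂ (Fin 3 → ℂ)) : Prop :=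
  ∀ i, MvPolynomial.eval m.rep (F.form i) = 0

end Foliation

/-- An index `k` such that the point `m` lies in the affine chart `X_k = 1`. -/
def chartIndex (m : ℙ ℂ (Fin 3 → ℂ)) : Fin 3 :=
  Classical.choose (Function.ne_iff.mp m.rep_nonzero)

/-- The affine coordinates of `m` in the chart `X_k = 1`, where `k = chartIndex m`; the remaining
two variables are numbered in increasing order by `k.succAbove`. -/
def chartPoint (m : ℙ ℂ (Fin 3 → ℂ)) : Fin 2 → ℂ :=
  fun l => m.rep ((chartIndex m).succAbove l) / m.rep (chartIndex m)

instance germAlgebra (a : Fin 2 → ℂ) : Algebra ℂ (Filter.Germ (𝓝 a) ℂ) :=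
  Algebra.ofModule
    (by
      intro r x y
      induction x using Filter.Germ.inductionOn with | _ f => ?_
      induction y using Filter.Germ.inductionOn with | _ g => ?_
      exact congrArg _ (smul_mul_assoc r f g))
    (by
      intro r x y
      induction x using Filter.Germ.inductionOn with | _ f => ?_
      induction y using Filter.Germ.inductionOn with | _ g => ?_
      exact congrArg _ (mul_smul_comm r f g))

/-- The ring `ℂ{u, v}` of germs at `a ∈ ℂ²` of holomorphic functions. -/
def holomorphicGerms (a : Fin 2 → ℂ) : Subalgebra ℂ (Filter.Germ (𝓝 a) ℂ) where
  carrier := {f | ∃ g : (Fin 2 → ℂ) → ℂ, AnalyticAt ℂ g a ∧ (g : Filter.Germ (𝓝 a) ℂ) = f}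
  mul_mem' := by
    rintro _ _ ⟨g, hg, rfl⟩ ⟨h, hh, rfl⟩
    exact ⟨g * h, hg.mul hh, rfl⟩
  add_mem' := by
    rintro _ _ ⟨g, hg, rfl⟩ ⟨h, hh, rfl⟩
    exact ⟨g + h, hg.add hh, rfl⟩
  algebraMap_mem' := fun c => ⟨c • 1, analyticAt_const.smul analyticAt_const, rfl⟩

/-- The germ at `a` of a polynomial in two variables. -/
def polynomialGerm (a : Fin 2 → ℂ) (P : MvPolynomial (Fin 2) ℂ) : holomorphicGerms a :=
  ⟨((fun x => MvPolynomial.eval x P : (Fin 2 → ℂ) → ℂ) : Filter.Germ (𝓝 a) ℂ),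
    fun x => MvPolynomial.eval x P, AnalyticOnNhd.eval_mvPolynomial P a (Set.mem_univ a), rfl⟩

namespace Foliation

variable {N : ℕ}

/-- In the affine chart `X_k = 1` with affine coordinates `(u, v)` the foliation is given by
`E du + F dv`; here `E` is `localCoeff k 0` and `F` is `localCoeff k 1`. -/
def localCoeff (F : Foliation N) (k : Fin 3) (l : Fin 2) : MvPolynomial (Fin 2) ℂ :=
  MvPolynomial.aeval (Fin.insertNth (α := fun _ => MvPolynomial (Fin 2) ℂ) k 1 MvPolynomial.X)
    (F.form (k.succAbove l))

/-- The multiplicity (Milnor number) of the foliation at a point: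
`μ(F, m) = dim_ℂ ℂ{u, v} / ⟨E, F⟩`, where `E du + F dv` is a local form at `m`. -/
def milnorNumber (F : Foliation N) (m : ℙ ℂ (Fin 3 → ℂ)) : ℕ∞ :=
  Cardinal.toENat (Module.rank ℂ (holomorphicGerms (chartPoint m) ⧸
    Ideal.span {polynomialGerm (chartPoint m) (F.localCoeff (chartIndex m) 0),
      polynomialGerm (chartPoint m) (F.localCoeff (chartIndex m) 1)}))

/-- The components of the vector field `F ∂/∂u - E ∂/∂v`, which is tangent to the foliation. -/
def localField (F : Foliation N) (k : Fin 3) : Fin 2 → MvPolynomial (Fin 2) ℂ :=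
  ![F.localCoeff k 1, -F.localCoeff k 0]

/-- The linear part at `m` of a local vector field defining the foliation. -/
def linearPart (F : Foliation N) (m : ℙ ℂ (Fin 3 → ℂ)) : Matrix (Fin 2) (Fin 2) ℂ :=
  Matrix.of fun i j => MvPolynomial.eval (chartPoint m)
    (MvPolynomial.pderiv j (F.localField (chartIndex m) i))

/-- The Baum–Bott invariant `BB(F; m) = tr(J)² / det(J)` of the foliation at a singular point `m`
of multiplicity `1`, `J` being the linear part at `m` of a local vector field defining it. -/
def baumBott (F : Foliation N) (m : ℙ ℂ (Fin 3 → ℂ)) : ℂ :=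
  (F.linearPart m).trace ^ 2 / (F.linearPart m).det

/-- The Lie algebra of the isotropy group of the foliation, inside the Lie algebra `𝔰𝔩₃(ℂ)` of
`Aut(ℙ²(ℂ))`: the matrices `A` whose flow `exp(tA)` preserves the foliation for all `t`. (They
form a linear subspace, so that taking the span adds nothing.) -/
def isoAlgebra (F : Foliation N) : Submodule ℂ (Matrix (Fin 3) (Fin 3) ℂ) :=
  Submodule.span ℂ {A | A.trace = 0 ∧
    ∀ t : ℂ, ∃ c : ℂ, c ≠ 0 ∧ F.form.pullback (NormedSpace.exp (t • A)) = c • F.form}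

/-- The dimension of the orbit of the foliation, which is the homogeneous space
`PGL₃(ℂ) / Iso(F)`: `dim PGL₃(ℂ) - dim Iso(F)`, with `dim PGL₃(ℂ) = 8`. -/
def orbitDim (F : Foliation N) : ℕ := 8 - Module.finrank ℂ F.isoAlgebra

/-- An algebraic subset of the space of foliations: the zero set of homogeneous polynomials in the
coefficients of the defining forms. -/
def IsAlgebraicSet (S : Set (Foliation N)) : Prop :=
  ∃ I : Set (MvPolynomial (Fin 3 × (Fin 3 →₀ ℕ)) ℂ), (∀ P ∈ I, ∃ n, P.IsHomogeneous n) ∧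
    S = {F | ∀ P ∈ I, MvPolynomial.eval F.form.coords P = 0}

/-- A property holds for the generic foliation of degree `N` when it holds for all foliations
outside some proper algebraic subset of the space of foliations. -/
def Generically (p : Foliation N → Prop) : Prop :=
  ∃ S : Set (Foliation N), IsAlgebraicSet S ∧ S ≠ Set.univ ∧ ∀ F ∉ S, p F

end Foliation

open MvPolynomial in
/-- `x² dy + y² (x dy - y dx)` in homogeneous coordinates. -/
def omegaFive : OneForm :=
  ![-(X 1) ^ 3, (X 0) ^ 2 * X 2 + X 0 * (X 1) ^ 2, -((X 0) ^ 2 * X 1)]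

open MvPolynomial in
/-- `y dx + (l x + y²) dy` in homogeneous coordinates. -/
def omegaZero (l : ℂ) : OneForm :=
  ![X 1 * (X 2) ^ 2, C l * (X 0 * (X 2) ^ 2) + (X 1) ^ 2 * X 2,
    -(C (1 + l) * (X 0 * X 1 * X 2) + (X 1) ^ 3)]

open MvPolynomial in
/-- In the chart `Z = 1`, `omegaFive` is `-y³ dx + (x² + x y²) dy`. -/
theorem omegaFive_chart (i : Fin 2) :
    aeval (![X 0, X 1, 1] : Fin 3 → MvPolynomial (Fin 2) ℂ) (omegaFive i.castSucc) =
      (![-(X 1) ^ 3, (X 0) ^ 2 + X 0 * (X 1) ^ 2] : Fin 2 → MvPolynomial (Fin 2) ℂ) i := by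
  fin_cases i <;> simp [omegaFive]

open MvPolynomial in
/-- In the chart `Z = 1`, `omegaZero l` is `y dx + (l x + y²) dy`. -/
theorem omegaZero_chart (l : ℂ) (i : Fin 2) :
    aeval (![X 0, X 1, 1] : Fin 3 → MvPolynomial (Fin 2) ℂ) (omegaZero l i.castSucc) =
      (![X 1, C l * X 0 + (X 1) ^ 2] : Fin 2 → MvPolynomial (Fin 2) ℂ) i := by
  fin_cases i <;> simp [omegaZero, algebraMap_eq]

/-- If every prime common divisor is excluded and one coefficient is nonzero, then the
coefficients have no common factor. -/
theorem isUnit_of_forall_dvd {ω : OneForm} (i₀ : Fin 3) (h₀ : ω i₀ ≠ 0)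
    (h : ∀ p : MvPolynomial (Fin 3) ℂ, Prime p → ¬ ∀ i, p ∣ ω i)
    (d : MvPolynomial (Fin 3) ℂ) (hd : ∀ i, d ∣ ω i) : IsUnit d := by
  by_contra hu
  have hd0 : d ≠ 0 := by
    rintro rfl
    exact h₀ (zero_dvd_iff.mp (hd i₀))
  obtain ⟨p, hp, hpd⟩ := WfDvdMonoid.exists_irreducible_factor hu hd0
  exact h p hp.prime fun i => hpd.trans (hd i)

open MvPolynomial in
/-- A prime dividing the variable `X k` divides no polynomial that is nonzero at some point of the
plane `X k = 0`. -/
theorem not_dvd_of_eval_ne_zero {p q : MvPolynomial (Fin 3) ℂ} {k : Fin 3} (hp : Prime p)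
    (hpk : p ∣ X k) (v : Fin 3 → ℂ) (hv : v k = 0) (hq : eval v q ≠ 0) : ¬ p ∣ q := by
  rintro hpq
  have hX : X k ∣ p := (hp.irreducible.dvd_symm (X_prime (R := ℂ) (i := k)).irreducible) hpk
  obtain ⟨r, rfl⟩ := hX.trans hpq
  simp [hv] at hq

open MvPolynomial in
theorem definesFoliation_omegaFive : DefinesFoliation 2 omegaFive := by
  have hX : ∀ i : Fin 3, (X i : MvPolynomial (Fin 3) ℂ).IsHomogeneous 1 :=
    fun i => isHomogeneous_X ℂ i
  refine ⟨fun i => ?_, ?_, ?_⟩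
  · fin_cases i
    · exact ((hX 1).pow 3).neg
    · exact (((hX 0).pow 2).mul (hX 2)).add ((hX 0).mul ((hX 1).pow 2))
    · exact (((hX 0).pow 2).mul (hX 1)).neg
  · simp only [omegaFive, Fin.sum_univ_three]
    simp
    ring
  · refine isUnit_of_forall_dvd 0 ?_ ?_
    · simp [omegaFive]
    · intro p hp h
      have h0 : p ∣ X 1 := hp.dvd_of_dvd_pow ((dvd_neg).mp (h 0))
      exact not_dvd_of_eval_ne_zero hp h0 ![1, 0, 1] rfl (by simp [omegaFive]) (h 1)

open MvPolynomial in
theorem definesFoliation_omegaZero {l : ℂ} (hl : l ≠ 0) : DefinesFoliation 2 (omegaZero l) := by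
  have hX : ∀ i : Fin 3, (X i : MvPolynomial (Fin 3) ℂ).IsHomogeneous 1 :=
    fun i => isHomogeneous_X ℂ i
  refine ⟨fun i => ?_, ?_, ?_⟩
  · fin_cases i
    · exact (hX 1).mul ((hX 2).pow 2)
    · exact ((isHomogeneous_C _ l).mul ((hX 0).mul ((hX 2).pow 2))).add
        (((hX 1).pow 2).mul (hX 2))
    · exact (((isHomogeneous_C _ (1 + l)).mul (((hX 0).mul (hX 1)).mul (hX 2))).add
        ((hX 1).pow 3)).neg
  · simp only [omegaZero, Fin.sum_univ_three]
    simp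
    ring
  · refine isUnit_of_forall_dvd 0 ?_ ?_
    · simp [omegaZero]
    · intro p hp h
      rcases hp.dvd_or_dvd (show p ∣ X 1 * (X 2) ^ 2 from h 0) with h0 | h0
      · exact not_dvd_of_eval_ne_zero hp h0 ![1, 0, 1] rfl (by simp [omegaZero, hl]) (h 1)
      · exact not_dvd_of_eval_ne_zero hp (hp.dvd_of_dvd_pow h0) ![0, 1, 0] rfl
          (by simp [omegaZero]) (h 2)

/-- The foliation `F₅`, given by `x² dy + y² (x dy - y dx)`. -/
def foliationFive : Foliation 2 :=
  FoliationForm.toFoliation ⟨omegaFive, definesFoliation_omegaFive⟩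

/-- The foliation `F₀(l)`, given by `y dx + (l x + y²) dy`, for `l ≠ 0`. -/
def foliationZero (l : ℂ) (hl : l ≠ 0) : Foliation 2 :=
  FoliationForm.toFoliation ⟨omegaZero l, definesFoliation_omegaZero hl⟩

end

/-! Everything is read off from flags (`IsFlag`): a nondegenerate singular point `p` and an
eigendirection `b` of its linear part such that the line through `p` along `b` is not invariant. If
`-l` is the quotient of the other eigenvalue by that of `b`, the Baum–Bott invariant at `p` is `2 -
l - 1 / l`.

In affine coordinates at `p` with `y` along `b`, give `x` weight 2 and `y` weight 1. The terms `dx`,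
`dy` vanish since `p` is singular and `y dy` vanishes since `b` is an eigendirection. The lowest
terms then have weight 3: `y dx`, `x dy`, `y² dy`. The last one is present because the line is not
invariant. After rescaling an axis they are proportional to `y dx + l x dy + y² dy`, so pulling back
by `(t², t, 1)`, dividing by `t³` and letting `t → 0` gives `omegaZero l` (`IsFlag.exists_scale`,
`orbit_foliationZero_subset_closure`). Without invariant lines, a singular point with invariant `2 -
l - 1 / l` always yields a flag of ratio `l` (`hasFlag_of_hasBB`). The foliation `F₅` is conjugate
to `F₀(-1)` (`orbit_foliationFive`), which corresponds to the value 4.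

Conversely, a nondegenerate singular point survives small perturbations and its invariant moves
continuously (`eventually_exists_hasBB`). The finitely many invariants of a foliation are constant
along its orbit, so an invariant found in the closure of the orbit already occurs on the orbit
(`hasBB_of_mem_closure_orbit`).

For the generic statement, `F₀(l)` has flags of ratio `l` only, so different `l` give different
orbits. For `l ≠ 0, -1` its stabilizer has dimension one. It remains to find seven distinct ratios
on the generic foliation. One explicit quadratic field has them (`hasSevenFlags_quadFieldSeven`),
and by the implicit function theorem so do its neighbours. Chevalley's theorem turns this open set
into a Zariski open one (`exists_ne_zero_forall_hasSevenFlags`), and `generically_of_quadField`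
passes from fields to foliations. -/

noncomputable section

open MvPolynomial

/-! ### Values, derivatives and pullbacks of forms -/

namespace OneForm

/-- The value of the form `ω` at the point `p` on the vector `v`. -/
def ev (ω : OneForm) (p v : Fin 3 → ℂ) : ℂ := ∑ i, eval p (ω i) * v i

/-- The derivative at `p` in the direction `w` of the value of `ω` on the constant field `v`. -/
def der (ω : OneForm) (p w v : Fin 3 → ℂ) : ℂ :=
  ∑ i, (∑ j, eval p (pderiv j (ω i)) * w j) * v i

end OneForm

open OneForm

/-- Ties formal partial derivatives to derivatives along lines, so that identities for `der` follow
from identities for `ev` by uniqueness of the derivative. -/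
theorem hasDerivAt_eval_line {σ : Type*} [Fintype σ] (P : MvPolynomial σ ℂ) (p w : σ → ℂ) :
    HasDerivAt (fun t : ℂ => eval (p + t • w) P) (∑ j, eval p (pderiv j P) * w j) 0 := by
  classical
  induction P using MvPolynomial.induction_on with
  | C a => simpa using hasDerivAt_const (0 : ℂ) a
  | add P Q hP hQ =>
    simp only [map_add, add_mul, Finset.sum_add_distrib]
    exact hP.add hQ
  | mul_X P i hP =>
    have h1 : HasDerivAt (fun t : ℂ => p i + t * w i) (w i) 0 := by
      simpa using ((hasDerivAt_id (0 : ℂ)).mul_const (w i)).const_add (p i)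
    have h2 := hP.mul h1
    refine (h2.congr_of_eventuallyEq (Filter.Eventually.of_forall fun t => ?_)).congr_deriv ?_
    · simp
    simp only [Derivation.leibniz, pderiv_X, smul_eq_mul, map_add, map_mul, eval_X, zero_smul,
      add_zero, zero_mul, add_mul, Finset.sum_add_distrib]
    rw [Finset.sum_mul, add_comm]
    congr 1
    · rw [Finset.sum_eq_single i]
      · simp
      · intro j _ hj
        simp [hj]
      · simp
    · exact Finset.sum_congr rfl fun j _ => by ring

namespace OneForm

theorem hasDerivAt_ev (ω : OneForm) (p w v : Fin 3 → ℂ) :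
    HasDerivAt (fun t : ℂ => ω.ev (p + t • w) v) (ω.der p w v) 0 :=
  HasDerivAt.fun_sum fun i _ => (hasDerivAt_eval_line (ω i) p w).mul_const (v i)

theorem ev_add_right (ω : OneForm) (p v v' : Fin 3 → ℂ) :
    ω.ev p (v + v') = ω.ev p v + ω.ev p v' := by
  simp [ev, mul_add, Finset.sum_add_distrib]

theorem ev_smul_right (ω : OneForm) (p v : Fin 3 → ℂ) (c : ℂ) :
    ω.ev p (c • v) = c * ω.ev p v := by
  simp only [ev, Finset.mul_sum, Pi.smul_apply, smul_eq_mul]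
  exact Finset.sum_congr rfl fun i _ => by ring

theorem der_add_right (ω : OneForm) (p w v v' : Fin 3 → ℂ) :
    ω.der p w (v + v') = ω.der p w v + ω.der p w v' := by
  simp [der, mul_add, Finset.sum_add_distrib]

theorem der_smul_right (ω : OneForm) (p w v : Fin 3 → ℂ) (c : ℂ) :
    ω.der p w (c • v) = c * ω.der p w v := by
  simp only [der, Finset.mul_sum, Pi.smul_apply, smul_eq_mul]
  exact Finset.sum_congr rfl fun i _ => by ring

theorem der_add_left (ω : OneForm) (p w w' v : Fin 3 → ℂ) :
    ω.der p (w + w') v = ω.der p w v + ω.der p w' v := by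
  simp [der, mul_add, add_mul, Finset.sum_add_distrib]

theorem der_smul_left (ω : OneForm) (p w v : Fin 3 → ℂ) (c : ℂ) :
    ω.der p (c • w) v = c * ω.der p w v := by
  simp only [der, Finset.mul_sum, Pi.smul_apply, smul_eq_mul]
  refine Finset.sum_congr rfl fun i _ => ?_
  rw [← mul_assoc, Finset.mul_sum]
  congr 1
  exact Finset.sum_congr rfl fun i _ => by ring

theorem ev_smul (ω : OneForm) (c : ℂ) (p v : Fin 3 → ℂ) : (c • ω).ev p v = c * ω.ev p v := by
  simp only [ev, Finset.mul_sum, Pi.smul_apply, smul_eval]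
  exact Finset.sum_congr rfl fun i _ => by ring

theorem der_smul (ω : OneForm) (c : ℂ) (p w v : Fin 3 → ℂ) :
    (c • ω).der p w v = c * ω.der p w v := by
  have h := (ω.hasDerivAt_ev p w v).const_mul c
  simp only [← ev_smul] at h
  exact (hasDerivAt_ev _ _ _ _).unique h

theorem ev_single (ω : OneForm) (p : Fin 3 → ℂ) (i : Fin 3) :
    ω.ev p (Pi.single i 1) = eval p (ω i) := by
  simp [ev, Pi.single_apply]

theorem ev_eq_zero_iff (ω : OneForm) (p : Fin 3 → ℂ) :
    (∀ v, ω.ev p v = 0) ↔ ∀ i, eval p (ω i) = 0 := by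
  refine ⟨fun h i => ?_, fun h v => by simp [ev, h]⟩
  rw [← ev_single, h]

theorem ext_ev {ω η : OneForm} (h : ∀ p v, ω.ev p v = η.ev p v) : ω = η := by
  funext i
  refine MvPolynomial.funext fun p => ?_
  rw [← ev_single, ← ev_single, h]

/-- The substitution `X ↦ g X`. -/
def subst (g : Matrix (Fin 3) (Fin 3) ℂ) : MvPolynomial (Fin 3) ℂ →ₐ[ℂ] MvPolynomial (Fin 3) ℂ :=
  bind₁ fun k => ∑ l, C (g k l) * X l

theorem eval_subst (g : Matrix (Fin 3) (Fin 3) ℂ) (p : Fin 3 → ℂ) (P : MvPolynomial (Fin 3) ℂ) :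
    eval p (subst g P) = eval (g.mulVec p) P := by
  rw [subst, ← MvPolynomial.coe_aeval_eq_eval, ← MvPolynomial.coe_aeval_eq_eval]
  simp only [RingHom.coe_coe, aeval_bind₁]
  congr 2
  funext k
  simp [Matrix.mulVec, dotProduct]

theorem subst_subst (g h : Matrix (Fin 3) (Fin 3) ℂ) (P : MvPolynomial (Fin 3) ℂ) :
    subst g (subst h P) = subst (h * g) P :=
  MvPolynomial.funext fun p => by simp only [eval_subst, Matrix.mulVec_mulVec]

theorem subst_one (P : MvPolynomial (Fin 3) ℂ) : subst 1 P = P :=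
  MvPolynomial.funext fun p => by simp [eval_subst]

theorem pullback_apply (g : Matrix (Fin 3) (Fin 3) ℂ) (ω : OneForm) (j : Fin 3) :
    ω.pullback g j = ∑ i, C (g i j) * subst g (ω i) := rfl

theorem ev_pullback (g : Matrix (Fin 3) (Fin 3) ℂ) (ω : OneForm) (p v : Fin 3 → ℂ) :
    (ω.pullback g).ev p v = ω.ev (g.mulVec p) (g.mulVec v) := by
  simp only [ev, pullback_apply, map_sum, map_mul, eval_C, eval_subst, Matrix.mulVec, dotProduct,
    Finset.sum_mul, Finset.mul_sum]
  rw [Finset.sum_comm]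
  exact Finset.sum_congr rfl fun i _ => Finset.sum_congr rfl fun j _ => by ring

theorem der_pullback (g : Matrix (Fin 3) (Fin 3) ℂ) (ω : OneForm) (p w v : Fin 3 → ℂ) :
    (ω.pullback g).der p w v = ω.der (g.mulVec p) (g.mulVec w) (g.mulVec v) := by
  have h := ω.hasDerivAt_ev (g.mulVec p) (g.mulVec w) (g.mulVec v)
  refine ((hasDerivAt_ev _ p w v).congr_deriv rfl).unique ?_
  simpa only [ev_pullback, Matrix.mulVec_add, Matrix.mulVec_smul] using h

theorem pullback_pullback (g h : Matrix (Fin 3) (Fin 3) ℂ) (ω : OneForm) :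
    (ω.pullback g).pullback h = ω.pullback (g * h) :=
  ext_ev fun p v => by simp only [ev_pullback, Matrix.mulVec_mulVec]

theorem pullback_one (ω : OneForm) : ω.pullback 1 = ω :=
  ext_ev fun p v => by simp only [ev_pullback, Matrix.one_mulVec]

theorem pullback_smul (g : Matrix (Fin 3) (Fin 3) ℂ) (c : ℂ) (ω : OneForm) :
    (c • ω).pullback g = c • ω.pullback g :=
  ext_ev fun p v => by simp only [ev_pullback, ev_smul]

end OneForm

namespace DefinesFoliation

variable {N : ℕ} {ω : OneForm}

theorem ev_self (h : DefinesFoliation N ω) (p : Fin 3 → ℂ) : ω.ev p p = 0 := by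
  have := congrArg (eval p) h.2.1
  simpa [ev, mul_comm] using this

theorem ev_smul_left (h : DefinesFoliation N ω) (c : ℂ) (p v : Fin 3 → ℂ) :
    ω.ev (c • p) v = c ^ (N + 1) * ω.ev p v := by
  simp only [ev, Finset.mul_sum]
  refine Finset.sum_congr rfl fun i _ => ?_
  have h2 : eval (c • p) (ω i) = c ^ (N + 1) * eval p (ω i) := by
    rw [eval_eq, eval_eq, Finset.mul_sum]
    refine Finset.sum_congr rfl fun m hm => ?_
    have hd : ∑ i ∈ m.support, m i = N + 1 := by
      have := h.1 i (mem_support_iff.mp hm)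
      rwa [Finsupp.weight_apply, Finsupp.sum, Finset.sum_congr rfl
        (fun i _ => by rw [Pi.one_apply, smul_eq_mul, mul_one])] at this
    simp only [Pi.smul_apply, smul_eq_mul, mul_pow, Finset.prod_mul_distrib,
      Finset.prod_pow_eq_pow_sum, hd]
    ring
  rw [h2]
  ring

theorem der_self_left (h : DefinesFoliation N ω) (p v : Fin 3 → ℂ) :
    ω.der p p v = (N + 1) * ω.ev p v := by
  refine (hasDerivAt_ev ω p p v).unique ?_
  have h1 : HasDerivAt (fun t : ℂ => (1 + t) ^ (N + 1) * ω.ev p v)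
      (((N + 1 : ℕ) * (1 + 0) ^ N * 1) * ω.ev p v) 0 :=
    (((hasDerivAt_id (0 : ℂ)).const_add 1).pow (N + 1)).mul_const _
  refine (h1.congr_of_eventuallyEq (Filter.Eventually.of_forall fun t => ?_)).congr_deriv ?_
  · show ω.ev (p + t • p) v = _
    rw [show p + t • p = (1 + t) • p by rw [add_smul, one_smul], h.ev_smul_left]
  · simp

/-- Differentiate `ω.ev (p + t • w) (p + t • w) = 0` at `t = 0`. Together with `der_self_left`, this
puts a singular point `p` in the left and right kernels of `ω.der p`. -/
theorem der_self_right (h : DefinesFoliation N ω) (p w : Fin 3 → ℂ) :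
    ω.der p w p = - ω.ev p w := by
  have h0 : HasDerivAt (fun t : ℂ => ω.ev (p + t • w) p + t * ω.ev (p + t • w) w)
      (ω.der p w p + (1 * ω.ev (p + (0 : ℂ) • w) w + 0 * ω.der p w w)) 0 :=
    (hasDerivAt_ev ω p w p).add ((hasDerivAt_id (0 : ℂ)).mul (hasDerivAt_ev ω p w w))
  have h1 : (fun t : ℂ => ω.ev (p + t • w) p + t * ω.ev (p + t • w) w) = fun _ => 0 := by
    funext t
    rw [← ev_smul_right, ← ev_add_right, h.ev_self]
  rw [h1] at h0
  have := h0.unique (hasDerivAt_const (0 : ℂ) (0 : ℂ))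
  simp only [zero_smul, add_zero, one_mul, zero_mul] at this
  exact eq_neg_of_add_eq_zero_left this

theorem isHomogeneous_subst {n : ℕ} {P : MvPolynomial (Fin 3) ℂ} (hP : P.IsHomogeneous n)
    (g : Matrix (Fin 3) (Fin 3) ℂ) : (subst g P).IsHomogeneous n := by
  have := hP.aeval (fun k => ∑ l, C (g k l) * X l) (n := 1)
    (fun k => IsHomogeneous.sum _ _ _ fun l _ => by
      simpa using (isHomogeneous_C (Fin 3) (g k l)).mul (isHomogeneous_X ℂ l))
  rwa [one_mul] at this

theorem isUnit_of_isUnit_subst (g : GL (Fin 3) ℂ) {P : MvPolynomial (Fin 3) ℂ}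
    (h : IsUnit (subst g.1 P)) : IsUnit P := by
  have := h.map (subst (g⁻¹).1)
  rwa [subst_subst, ← Units.val_mul, mul_inv_cancel, Units.val_one, subst_one] at this

theorem pullback (h : DefinesFoliation N ω) (g : GL (Fin 3) ℂ) :
    DefinesFoliation N (ω.pullback g.1) := by
  refine ⟨fun j => ?_, ?_, fun d hd => ?_⟩
  · rw [pullback_apply]
    refine IsHomogeneous.sum _ _ _ fun i _ => ?_
    simpa using (isHomogeneous_C (Fin 3) (g.1 i j)).mul (isHomogeneous_subst (h.1 i) g.1)
  · refine MvPolynomial.funext fun p => ?_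
    have : (ω.pullback g.1).ev p p = 0 := by rw [ev_pullback, h.ev_self]
    simpa [ev, mul_comm] using this
  · refine isUnit_of_isUnit_subst g⁻¹ (h.2.2 _ fun i => ?_)
    have : ω = (ω.pullback g.1).pullback (g⁻¹).1 := by
      rw [pullback_pullback, ← Units.val_mul, mul_inv_cancel, Units.val_one, pullback_one]
    rw [this, pullback_apply]
    exact Finset.dvd_sum fun j _ => Dvd.dvd.mul_left (map_dvd _ (hd j)) _

theorem smul (h : DefinesFoliation N ω) {c : ℂ} (hc : c ≠ 0) : DefinesFoliation N (c • ω) := by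
  refine ⟨fun i => ?_, ?_, fun d hd => h.2.2 d fun i => ?_⟩
  · rw [Pi.smul_apply, smul_eq_C_mul]
    simpa using (isHomogeneous_C (Fin 3) c).mul (h.1 i)
  · have := congrArg (c • ·) h.2.1
    simpa [Finset.smul_sum] using this
  · have := Dvd.dvd.mul_left (hd i) (C c⁻¹)
    rwa [Pi.smul_apply, smul_eq_C_mul, ← mul_assoc, ← C_mul, inv_mul_cancel₀ hc, C_1,
      one_mul] at this

end DefinesFoliation

/-! ### Representatives and orbits -/

namespace Foliation

variable {N : ℕ}

theorem definesFoliation_form (F : Foliation N) : DefinesFoliation N F.form :=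
  (Quotient.out F).2

/-- The foliation defined by a homogeneous form. -/
def mk (ω : OneForm) (h : DefinesFoliation N ω) : Foliation N := FoliationForm.toFoliation ⟨ω, h⟩

theorem mk_eq_mk_iff {ω η : OneForm} {h : DefinesFoliation N ω} {h' : DefinesFoliation N η} :
    mk ω h = mk η h' ↔ ∃ c : ℂ, c ≠ 0 ∧ η = c • ω :=
  Quotient.eq (r := FoliationForm.setoid N)

theorem mk_form (F : Foliation N) : mk F.form F.definesFoliation_form = F :=
  Quotient.out_eq F

theorem exists_form_mk (ω : OneForm) (h : DefinesFoliation N ω) :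
    ∃ c : ℂ, c ≠ 0 ∧ (mk ω h).form = c • ω :=
  mk_eq_mk_iff.mp (mk_form (mk ω h)).symm

theorem mk_mem_orbit_iff {F : Foliation N} {η : OneForm} {h : DefinesFoliation N η} :
    mk η h ∈ F.orbit ↔ ∃ g : GL (Fin 3) ℂ, ∃ c : ℂ, c ≠ 0 ∧ η = c • F.form.pullback g.1 := by
  obtain ⟨e, he, h1⟩ := exists_form_mk η h
  constructor
  · rintro ⟨g, c, hc, h2⟩
    refine ⟨g, e⁻¹ * c, mul_ne_zero (inv_ne_zero he) hc, ?_⟩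
    rw [mul_smul, ← h2, h1, smul_smul, inv_mul_cancel₀ he, one_smul]
  · rintro ⟨g, c, hc, h2⟩
    exact ⟨g, e * c, mul_ne_zero he hc, by rw [h1, h2, smul_smul]⟩

theorem mem_orbit_self (F : Foliation N) : F ∈ F.orbit :=
  ⟨1, 1, one_ne_zero, by rw [Units.val_one, pullback_one, one_smul]⟩

theorem mem_orbit_symm {F G : Foliation N} (h : G ∈ F.orbit) : F ∈ G.orbit := by
  obtain ⟨g, c, hc, h⟩ := h
  refine ⟨g⁻¹, c⁻¹, inv_ne_zero hc, ?_⟩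
  rw [h, pullback_smul, pullback_pullback, ← Units.val_mul, mul_inv_cancel, Units.val_one,
    pullback_one, smul_smul, inv_mul_cancel₀ hc, one_smul]

theorem mem_orbit_trans {F G H : Foliation N} (h : G ∈ F.orbit) (h' : H ∈ G.orbit) :
    H ∈ F.orbit := by
  obtain ⟨g, c, hc, h⟩ := h
  obtain ⟨g', c', hc', h'⟩ := h'
  refine ⟨g * g', c' * c, mul_ne_zero hc' hc, ?_⟩
  rw [h', h, pullback_smul, pullback_pullback, smul_smul, Units.val_mul]

theorem orbit_eq_of_mem {F G : Foliation N} (h : G ∈ F.orbit) : G.orbit = F.orbit :=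
  Set.Subset.antisymm (fun _ hH => mem_orbit_trans h hH)
    fun _ hH => mem_orbit_trans (mem_orbit_symm h) hH

theorem mem_of_orbit_eq {F G : Foliation N} (h : F.orbit = G.orbit) : G ∈ F.orbit := by
  rw [h]
  exact G.mem_orbit_self

end Foliation

/-! ### Elimination and polynomial functions -/

/-- The image of an algebraic set under a coordinate projection contains a nonempty Zariski open
set as soon as it contains a set on which no nonzero polynomial vanishes. -/
theorem exists_ne_zero_forall_exists_eval_eq_zero {σ τ : Type*} [Finite σ] [Finite τ]
    (I : Set (MvPolynomial (σ ⊕ τ) ℂ)) (U : Set (σ → ℂ))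
    (hU : ∀ P : MvPolynomial σ ℂ, (∀ w ∈ U, eval w P = 0) → P = 0)
    (h : ∀ w ∈ U, ∃ y : τ → ℂ, ∀ f ∈ I, eval (Sum.elim w y) f = 0) :
    ∃ P : MvPolynomial σ ℂ, P ≠ 0 ∧
      ∀ w, eval w P ≠ 0 → ∃ y : τ → ℂ, ∀ f ∈ I, eval (Sum.elim w y) f = 0 := by
  set J : Ideal (MvPolynomial (σ ⊕ τ) ℂ) := Ideal.span I with hJ
  set φ : MvPolynomial σ ℂ →ₐ[ℂ] MvPolynomial (σ ⊕ τ) ℂ ⧸ J :=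
    (Ideal.Quotient.mkₐ ℂ J).comp (rename Sum.inl) with hφ
  -- A polynomial killed by `φ` vanishes on `U`: the projection of the algebraic set is dominant.
  have hinj : Function.Injective φ.toRingHom := by
    rw [injective_iff_map_eq_zero]
    intro P hP
    refine hU P fun w hw => ?_
    obtain ⟨y, hy⟩ := h w hw
    have h1 : rename Sum.inl P ∈ J := Ideal.Quotient.eq_zero_iff_mem.mp hP
    have h2 : J ≤ RingHom.ker (eval (Sum.elim w y)) := Ideal.span_le.mpr hy
    have h3 : eval (Sum.elim w y) (rename Sum.inl P) = 0 := h2 h1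
    rwa [eval_rename, Sum.elim_comp_inl] at h3
  have hfin : φ.toRingHom.FinitePresentation := by
    refine RingHom.FinitePresentation.of_finiteType.mp ?_
    refine RingHom.FiniteType.of_comp_finiteType (f := algebraMap ℂ (MvPolynomial σ ℂ)) ?_
    have : φ.toRingHom.comp (algebraMap ℂ (MvPolynomial σ ℂ)) =
        algebraMap ℂ (MvPolynomial (σ ⊕ τ) ℂ ⧸ J) := φ.comp_algebraMap
    rw [this, RingHom.finiteType_algebraMap]
    infer_instance
  -- Chevalley: the range on spectra is constructible. It contains the generic point, hence a piece
  -- whose equations `g` are all zero, that is, a basic open set.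
  obtain ⟨S, hS⟩ := PrimeSpectrum.exists_constructibleSetData_iff.mpr
    (PrimeSpectrum.isConstructible_range_comap hfin)
  obtain ⟨q₀, hq₀, hq₀'⟩ := Ideal.exists_comap_eq_of_mem_minimalPrimes_of_injective hinj
    (⊥ : Ideal (MvPolynomial σ ℂ)) (by simp [IsDomain.minimalPrimes_eq_singleton_bot])
  have hmem : (⟨⊥, Ideal.isPrime_bot⟩ : PrimeSpectrum (MvPolynomial σ ℂ)) ∈ S.toSet := by
    rw [hS]
    exact ⟨⟨q₀, hq₀⟩, PrimeSpectrum.ext hq₀'⟩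
  simp only [PrimeSpectrum.ConstructibleSetData.toSet, Set.mem_iUnion] at hmem
  obtain ⟨D, hD, hD1, hD2⟩ := hmem
  refine ⟨D.f, fun h0 => hD2 ?_, fun w hw => ?_⟩
  · rintro _ rfl
    exact h0
  have hg : ∀ i, D.g i = 0 := fun i => hD1 ⟨i, rfl⟩
  have hmw : (⟨RingHom.ker (eval w), RingHom.ker_isPrime _⟩ :
      PrimeSpectrum (MvPolynomial σ ℂ)) ∈ S.toSet := by
    simp only [PrimeSpectrum.ConstructibleSetData.toSet, Set.mem_iUnion]
    refine ⟨D, hD, ?_, fun h' => hw (h' rfl)⟩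
    rintro _ ⟨i, rfl⟩
    simp [hg]
  rw [hS] at hmw
  obtain ⟨q, hq⟩ := hmw
  have hq' : q.asIdeal.comap φ.toRingHom = RingHom.ker (eval w) :=
    congrArg PrimeSpectrum.asIdeal hq
  -- Nullstellensatz: a maximal ideal above a prime lying over `w` is a point of the algebraic set
  -- over `w`.
  obtain ⟨M, hM, hqM⟩ := Ideal.exists_le_maximal q.asIdeal q.isPrime.ne_top
  have hM' : (M.comap (Ideal.Quotient.mk J)).IsMaximal :=
    Ideal.comap_isMaximal_of_surjective _ Ideal.Quotient.mk_surjective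
  obtain ⟨x, hx⟩ := isMaximal_iff_eq_vanishingIdeal_singleton.mp hM'
  have hxz : ∀ f, f ∈ M.comap (Ideal.Quotient.mk J) → eval x f = 0 := by
    intro f hf
    rw [hx, mem_vanishingIdeal_singleton_iff] at hf
    simpa [coe_aeval_eq_eval] using hf
  have hxw : ∀ i, x (Sum.inl i) = w i := by
    intro i
    have h1 : (X i - C (w i) : MvPolynomial σ ℂ) ∈ q.asIdeal.comap φ.toRingHom := by
      rw [hq']
      simp [RingHom.mem_ker]
    have h2 := hxz (X (Sum.inl i) - C (w i)) (hqM (by simpa [hφ] using h1))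
    simpa [sub_eq_zero] using h2
  refine ⟨x ∘ Sum.inr, fun f hf => ?_⟩
  have : Sum.elim w (x ∘ Sum.inr) = x := by
    funext i
    rcases i with i | i
    · exact (hxw i).symm
    · rfl
  rw [this]
  refine hxz f ?_
  rw [Ideal.mem_comap, Ideal.Quotient.eq_zero_iff_mem.mpr (Ideal.subset_span hf)]
  exact M.zero_mem

/-- A function on `ℂ^ι` given by a polynomial. -/
def IsPolyFun {ι : Type*} (f : (ι → ℂ) → ℂ) : Prop :=
  ∃ P : MvPolynomial ι ℂ, ∀ x, eval x P = f x

namespace IsPolyFun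

variable {ι : Type*} {f g : (ι → ℂ) → ℂ}

theorem const (c : ℂ) : IsPolyFun fun _ : ι → ℂ => c := ⟨C c, fun _ => by simp⟩

theorem coord (i : ι) : IsPolyFun fun x : ι → ℂ => x i := ⟨X i, fun _ => by simp⟩

theorem add (hf : IsPolyFun f) (hg : IsPolyFun g) : IsPolyFun fun x => f x + g x := by
  obtain ⟨P, hP⟩ := hf
  obtain ⟨Q, hQ⟩ := hg
  exact ⟨P + Q, fun x => by simp [hP, hQ]⟩

theorem mul (hf : IsPolyFun f) (hg : IsPolyFun g) : IsPolyFun fun x => f x * g x := by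
  obtain ⟨P, hP⟩ := hf
  obtain ⟨Q, hQ⟩ := hg
  exact ⟨P * Q, fun x => by simp [hP, hQ]⟩

theorem neg (hf : IsPolyFun f) : IsPolyFun fun x => -f x := by
  obtain ⟨P, hP⟩ := hf
  exact ⟨-P, fun x => by simp [hP]⟩

theorem sub (hf : IsPolyFun f) (hg : IsPolyFun g) : IsPolyFun fun x => f x - g x := by
  simpa only [sub_eq_add_neg] using hf.add hg.neg

theorem sum {κ : Type*} (s : Finset κ) {F : κ → (ι → ℂ) → ℂ} (h : ∀ k ∈ s, IsPolyFun (F k)) :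
    IsPolyFun fun x => ∑ k ∈ s, F k x := by
  choose! P hP using h
  exact ⟨∑ k ∈ s, P k, fun x => by
    rw [map_sum]
    exact Finset.sum_congr rfl fun k hk => hP k hk x⟩

theorem prod {κ : Type*} (s : Finset κ) {F : κ → (ι → ℂ) → ℂ} (h : ∀ k ∈ s, IsPolyFun (F k)) :
    IsPolyFun fun x => ∏ k ∈ s, F k x := by
  choose! P hP using h
  exact ⟨∏ k ∈ s, P k, fun x => by
    rw [map_prod]
    exact Finset.prod_congr rfl fun k hk => hP k hk x⟩

end IsPolyFun

/-- A polynomial vanishing on a neighbourhood of a point vanishes. -/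
theorem eq_zero_of_eventually_eval_eq_zero {σ : Type*} [Fintype σ] {P : MvPolynomial σ ℂ}
    {w₀ : σ → ℂ} (h : ∀ᶠ w in 𝓝 w₀, eval w P = 0) : P = 0 := by
  have h1 : AnalyticOnNhd ℂ (fun w => eval w P) Set.univ := AnalyticOnNhd.eval_mvPolynomial P
  have h2 := h1.eq_of_eventuallyEq (g := fun _ => 0) analyticOnNhd_const h
  exact MvPolynomial.funext fun w => by simpa using congrFun h2 w

/-! ### Finiteness of the singular set -/

/-- The homogeneous prime ideal of the line spanned by `p`. -/
def lineHom (p : Fin 3 → ℂ) : MvPolynomial (Fin 3) ℂ →ₐ[ℂ] Polynomial ℂ :=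
  aeval fun i => Polynomial.C (p i) * Polynomial.X

theorem eval_lineHom (p : Fin 3 → ℂ) (t : ℂ) (P : MvPolynomial (Fin 3) ℂ) :
    (lineHom p P).eval t = eval (t • p) P := by
  induction P using MvPolynomial.induction_on with
  | C a => simp [lineHom]
  | add P Q hP hQ => simp [hP, hQ]
  | mul_X P i hP =>
    rw [map_mul, Polynomial.eval_mul, hP, map_mul]
    rw [show lineHom p (X i) = Polynomial.C (p i) * Polynomial.X from aeval_X _ _]
    simp [mul_comm t]

namespace DefinesFoliation

variable {N : ℕ} {ω : OneForm}

theorem eval_smul (h : DefinesFoliation N ω) (c : ℂ) (p : Fin 3 → ℂ) (i : Fin 3) :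
    eval (c • p) (ω i) = c ^ (N + 1) * eval p (ω i) := by
  rw [← OneForm.ev_single, h.ev_smul_left, OneForm.ev_single]

/-- A smaller prime `q` over the coefficients would give a chain `0 < (π) < q < ker (lineHom p) <
𝔪`, with `π ∈ q` a prime element and `𝔪` the ideal of the origin: length four in a ring of dimension
three. The absence of a common factor makes `(π) < q` strict. -/
theorem ker_lineHom_mem_minimalPrimes (h : DefinesFoliation N ω) {p : Fin 3 → ℂ} (hp : p ≠ 0)
    (hs : ∀ i, eval p (ω i) = 0) :
    RingHom.ker (lineHom p) ∈ (Ideal.span (Set.range ω)).minimalPrimes := by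
  have hprime : (RingHom.ker (lineHom p)).IsPrime := RingHom.ker_isPrime _
  have hle : Ideal.span (Set.range ω) ≤ RingHom.ker (lineHom p) := by
    rw [Ideal.span_le]
    rintro _ ⟨i, rfl⟩
    refine Polynomial.funext fun t => ?_
    rw [eval_lineHom, h.eval_smul, hs, mul_zero, Polynomial.eval_zero]
  refine ⟨⟨hprime, hle⟩, ?_⟩
  rintro q ⟨hq, hIq⟩ hqp
  by_contra hlt
  have hlt1 : q < RingHom.ker (lineHom p) := lt_of_le_not_ge hqp hlt
  have hω : ∀ i, ω i ∈ q := fun i => hIq (Ideal.subset_span ⟨i, rfl⟩)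
  have hq0 : q ≠ ⊥ := by
    rintro rfl
    refine not_isUnit_zero (h.2.2 0 fun i => ?_)
    rw [(Ideal.mem_bot).mp (hω i)]
  obtain ⟨π, hπq, hπ⟩ := hq.exists_mem_prime_of_ne_bot hq0
  have hπ1 : (Ideal.span {π}).IsPrime := (Ideal.span_singleton_prime hπ.ne_zero).mpr hπ
  have hlt2 : Ideal.span {π} < q := by
    refine lt_of_le_of_ne ((Ideal.span_singleton_le_iff_mem _).mpr hπq) ?_
    rintro rfl
    exact hπ.not_isUnit (h.2.2 π fun i => Ideal.mem_span_singleton.mp (hω i))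
  have hlt3 : (⊥ : Ideal (MvPolynomial (Fin 3) ℂ)) < Ideal.span {π} := by
    rw [bot_lt_iff_ne_bot, Ne, Ideal.span_singleton_eq_bot]
    exact hπ.ne_zero
  have hm : (RingHom.ker (eval (0 : Fin 3 → ℂ))).IsPrime := RingHom.ker_isPrime _
  have hlt4 : RingHom.ker (lineHom p) < RingHom.ker (eval (0 : Fin 3 → ℂ)) := by
    refine lt_of_le_not_ge (fun f hf => ?_) fun hge => ?_
    · have h1 : lineHom p f = 0 := hf
      have h2 := eval_lineHom p 0 f
      rw [h1, Polynomial.eval_zero, zero_smul] at h2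
      exact h2.symm
    · obtain ⟨i, hi⟩ := Function.ne_iff.mp hp
      have h1 : lineHom p (X i) = 0 :=
        hge (show X i ∈ RingHom.ker (eval (0 : Fin 3 → ℂ)) by simp [RingHom.mem_ker])
      have h2 := congrArg (Polynomial.eval 1) h1
      rw [eval_lineHom] at h2
      exact hi (by simpa using h2)
  have hdim : ringKrullDim (MvPolynomial (Fin 3) ℂ) = 3 := by
    rw [MvPolynomial.ringKrullDim_of_isNoetherianRing]
    simp
  have hbot : (⊥ : Ideal (MvPolynomial (Fin 3) ℂ)).IsPrime := Ideal.isPrime_bot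
  have e1 := Ideal.height_add_one_le_of_lt_of_isPrime hlt3
  have e2 := Ideal.height_add_one_le_of_lt_of_isPrime hlt2
  have e3 := Ideal.height_add_one_le_of_lt_of_isPrime hlt1
  have e4 := Ideal.height_add_one_le_of_lt_of_isPrime hlt4
  have e5 := Ideal.height_le_ringKrullDim_of_isPrime (I := RingHom.ker (eval (0 : Fin 3 → ℂ)))
  rw [hdim] at e5
  have e6 : (RingHom.ker (eval (0 : Fin 3 → ℂ))).height ≤ 3 :=
    WithBot.coe_le_coe.mp e5
  rw [Ideal.height_bot, zero_add] at e1
  have e7 : (4 : ℕ∞) ≤ (RingHom.ker (eval (0 : Fin 3 → ℂ))).height :=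
    calc (4 : ℕ∞) = 1 + 1 + 1 + 1 := by norm_num
      _ ≤ (RingHom.ker (lineHom p)).height + 1 := by
        gcongr
        refine le_trans ?_ e3
        gcongr
        refine le_trans ?_ e2
        gcongr
      _ ≤ _ := e4
  exact absurd (e7.trans e6) (by norm_num)

end DefinesFoliation

/-- Singular points inject into the minimal primes of the ideal of coefficients, which are finitely
many in a Noetherian ring. -/
theorem Foliation.finite_setOf_isSingular {N : ℕ} (F : Foliation N) :
    {m | F.IsSingular m}.Finite := by
  refine Set.Finite.of_finite_image (f := fun m : ℙ ℂ (Fin 3 → ℂ) => RingHom.ker (lineHom m.rep))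
    ((Ideal.finite_minimalPrimes_of_isNoetherianRing _ (Ideal.span (Set.range F.form))).subset ?_)
    ?_
  · rintro _ ⟨m, hm, rfl⟩
    exact F.definesFoliation_form.ker_lineHom_mem_minimalPrimes m.rep_nonzero hm
  · intro m _ m' _ hmm
    obtain ⟨k, hk⟩ := Function.ne_iff.mp m.rep_nonzero
    have h1 : ∀ i, m.rep k * m'.rep i = m.rep i * m'.rep k := by
      intro i
      have h2 : (C (m.rep k) * X i - C (m.rep i) * X k : MvPolynomial (Fin 3) ℂ) ∈
          RingHom.ker (lineHom m.rep) := by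
        refine (RingHom.mem_ker).mpr (Polynomial.funext fun t => ?_)
        rw [eval_lineHom]
        simp
        ring
      have hmm' : RingHom.ker (lineHom m.rep) = RingHom.ker (lineHom m'.rep) := hmm
      rw [hmm'] at h2
      have h4 := congrArg (Polynomial.eval 1) ((RingHom.mem_ker).mp h2)
      rw [eval_lineHom] at h4
      simpa [sub_eq_zero] using h4
    have h5 : m'.rep = (m'.rep k / m.rep k) • m.rep := by
      funext i
      have := h1 i
      have hk' : m.rep k ≠ 0 := hk
      rw [Pi.smul_apply, smul_eq_mul]
      field_simp
      linear_combination this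
    rw [← m.mk_rep, ← m'.mk_rep]
    refine ((Projectivization.mk_eq_mk_iff' ℂ _ _ _ _).mpr ⟨m'.rep k / m.rep k, h5.symm⟩).symm

/-! ### Multiplicity one and the Jacobian determinant -/

/-- Hadamard's lemma for analytic functions. -/
theorem AnalyticAt.exists_eq_add_apply_sub {𝕜 E F : Type*} [NontriviallyNormedField 𝕜]
    [NormedAddCommGroup E] [NormedSpace 𝕜 E] [NormedAddCommGroup F] [NormedSpace 𝕜 F]
    [CompleteSpace F] {f : E → F} {a : E} (hf : AnalyticAt 𝕜 f a) :
    ∃ G : E → E →L[𝕜] F, AnalyticAt 𝕜 G a ∧ ∀ᶠ x in 𝓝 a, f x = f a + G x (x - a) := by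
  obtain ⟨p, r, hp⟩ := hf
  have hr : 0 < p.shift.radius := by
    rw [p.radius_shift]
    exact hp.r_pos.trans_le hp.r_le
  have hq := p.shift.hasFPowerSeriesOnBall hr
  -- Peeling the last argument off each term of the power series leaves a series that sums to the
  -- factor `G`.
  refine ⟨fun x => p.shift.sum (x - a), ?_, ?_⟩
  · have := hq.comp_sub a
    rw [zero_add] at this
    exact this.analyticAt
  · filter_upwards [Metric.eball_mem_nhds a hp.r_pos] with x hx
    have hx1 : x - a ∈ Metric.eball (0 : E) r := by
      simpa [edist_eq_enorm_sub] using hx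
    have hx2 : x - a ∈ Metric.eball (0 : E) p.shift.radius := by
      refine Metric.eball_subset_eball ?_ hx1
      rw [p.radius_shift]
      exact hp.r_le
    have h1 := (hq.hasSum hx2).mapL (ContinuousLinearMap.apply 𝕜 F (x - a))
    have h2 := hp.hasSum hx1
    rw [← hasSum_nat_add_iff' 1] at h2
    have h3 : (fun n => (ContinuousLinearMap.apply 𝕜 F (x - a)) (p.shift n fun _ => x - a)) =
        fun n => p (n + 1) fun _ => x - a := by
      funext n
      change (p (n + 1)).curryRight (fun _ => x - a) (x - a) = _
      rw [ContinuousMultilinearMap.curryRight_apply]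
      congr 1
      funext i
      refine Fin.lastCases ?_ (fun j => ?_) i <;> simp
    rw [h3] at h1
    have h4 := h2.unique h1
    rw [add_sub_cancel, Finset.sum_range_one, sub_eq_iff_eq_add', hp.coeff_zero, zero_add] at h4
    exact h4

/-- The germ of an analytic function. -/
def analyticGerm {a : Fin 2 → ℂ} {g : (Fin 2 → ℂ) → ℂ} (hg : AnalyticAt ℂ g a) :
    holomorphicGerms a :=
  ⟨(g : Filter.Germ (𝓝 a) ℂ), g, hg, rfl⟩

theorem exists_analyticGerm_eq {a : Fin 2 → ℂ} (f : holomorphicGerms a) :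
    ∃ g : (Fin 2 → ℂ) → ℂ, ∃ hg : AnalyticAt ℂ g a, analyticGerm hg = f := by
  obtain ⟨f, g, hg, rfl⟩ := f
  exact ⟨g, hg, rfl⟩

theorem analyticGerm_eq_iff {a : Fin 2 → ℂ} {g h : (Fin 2 → ℂ) → ℂ} {hg : AnalyticAt ℂ g a}
    {hh : AnalyticAt ℂ h a} : analyticGerm hg = analyticGerm hh ↔ g =ᶠ[𝓝 a] h := by
  rw [Subtype.ext_iff]
  exact Filter.Germ.coe_eq

theorem analyticAt_eval {σ : Type*} [Fintype σ] (P : MvPolynomial σ ℂ) (a : σ → ℂ) :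
    AnalyticAt ℂ (fun x => eval x P) a :=
  AnalyticOnNhd.eval_mvPolynomial P a (Set.mem_univ a)

/-- Hadamard's lemma in coordinates; the values of the factors at `a` come from comparing
derivatives along lines. -/
theorem exists_eval_eq_mul_sub (a : Fin 2 → ℂ) {P : MvPolynomial (Fin 2) ℂ}
    (hP : eval a P = 0) : ∃ g : Fin 2 → (Fin 2 → ℂ) → ℂ, (∀ i, AnalyticAt ℂ (g i) a) ∧
      (∀ i, g i a = eval a (pderiv i P)) ∧
      ∀ᶠ x in 𝓝 a, eval x P = g 0 x * (x 0 - a 0) + g 1 x * (x 1 - a 1) := by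
  obtain ⟨G, hG, h⟩ := (analyticAt_eval P a).exists_eq_add_apply_sub
  have hd : HasFDerivAt (fun x => eval x P) (G a) a := by
    have h1 := (hG.differentiableAt.hasFDerivAt.clm_apply
      ((hasFDerivAt_id a).sub_const a)).const_add (eval a P)
    refine (h1.congr_of_eventuallyEq h).congr_fderiv ?_
    ext v
    simp
  have hline : ∀ w : Fin 2 → ℂ, G a w = ∑ j, eval a (pderiv j P) * w j := by
    intro w
    refine HasDerivAt.unique ?_ (hasDerivAt_eval_line P a w)
    have h2 : HasDerivAt (fun t : ℂ => a + t • w) w 0 := by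
      simpa using ((hasDerivAt_id (0 : ℂ)).smul_const w).const_add a
    have h3 : HasFDerivAt (fun x => eval x P) (G a) (a + (0 : ℂ) • w) := by simpa using hd
    exact h3.comp_hasDerivAt (0 : ℂ) h2
  refine ⟨fun i x => G x (Pi.single i 1), fun i => ?_, fun i => ?_, ?_⟩
  · exact (ContinuousLinearMap.apply ℂ ℂ (Pi.single i (1 : ℂ))).analyticAt _ |>.comp hG
  · simp [hline, Pi.single_apply]
  · filter_upwards [h] with x hx
    rw [hx, hP, zero_add]
    have : x - a = (x 0 - a 0) • Pi.single 0 1 + (x 1 - a 1) • Pi.single 1 1 := by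
      funext i
      fin_cases i <;> simp
    rw [this, map_add, map_smul, map_smul, smul_eq_mul, smul_eq_mul]
    ring

/-- A common zero of two polynomials has multiplicity one exactly when the Jacobian determinant
does not vanish there. -/
theorem multiplicity_eq_one_iff (a : Fin 2 → ℂ) {P Q : MvPolynomial (Fin 2) ℂ}
    (hP : eval a P = 0) (hQ : eval a Q = 0) :
    Cardinal.toENat (Module.rank ℂ (holomorphicGerms a ⧸
      Ideal.span {polynomialGerm a P, polynomialGerm a Q})) = 1 ↔
    eval a (pderiv 0 P) * eval a (pderiv 1 Q) - eval a (pderiv 1 P) * eval a (pderiv 0 Q) ≠ 0 := by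
  set I := Ideal.span {polynomialGerm a P, polynomialGerm a Q} with hI
  have hfree : Module.Free ℂ (holomorphicGerms a ⧸ I) := Module.Free.of_divisionRing _ _
  rw [Cardinal.toENat_eq_one, rank_eq_one_iff]
  have hmem : ∀ f ∈ I, ∃ α β : (Fin 2 → ℂ) → ℂ, AnalyticAt ℂ α a ∧ AnalyticAt ℂ β a ∧
      ∃ g, ∃ hg : AnalyticAt ℂ g a, analyticGerm hg = f ∧
      ∀ᶠ x in 𝓝 a, g x = α x * eval x P + β x * eval x Q := by
    intro f hf
    obtain ⟨u, v, huv⟩ := Ideal.mem_span_pair.mp hf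
    obtain ⟨α, hα, rfl⟩ := exists_analyticGerm_eq u
    obtain ⟨β, hβ, rfl⟩ := exists_analyticGerm_eq v
    exact ⟨α, β, hα, hβ, _, (hα.mul (analyticAt_eval P a)).add (hβ.mul (analyticAt_eval Q a)),
      huv, Filter.Eventually.of_forall fun x => rfl⟩
  have h1I : (1 : holomorphicGerms a) ∉ I := by
    intro h
    obtain ⟨α, β, hα, hβ, g, hg, hg1, hgx⟩ := hmem 1 h
    have h1 : (1 : holomorphicGerms a) = analyticGerm (analyticAt_const (v := (1 : ℂ))) := rfl
    rw [h1, analyticGerm_eq_iff] at hg1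
    have h2 := hg1.eq_of_nhds
    rw [hgx.self_of_nhds, hP, hQ] at h2
    simp at h2
  constructor
  · rintro ⟨e, -, he⟩ hdet
    -- Along a kernel vector `w` of the Jacobian matrix, every element of `I` has zero derivative.
    -- In a quotient of dimension one, the coordinate `x i` with `w i ≠ 0` would be constant modulo
    -- `I`, yet its derivative along `w` is `w i`.
    obtain ⟨w, hw0, hwP, hwQ⟩ : ∃ w : Fin 2 → ℂ, w ≠ 0 ∧ ∑ j, eval a (pderiv j P) * w j = 0 ∧
        ∑ j, eval a (pderiv j Q) * w j = 0 := by
      have hM : (Matrix.of ![fun j => eval a (pderiv j P), fun j => eval a (pderiv j Q)] :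
          Matrix (Fin 2) (Fin 2) ℂ).det = 0 := by
        rw [Matrix.det_fin_two]
        simpa using hdet
      obtain ⟨w, hw, h⟩ := Matrix.exists_mulVec_eq_zero_iff.mpr hM
      exact ⟨w, hw, congrFun h 0, congrFun h 1⟩
    obtain ⟨i, hi⟩ := Function.ne_iff.mp hw0
    obtain ⟨c₁, hc₁⟩ := he (Ideal.Quotient.mk I 1)
    have hc₁0 : c₁ ≠ 0 := by
      rintro rfl
      rw [zero_smul] at hc₁
      exact h1I (Ideal.Quotient.eq_zero_iff_mem.mp hc₁.symm)
    have hl : AnalyticAt ℂ (fun x : Fin 2 → ℂ => x i - a i) a := by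
      exact (analyticAt_eval (X i - C (a i)) a).congr (Filter.Eventually.of_forall fun x => by simp)
    obtain ⟨c₂, hc₂⟩ := he (Ideal.Quotient.mk I (analyticGerm hl))
    have hc : analyticGerm hl - (c₂ * c₁⁻¹) • (1 : holomorphicGerms a) ∈ I := by
      rw [← Ideal.Quotient.eq_zero_iff_mem, map_sub, ← Ideal.Quotient.mkₐ_eq_mk ℂ, map_smul,
        Ideal.Quotient.mkₐ_eq_mk, ← hc₂, ← hc₁, smul_smul, mul_assoc, inv_mul_cancel₀ hc₁0,
        mul_one, sub_self]
    obtain ⟨α, β, hα, hβ, g, hg, hg1, hgx⟩ := hmem _ hc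
    have hsub : AnalyticAt ℂ (fun x : Fin 2 → ℂ => x i - a i - (c₂ * c₁⁻¹) • 1) a :=
      hl.sub analyticAt_const
    have h1 : analyticGerm hl - (c₂ * c₁⁻¹) • (1 : holomorphicGerms a) = analyticGerm hsub := rfl
    rw [h1, analyticGerm_eq_iff] at hg1
    have hfin : ∀ᶠ x in 𝓝 a, x i - a i - (c₂ * c₁⁻¹) • (1 : ℂ) =
        α x * eval x P + β x * eval x Q := by
      filter_upwards [hg1, hgx] with x hx1 hx2
      rw [← hx1, hx2]
    have hline : HasDerivAt (fun t : ℂ => a + t • w) w 0 := by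
      simpa using ((hasDerivAt_id (0 : ℂ)).smul_const w).const_add a
    have htend : Filter.Tendsto (fun t : ℂ => a + t • w) (𝓝 0) (𝓝 a) := by
      have := hline.continuousAt.tendsto
      simpa using this
    have hα' : DifferentiableAt ℂ (fun t : ℂ => α (a + t • w)) 0 := by
      have : DifferentiableAt ℂ α (a + (0 : ℂ) • w) := by simpa using hα.differentiableAt
      exact this.comp (0 : ℂ) hline.differentiableAt
    have hβ' : DifferentiableAt ℂ (fun t : ℂ => β (a + t • w)) 0 := by
      have : DifferentiableAt ℂ β (a + (0 : ℂ) • w) := by simpa using hβ.differentiableAt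
      exact this.comp (0 : ℂ) hline.differentiableAt
    have hD := (hα'.hasDerivAt.mul (hasDerivAt_eval_line P a w)).add
      (hβ'.hasDerivAt.mul (hasDerivAt_eval_line Q a w))
    have hD2 : HasDerivAt (fun t : ℂ => (a + t • w) i - a i - (c₂ * c₁⁻¹) • (1 : ℂ)) (w i) 0 := by
      have := (((hasDerivAt_id (0 : ℂ)).mul_const (w i)).const_add (a i)).sub_const (a i)
        |>.sub_const ((c₂ * c₁⁻¹) • (1 : ℂ))
      simpa using this
    have hD3 := hD2.unique (hD.congr_of_eventuallyEq (htend.eventually hfin))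
    simp only [zero_smul, add_zero, hP, hQ, hwP, hwQ, mul_zero] at hD3
    exact hi hD3
  · intro hdet
    refine ⟨Ideal.Quotient.mk I 1, fun h => h1I (Ideal.Quotient.eq_zero_iff_mem.mp h), fun f => ?_⟩
    obtain ⟨f, rfl⟩ := Ideal.Quotient.mk_surjective f
    obtain ⟨f, hf, rfl⟩ := exists_analyticGerm_eq f
    obtain ⟨p, hp, hpa, hpx⟩ := exists_eval_eq_mul_sub a hP
    obtain ⟨q, hq, hqa, hqx⟩ := exists_eval_eq_mul_sub a hQ
    obtain ⟨G, hG, hGx⟩ := hf.exists_eq_add_apply_sub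
    -- `D` is the determinant of the matrix expressing `P`, `Q` through the coordinates. It is
    -- invertible near `a`, so Cramer's rule writes `f - f a` as a combination of `P` and `Q`.
    set D : (Fin 2 → ℂ) → ℂ := fun x => p 0 x * q 1 x - p 1 x * q 0 x with hD
    have hDa : AnalyticAt ℂ D a := ((hp 0).mul (hq 1)).sub ((hp 1).mul (hq 0))
    have hD0 : D a ≠ 0 := by simpa [hD, hpa, hqa] using hdet
    have hg : ∀ i, AnalyticAt ℂ (fun x => G x (Pi.single i 1)) a := fun i =>
      ((ContinuousLinearMap.apply ℂ ℂ (Pi.single i 1 : Fin 2 → ℂ)).analyticAt (G a)).comp hG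
    have hα : AnalyticAt ℂ (fun x => (D x)⁻¹ *
        (G x (Pi.single 0 1) * q 1 x - G x (Pi.single 1 1) * q 0 x)) a :=
      (hDa.inv hD0).mul (((hg 0).mul (hq 1)).sub ((hg 1).mul (hq 0)))
    have hβ : AnalyticAt ℂ (fun x => (D x)⁻¹ *
        (G x (Pi.single 1 1) * p 0 x - G x (Pi.single 0 1) * p 1 x)) a :=
      (hDa.inv hD0).mul (((hg 1).mul (hp 0)).sub ((hg 0).mul (hp 1)))
    refine ⟨f a, ?_⟩
    rw [← Ideal.Quotient.mkₐ_eq_mk ℂ, ← map_smul, Ideal.Quotient.mkₐ_eq_mk, eq_comm,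
      Ideal.Quotient.eq]
    refine Ideal.mem_span_pair.mpr ⟨analyticGerm hα, analyticGerm hβ, ?_⟩
    have hfa : AnalyticAt ℂ (fun x => f x - f a • 1) a := hf.sub analyticAt_const
    have h1 : analyticGerm hf - f a • (1 : holomorphicGerms a) = analyticGerm hfa := rfl
    have h2 : analyticGerm hα * polynomialGerm a P + analyticGerm hβ * polynomialGerm a Q =
        analyticGerm ((hα.mul (analyticAt_eval P a)).add (hβ.mul (analyticAt_eval Q a))) := rfl
    rw [h1, h2, analyticGerm_eq_iff]
    filter_upwards [hpx, hqx, hGx, hDa.continuousAt.eventually_ne hD0] with x h3 h4 h5 h6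
    have h7 : x - a = (x 0 - a 0) • Pi.single 0 1 + (x 1 - a 1) • Pi.single 1 1 := by
      funext i
      fin_cases i <;> simp
    rw [h7, map_add, map_smul, map_smul, smul_eq_mul, smul_eq_mul] at h5
    simp only [Pi.add_apply, Pi.mul_apply, h3, h4, h5, smul_eq_mul, mul_one]
    field_simp
    rw [hD]
    ring

/-! ### Baum–Bott invariants in arbitrary frames -/

/-- The vectors `a`, `b`, `p` form a basis of `ℂ³`. -/
def IsFrame (a b p : Fin 3 → ℂ) : Prop := (Matrix.of ![a, b, p]).det ≠ 0

namespace IsFrame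

variable {a b p : Fin 3 → ℂ}

theorem exists_combination (h : IsFrame a b p) (v : Fin 3 → ℂ) :
    ∃ s t u : ℂ, v = s • a + t • b + u • p := by
  have hu : IsUnit (Matrix.of ![a, b, p]).det := isUnit_iff_ne_zero.mpr h
  set x := Matrix.vecMul v (Matrix.of ![a, b, p])⁻¹ with hx
  have h1 : Matrix.vecMul x (Matrix.of ![a, b, p]) = v := by
    rw [hx, Matrix.vecMul_vecMul, Matrix.nonsing_inv_mul _ hu, Matrix.vecMul_one]
  refine ⟨x 0, x 1, x 2, ?_⟩
  rw [← h1]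
  funext i
  simp [Matrix.vecMul, dotProduct, Fin.sum_univ_three]

theorem mulVec (h : IsFrame a b p) (g : GL (Fin 3) ℂ) :
    IsFrame (g.1.mulVec a) (g.1.mulVec b) (g.1.mulVec p) := by
  have h1 : Matrix.of ![g.1.mulVec a, g.1.mulVec b, g.1.mulVec p] =
      Matrix.of ![a, b, p] * g.1.transpose := by
    ext i j
    rw [← Matrix.vecMul_transpose, ← Matrix.vecMul_transpose, ← Matrix.vecMul_transpose]
    fin_cases i <;> rfl
  have h2 : g.1.det ≠ 0 := ((Matrix.isUnit_iff_isUnit_det _).mp g.isUnit).ne_zero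
  rw [IsFrame, h1, Matrix.det_mul, Matrix.det_transpose]
  exact mul_ne_zero h h2

/-- The invertible matrix with columns `a`, `b`, `p`. -/
def toGL (h : IsFrame a b p) : GL (Fin 3) ℂ :=
  Matrix.GeneralLinearGroup.mkOfDetNeZero (Matrix.of ![a, b, p]).transpose
    (by rwa [Matrix.det_transpose])

theorem toGL_mulVec (h : IsFrame a b p) (x : Fin 3 → ℂ) :
    h.toGL.1.mulVec x = x 0 • a + x 1 • b + x 2 • p := by
  funext i
  change ((Matrix.of ![a, b, p]).transpose.mulVec x) i = _
  simp [Matrix.mulVec, dotProduct, Fin.sum_univ_three, mul_comm]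

theorem ne_zero (h : IsFrame a b p) : p ≠ 0 := by
  rintro rfl
  exact h (Matrix.det_eq_zero_of_row_eq_zero 2 fun j => rfl)

theorem swap (h : IsFrame a b p) : IsFrame b a p := by
  rw [IsFrame, Matrix.det_fin_three] at h ⊢
  contrapose! h
  simp at h ⊢
  linear_combination -h

theorem add_smul (h : IsFrame a b p) (s : ℂ) : IsFrame a (b + s • a) p := by
  rw [IsFrame, Matrix.det_fin_three] at h ⊢
  contrapose! h
  simp at h ⊢
  linear_combination h

end IsFrame

namespace OneForm

/-- The determinant of the linear part of the form at `p`, in the directions `a`, `b`. -/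
def jacDet (ω : OneForm) (p a b : Fin 3 → ℂ) : ℂ :=
  ω.der p a a * ω.der p b b - ω.der p a b * ω.der p b a

/-- The trace of the linear part at `p`, in the directions `a`, `b`, of a field tangent to the
form. -/
def jacTr (ω : OneForm) (p a b : Fin 3 → ℂ) : ℂ := ω.der p a b - ω.der p b a

/-- `z` is the Baum–Bott invariant of the form at a nondegenerate singular point. -/
def HasBB (ω : OneForm) (z : ℂ) : Prop :=
  ∃ a b p, IsFrame a b p ∧ (∀ v, ω.ev p v = 0) ∧ ω.jacDet p a b ≠ 0 ∧
    ω.jacTr p a b ^ 2 = z * ω.jacDet p a b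

theorem HasBB.smul {ω : OneForm} {z : ℂ} (h : ω.HasBB z) {c : ℂ} (hc : c ≠ 0) :
    (c • ω).HasBB z := by
  obtain ⟨a, b, p, h1, h2, h3, h4⟩ := h
  have h5 : (c • ω).jacDet p a b = c ^ 2 * ω.jacDet p a b := by
    simp only [jacDet, der_smul]
    ring
  have h6 : (c • ω).jacTr p a b = c * ω.jacTr p a b := by
    simp only [jacTr, der_smul]
    ring
  refine ⟨a, b, p, h1, fun v => by rw [ev_smul, h2, mul_zero], ?_, ?_⟩
  · rw [h5]
    exact mul_ne_zero (pow_ne_zero 2 hc) h3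
  · rw [h5, h6]
    linear_combination c ^ 2 * h4

theorem HasBB.of_pullback {ω : OneForm} {z : ℂ} {g : GL (Fin 3) ℂ}
    (h : (ω.pullback g.1).HasBB z) : ω.HasBB z := by
  obtain ⟨a, b, p, h1, h2, h3, h4⟩ := h
  refine ⟨g.1.mulVec a, g.1.mulVec b, g.1.mulVec p, h1.mulVec g, fun v => ?_, ?_, ?_⟩
  · have := h2 ((g⁻¹).1.mulVec v)
    rwa [ev_pullback, Matrix.mulVec_mulVec, ← Units.val_mul, mul_inv_cancel, Units.val_one,
      Matrix.one_mulVec] at this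
  · simpa only [jacDet, der_pullback] using h3
  · simpa only [jacDet, jacTr, der_pullback] using h4

end OneForm

namespace DefinesFoliation

open OneForm

variable {N : ℕ} {ω : OneForm}

theorem der_smul_point (h : DefinesFoliation N ω) {c : ℂ} (hc : c ≠ 0) (p w v : Fin 3 → ℂ) :
    ω.der (c • p) w v = c ^ N * ω.der p w v := by
  have h1 : HasDerivAt (fun t : ℂ => c ^ (N + 1) * ω.ev (p + t • w) v)
      (c ^ (N + 1) * ω.der p w v) 0 := (hasDerivAt_ev ω p w v).const_mul _
  have h2 := (hasDerivAt_ev ω (c • p) (c • w) v)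
  have h3 : (fun t : ℂ => ω.ev (c • p + t • c • w) v) =
      fun t : ℂ => c ^ (N + 1) * ω.ev (p + t • w) v := by
    funext t
    rw [← h.ev_smul_left, smul_add, smul_comm]
  rw [h3] at h2
  have h4 := h2.unique h1
  rw [der_smul_left, pow_succ'] at h4
  exact mul_left_cancel₀ hc (by rw [h4, mul_assoc])

/-- Since `p` lies in both kernels of `ω.der p`, only the components along `a` and `b` count, and
`δ` is the determinant of those components. -/
theorem exists_jac_eq (h : DefinesFoliation N ω) {p a b : Fin 3 → ℂ} (hf : IsFrame a b p)
    (hs : ∀ v, ω.ev p v = 0) (a' b' : Fin 3 → ℂ) :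
    ∃ δ : ℂ, ω.jacDet p a' b' = δ ^ 2 * ω.jacDet p a b ∧
      ω.jacTr p a' b' = δ * ω.jacTr p a b := by
  obtain ⟨s, t, u, rfl⟩ := hf.exists_combination a'
  obtain ⟨s', t', u', rfl⟩ := hf.exists_combination b'
  have h1 : ∀ v, ω.der p p v = 0 := fun v => by rw [h.der_self_left, hs, mul_zero]
  have h2 : ∀ w, ω.der p w p = 0 := fun w => by rw [h.der_self_right, hs, neg_zero]
  refine ⟨s * t' - t * s', ?_, ?_⟩ <;>
  · simp only [jacDet, jacTr, der_add_left, der_add_right, der_smul_left, der_smul_right, h1, h2]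
    ring

end DefinesFoliation

namespace Foliation

open OneForm

variable {N : ℕ} (F : Foliation N)

theorem eval_localCoeff (k : Fin 3) (l : Fin 2) (x : Fin 2 → ℂ) :
    eval x (F.localCoeff k l) =
      F.form.ev (Fin.insertNth (α := fun _ => ℂ) k 1 x) (Pi.single (k.succAbove l) 1) := by
  rw [ev_single, localCoeff, ← coe_aeval_eq_eval, ← coe_aeval_eq_eval]
  simp only [RingHom.coe_coe]
  rw [← AlgHom.comp_apply]
  congr 1
  refine MvPolynomial.algHom_ext fun i => ?_
  refine Fin.succAboveCases k ?_ (fun j => ?_) i <;> simp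

theorem eval_pderiv_localCoeff (k : Fin 3) (l j : Fin 2) (x : Fin 2 → ℂ) :
    eval x (pderiv j (F.localCoeff k l)) =
      F.form.der (Fin.insertNth (α := fun _ => ℂ) k 1 x) (Pi.single (k.succAbove j) 1)
        (Pi.single (k.succAbove l) 1) := by
  have h1 := hasDerivAt_eval_line (F.localCoeff k l) x (Pi.single j 1)
  have h2 := hasDerivAt_ev F.form (Fin.insertNth (α := fun _ => ℂ) k 1 x)
    (Pi.single (k.succAbove j) 1) (Pi.single (k.succAbove l) 1)
  have h3 : ∀ t : ℂ, Fin.insertNth (α := fun _ => ℂ) k 1 (x + t • Pi.single j 1) =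
      Fin.insertNth (α := fun _ => ℂ) k 1 x + t • Pi.single (k.succAbove j) 1 := by
    intro t
    funext i
    refine Fin.succAboveCases k ?_ (fun i => ?_) i <;>
      simp [Pi.single_apply, Fin.succAbove_right_injective.eq_iff]
  simp only [eval_localCoeff, h3] at h1
  have h4 := h1.unique h2
  rw [← h4]
  simp [Pi.single_apply]

/-- A vector of `ℂ³` representing the point, normalized in the chart of the point. -/
def chartVector (m : ℙ ℂ (Fin 3 → ℂ)) : Fin 3 → ℂ :=
  Fin.insertNth (α := fun _ => ℂ) (chartIndex m) 1 (chartPoint m)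

theorem rep_chartIndex_ne_zero (m : ℙ ℂ (Fin 3 → ℂ)) : m.rep (chartIndex m) ≠ 0 :=
  Classical.choose_spec (Function.ne_iff.mp m.rep_nonzero)

theorem chartVector_eq (m : ℙ ℂ (Fin 3 → ℂ)) :
    chartVector m = (m.rep (chartIndex m))⁻¹ • m.rep := by
  have h := rep_chartIndex_ne_zero m
  funext i
  rw [chartVector]
  refine Fin.succAboveCases (chartIndex m) ?_ (fun j => ?_) i
  · simp [h]
  · simp [chartPoint, div_eq_inv_mul]

theorem isFrame_chartVector (m : ℙ ℂ (Fin 3 → ℂ)) :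
    IsFrame (Pi.single ((chartIndex m).succAbove 0) 1) (Pi.single ((chartIndex m).succAbove 1) 1)
      (chartVector m) := by
  rw [IsFrame, Matrix.det_fin_three, chartVector]
  generalize chartIndex m = k
  generalize chartPoint m = x
  fin_cases k <;> simp [Fin.succAbove, Fin.insertNth, Fin.succAboveCases]

theorem isSingular_iff (m : ℙ ℂ (Fin 3 → ℂ)) :
    F.IsSingular m ↔ ∀ v, F.form.ev (chartVector m) v = 0 := by
  have h := inv_ne_zero (rep_chartIndex_ne_zero m)
  rw [IsSingular, ← ev_eq_zero_iff, chartVector_eq]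
  simp only [F.definesFoliation_form.ev_smul_left, mul_eq_zero, pow_eq_zero_iff, Ne, h,
    false_or, Nat.succ_ne_zero, not_false_iff]

theorem milnorNumber_eq_one_iff {m : ℙ ℂ (Fin 3 → ℂ)} (hm : F.IsSingular m) :
    F.milnorNumber m = 1 ↔ F.form.jacDet (chartVector m)
      (Pi.single ((chartIndex m).succAbove 0) 1) (Pi.single ((chartIndex m).succAbove 1) 1) ≠ 0 := by
  rw [isSingular_iff] at hm
  have h : ∀ l, eval (chartPoint m) (F.localCoeff (chartIndex m) l) = 0 := fun l => by
    rw [eval_localCoeff]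
    exact hm _
  rw [milnorNumber, multiplicity_eq_one_iff _ (h 0) (h 1)]
  simp only [eval_pderiv_localCoeff, jacDet, chartVector]
  rw [mul_comm (F.form.der _ (Pi.single ((chartIndex m).succAbove 1) 1) _)]

theorem baumBott_eq (m : ℙ ℂ (Fin 3 → ℂ)) :
    F.baumBott m = F.form.jacTr (chartVector m)
      (Pi.single ((chartIndex m).succAbove 0) 1) (Pi.single ((chartIndex m).succAbove 1) 1) ^ 2 /
        F.form.jacDet (chartVector m)
      (Pi.single ((chartIndex m).succAbove 0) 1) (Pi.single ((chartIndex m).succAbove 1) 1) := by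
  simp only [baumBott, Matrix.trace_fin_two, Matrix.det_fin_two, linearPart, Matrix.of_apply,
    localField, Matrix.cons_val_zero, Matrix.cons_val_one, map_neg, eval_pderiv_localCoeff,
    jacTr, jacDet, chartVector]
  congr 1
  ring

/-- The Baum–Bott invariants at the singular points of multiplicity one, computed in arbitrary
bases. -/
theorem exists_baumBott_eq_iff (z : ℂ) :
    (∃ m, F.IsSingular m ∧ F.milnorNumber m = 1 ∧ F.baumBott m = z) ↔ F.form.HasBB z := by
  constructor
  · rintro ⟨m, hm, h1, h2⟩
    rw [F.milnorNumber_eq_one_iff hm] at h1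
    rw [baumBott_eq, div_eq_iff h1] at h2
    exact ⟨_, _, _, isFrame_chartVector m, (F.isSingular_iff m).mp hm, h1, h2⟩
  · rintro ⟨a, b, p, hf, hs, h1, h2⟩
    have hω := F.definesFoliation_form
    set m : ℙ ℂ (Fin 3 → ℂ) := Projectivization.mk ℂ p hf.ne_zero with hm
    obtain ⟨e, he⟩ := Projectivization.exists_smul_eq_mk_rep ℂ p hf.ne_zero
    -- Rescaling the point by `c` multiplies the trace by `c ^ N` and the determinant by its square,
    -- so the quotient is unchanged.
    obtain ⟨c, hc, hcp⟩ : ∃ c : ℂ, c ≠ 0 ∧ p = c • chartVector m := by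
      refine ⟨(e⁻¹ : ℂˣ) * m.rep (chartIndex m),
        mul_ne_zero (Units.ne_zero _) (rep_chartIndex_ne_zero m), ?_⟩
      rw [chartVector_eq, smul_smul, mul_assoc, mul_inv_cancel₀ (rep_chartIndex_ne_zero m),
        mul_one, hm, ← he]
      simp [Units.smul_def, smul_smul]
    have hs' : ∀ v, F.form.ev (chartVector m) v = 0 := by
      intro v
      have := hs v
      rw [hcp, hω.ev_smul_left] at this
      exact (mul_eq_zero.mp this).resolve_left (pow_ne_zero _ hc)
    obtain ⟨δ, h3, h4⟩ := hω.exists_jac_eq (isFrame_chartVector m) hs' a b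
    have h5 : F.form.jacDet p a b = (c ^ N) ^ 2 * F.form.jacDet (chartVector m) a b := by
      simp only [jacDet, hcp, hω.der_smul_point hc]
      ring
    have h6 : F.form.jacTr p a b = c ^ N * F.form.jacTr (chartVector m) a b := by
      simp only [jacTr, hcp, hω.der_smul_point hc]
      ring
    rw [h5, h3] at h1 h2
    rw [h6, h4] at h2
    have hsing := (F.isSingular_iff m).mpr hs'
    have hcN : c ^ N ≠ 0 := pow_ne_zero _ hc
    have h7 := right_ne_zero_of_mul (right_ne_zero_of_mul h1)
    have hδ : δ ^ 2 ≠ 0 := left_ne_zero_of_mul (right_ne_zero_of_mul h1)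
    refine ⟨m, hsing, (F.milnorNumber_eq_one_iff hsing).mpr h7, ?_⟩
    rw [baumBott_eq, div_eq_iff h7]
    refine mul_left_cancel₀ hδ (mul_left_cancel₀ (pow_ne_zero 2 hcN) ?_)
    linear_combination h2

end Foliation

/-! ### Quadratic vector fields and forms of degree three -/

/-- The coefficients of a homogeneous quadratic vector field `v` on `ℂ³`, whose components are
`v i = ∑ w (i, j, k) X j X k`. -/
abbrev QuadField : Type := Fin 3 × Fin 3 × Fin 3 → ℂ

namespace QuadField

/-- The components of a quadratic vector field. -/
def poly (w : QuadField) (i : Fin 3) : MvPolynomial (Fin 3) ℂ :=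
  ∑ j, ∑ k, C (w (i, j, k)) * (X j * X k)

/-- The form `ω` of the foliation tangent to the radial field and to a quadratic field `v`:
the vector product of `(X, Y, Z)` and `v`. -/
def form (w : QuadField) : OneForm := fun i =>
  X (i + 1) * w.poly (i + 2) - X (i + 2) * w.poly (i + 1)

/-- The value of a quadratic vector field. -/
def quad (w : QuadField) (p : Fin 3 → ℂ) : Fin 3 → ℂ := fun i => ∑ j, ∑ k, w (i, j, k) * (p j * p k)

/-- The derivative of a quadratic vector field at `p` in the direction `q`. -/
def polar (w : QuadField) (p q : Fin 3 → ℂ) : Fin 3 → ℂ := fun i =>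
  ∑ j, ∑ k, w (i, j, k) * (p j * q k + q j * p k)

theorem eval_poly (w : QuadField) (p : Fin 3 → ℂ) (i : Fin 3) :
    eval p (w.poly i) = w.quad p i := by
  simp [poly, quad]

/-- The determinant of three vectors. -/
def triple (x y u : Fin 3 → ℂ) : ℂ :=
  (x 1 * y 2 - x 2 * y 1) * u 0 + (x 2 * y 0 - x 0 * y 2) * u 1 + (x 0 * y 1 - x 1 * y 0) * u 2

theorem ev_form (w : QuadField) (p u : Fin 3 → ℂ) : w.form.ev p u = triple p (w.quad p) u := by
  simp only [OneForm.ev, Fin.sum_univ_three, form, map_sub, map_mul, eval_X, eval_poly, triple]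
  rfl

theorem quad_add_smul (w : QuadField) (p q : Fin 3 → ℂ) (t : ℂ) :
    w.quad (p + t • q) = w.quad p + t • w.polar p q + t ^ 2 • w.quad q := by
  funext i
  simp only [quad, polar, Pi.add_apply, Pi.smul_apply, smul_eq_mul, Finset.mul_sum,
    ← Finset.sum_add_distrib]
  exact Finset.sum_congr rfl fun j _ => Finset.sum_congr rfl fun k _ => by ring

theorem ev_form_add_smul (w : QuadField) (p q u : Fin 3 → ℂ) (t : ℂ) :
    w.form.ev (p + t • q) u = w.form.ev p u +
      t * (triple q (w.quad p) u + triple p (w.polar p q) u) +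
      t ^ 2 * (triple p (w.quad q) u + triple q (w.polar p q) u) + t ^ 3 * w.form.ev q u := by
  simp only [ev_form, quad_add_smul, triple, Pi.add_apply, Pi.smul_apply, smul_eq_mul]
  ring

theorem polar_comm (w : QuadField) (p q : Fin 3 → ℂ) : w.polar p q = w.polar q p := by
  funext i
  exact Finset.sum_congr rfl fun j _ => Finset.sum_congr rfl fun k _ => by ring

theorem der_form (w : QuadField) (p q u : Fin 3 → ℂ) :
    w.form.der p q u = triple q (w.quad p) u + triple p (w.polar p q) u := by
  refine (OneForm.hasDerivAt_ev w.form p q u).unique ?_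
  simp only [ev_form_add_smul]
  have h := ((((hasDerivAt_id (0 : ℂ)).mul_const
    (triple q (w.quad p) u + triple p (w.polar p q) u)).const_add (w.form.ev p u)).add
    (((hasDerivAt_id (0 : ℂ)).pow 2).mul_const
      (triple p (w.quad q) u + triple q (w.polar p q) u))).add
    (((hasDerivAt_id (0 : ℂ)).pow 3).mul_const (w.form.ev q u))
  refine (h.congr_of_eventuallyEq (Filter.Eventually.of_forall fun t => rfl)).congr_deriv ?_
  simp

/-- Along a line the form is cubic in `t`, and the two middle coefficients are first derivatives,
one at `p` and one at `q`. -/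
theorem ev_form_add_smul' (w : QuadField) (p q u : Fin 3 → ℂ) (t : ℂ) :
    w.form.ev (p + t • q) u = w.form.ev p u + t * w.form.der p q u +
      t ^ 2 * w.form.der q p u + t ^ 3 * w.form.ev q u := by
  rw [ev_form_add_smul, der_form, der_form, polar_comm w q p]

theorem isHomogeneous_poly (w : QuadField) (i : Fin 3) : (w.poly i).IsHomogeneous 2 :=
  IsHomogeneous.sum _ _ _ fun j _ => IsHomogeneous.sum _ _ _ fun k _ => by
    simpa using (isHomogeneous_C (Fin 3) (w (i, j, k))).mul
      ((isHomogeneous_X ℂ j).mul (isHomogeneous_X ℂ k))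

theorem isHomogeneous_form (w : QuadField) (i : Fin 3) : (w.form i).IsHomogeneous (2 + 1) :=
  ((isHomogeneous_X ℂ (i + 1)).mul (w.isHomogeneous_poly (i + 2))).sub
    ((isHomogeneous_X ℂ (i + 2)).mul (w.isHomogeneous_poly (i + 1)))

theorem sum_X_mul_form (w : QuadField) : ∑ i, X i * w.form i = 0 := by
  simp only [Fin.sum_univ_three, form]
  change X 0 * (X 1 * w.poly 2 - X 2 * w.poly 1) + X 1 * (X 2 * w.poly 0 - X 0 * w.poly 2) +
    X 2 * (X 0 * w.poly 1 - X 1 * w.poly 0) = 0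
  ring

theorem form_add (w w' : QuadField) : (w + w').form = w.form + w'.form := by
  have h : ∀ i, (w + w').poly i = w.poly i + w'.poly i := fun i => by
    simp only [poly, Pi.add_apply, C_add, add_mul, Finset.sum_add_distrib]
  funext i
  simp only [form, h, Pi.add_apply]
  ring

theorem form_smul (c : ℂ) (w : QuadField) : (c • w).form = c • w.form := by
  have h : ∀ i, (c • w).poly i = C c * w.poly i := fun i => by
    simp only [poly, Pi.smul_apply, smul_eq_mul, C_mul, Finset.mul_sum, mul_assoc]
  funext i
  simp only [form, h, Pi.smul_apply, smul_eq_C_mul]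
  ring

end QuadField

namespace OneForm

/-- The curl of a form. -/
def curl (ω : OneForm) (i : Fin 3) : MvPolynomial (Fin 3) ℂ :=
  pderiv (i + 1) (ω (i + 2)) - pderiv (i + 2) (ω (i + 1))

/-- A quadratic vector field tangent to a form of degree three: a multiple of its curl. -/
def quadField (ω : OneForm) : QuadField := fun q =>
  -(1 / 8) * constantCoeff (pderiv q.2.2 (pderiv q.2.1 (ω.curl q.1)))

theorem isHomogeneous_curl {ω : OneForm} (h : ∀ i, (ω i).IsHomogeneous (2 + 1)) (i : Fin 3) :
    (ω.curl i).IsHomogeneous 2 := (h _).pderiv.sub (h _).pderiv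

theorem eq_sum_of_isHomogeneous_two {P : MvPolynomial (Fin 3) ℂ} (hP : P.IsHomogeneous 2) :
    P = ∑ j, ∑ k, C (1 / 2 * constantCoeff (pderiv k (pderiv j P))) * (X j * X k) := by
  have h1 : ∀ j, (pderiv j P).IsHomogeneous 1 := fun j => hP.pderiv
  have h2 : ∀ j k, pderiv k (pderiv j P) = C (constantCoeff (pderiv k (pderiv j P))) := by
    intro j k
    have h3 : (pderiv k (pderiv j P)).IsHomogeneous 0 := (h1 j).pderiv
    exact totalDegree_eq_zero_iff_eq_C.mp ((totalDegree_zero_iff_isHomogeneous _).mpr h3)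
  have h4 : ∀ j, pderiv j P = ∑ k, X k * C (constantCoeff (pderiv k (pderiv j P))) := by
    intro j
    have := (h1 j).sum_X_mul_pderiv
    rw [one_smul] at this
    rw [← Finset.sum_congr rfl fun k _ => congrArg (X k * ·) (h2 j k), this]
  have h5 := hP.sum_X_mul_pderiv
  have h6 : P = C (1 / 2) * ∑ j, X j * pderiv j P := by
    rw [h5, nsmul_eq_mul, ← mul_assoc, ← C_eq_coe_nat, ← C_mul]
    norm_num
  refine h6.trans ?_
  rw [Finset.mul_sum]
  refine Finset.sum_congr rfl fun j _ => ?_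
  conv_lhs => rw [h4 j]
  rw [Finset.mul_sum, Finset.mul_sum]
  refine Finset.sum_congr rfl fun k _ => ?_
  rw [C_mul]
  ring

theorem poly_quadField {ω : OneForm} (h : ∀ i, (ω i).IsHomogeneous (2 + 1)) (i : Fin 3) :
    ω.quadField.poly i = C (-(1 / 4)) * ω.curl i := by
  conv_rhs => rw [eq_sum_of_isHomogeneous_two (isHomogeneous_curl h i)]
  simp only [QuadField.poly, quadField, Finset.mul_sum]
  refine Finset.sum_congr rfl fun j _ => Finset.sum_congr rfl fun k _ => ?_
  rw [← mul_assoc (C _) (C _), ← C_mul]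
  congr 2
  ring

/-- For the radial field `R`, Cartan's formula and `ω(R) = 0` give `i_R dω = L_R ω = 4 ω`. In
coordinates this says that `ω` is the vector product of the position vector with `-1/4` of the curl.
-/
theorem form_quadField {ω : OneForm} (h : ∀ i, (ω i).IsHomogeneous (2 + 1))
    (he : ∑ i, X i * ω i = 0) : ω.quadField.form = ω := by
  have hE : ∀ i, ∑ j, X j * pderiv j (ω i) = 3 * ω i := fun i => by
    rw [(h i).sum_X_mul_pderiv, nsmul_eq_mul]
    norm_num
  have hd : ∀ i, ∑ j, X j * pderiv i (ω j) + ω i = 0 := by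
    intro i
    have h1 := congrArg (pderiv i) he
    rw [map_sum, map_zero] at h1
    simp only [Derivation.leibniz, pderiv_X, smul_eq_mul, Finset.sum_add_distrib] at h1
    rw [← h1]
    congr 1
    rw [Finset.sum_eq_single i]
    · simp
    · intro j _ hj
      simp [hj]
    · simp
  have h4 : (C (-(1 / 4)) : MvPolynomial (Fin 3) ℂ) * 4 = -1 := by
    rw [show (4 : MvPolynomial (Fin 3) ℂ) = C 4 from rfl, ← C_mul,
      show -(1 / 4) * 4 = (-1 : ℂ) by norm_num, C_neg, C_1]
  simp only [Fin.sum_univ_three] at hE hd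
  funext i
  simp only [QuadField.form, poly_quadField h, curl]
  fin_cases i
  · change X 1 * (C (-(1 / 4)) * (pderiv 0 (ω 1) - pderiv 1 (ω 0))) -
      X 2 * (C (-(1 / 4)) * (pderiv 2 (ω 0) - pderiv 0 (ω 2))) = ω 0
    linear_combination C (-(1 / 4)) * (hd 0 - hE 0) - ω 0 * h4
  · change X 2 * (C (-(1 / 4)) * (pderiv 1 (ω 2) - pderiv 2 (ω 1))) -
      X 0 * (C (-(1 / 4)) * (pderiv 0 (ω 1) - pderiv 1 (ω 0))) = ω 1
    linear_combination C (-(1 / 4)) * (hd 1 - hE 1) - ω 1 * h4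
  · change X 0 * (C (-(1 / 4)) * (pderiv 2 (ω 0) - pderiv 0 (ω 2))) -
      X 1 * (C (-(1 / 4)) * (pderiv 1 (ω 2) - pderiv 2 (ω 1))) = ω 2
    linear_combination C (-(1 / 4)) * (hd 2 - hE 2) - ω 2 * h4

theorem exists_constantCoeff_pderiv_eq (i j k : Fin 3) : ∃ c : ℂ, ∃ m : Fin 3 →₀ ℕ,
    ∀ P : MvPolynomial (Fin 3) ℂ,
      constantCoeff (pderiv k (pderiv j (pderiv i P))) = c * coeff m P := by
  refine ⟨((((0 + Finsupp.single k 1 + Finsupp.single j 1 : Fin 3 →₀ ℕ) i : ℕ) : ℂ) + 1) *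
    (((((0 + Finsupp.single k 1 : Fin 3 →₀ ℕ) j : ℕ) : ℂ) + 1) *
    ((((0 : Fin 3 →₀ ℕ) k : ℕ) : ℂ) + 1)),
    0 + Finsupp.single k 1 + Finsupp.single j 1 + Finsupp.single i 1, fun P => ?_⟩
  rw [constantCoeff_eq, coeff_pderiv, coeff_pderiv, coeff_pderiv, mul_assoc, mul_assoc, mul_comm]

/-- The coefficients of `ω.quadField` are linear forms in the coefficients of `ω`. -/
theorem exists_quadField_eq (q : Fin 3 × Fin 3 × Fin 3) :
    ∃ (c c' : ℂ) (r r' : Fin 3 × (Fin 3 →₀ ℕ)), ∀ ω : OneForm,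
      ω.quadField q = c * ω.coords r + c' * ω.coords r' := by
  obtain ⟨c, m, h⟩ := exists_constantCoeff_pderiv_eq (q.1 + 1) q.2.1 q.2.2
  obtain ⟨c', m', h'⟩ := exists_constantCoeff_pderiv_eq (q.1 + 2) q.2.1 q.2.2
  refine ⟨-(1 / 8) * c, 1 / 8 * c', (q.1 + 2, m), (q.1 + 1, m'), fun ω => ?_⟩
  simp only [quadField, curl, map_sub, h, h', coords]
  ring

end OneForm

/-- Transfers open conditions on the finite-dimensional space of quadratic fields to the space of
forms. -/
theorem FoliationForm.continuous_quadField :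
    Continuous fun ω : FoliationForm 2 => ω.1.quadField := by
  refine continuous_pi fun q => ?_
  obtain ⟨c, c', r, r', h⟩ := OneForm.exists_quadField_eq q
  simp only [h]
  have h1 : Continuous fun ω : FoliationForm 2 => ω.1.coords := continuous_induced_dom
  exact (continuous_const.mul ((continuous_apply r).comp h1)).add
    (continuous_const.mul ((continuous_apply r').comp h1))

theorem DefinesFoliation.form_quadField {ω : OneForm} (h : DefinesFoliation 2 ω) :
    ω.quadField.form = ω :=
  OneForm.form_quadField h.1 h.2.1

theorem Foliation.form_quadField (F : Foliation 2) : F.form.quadField.form = F.form :=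
  F.definesFoliation_form.form_quadField

/-! ### Flags: eigendirections transverse to the foliation -/

/-- The frame `a`, `b`, `p` exhibits a nondegenerate singular point `p` of `ω` and an eigendirection
`b` along which the line through `p` is not invariant; `-l` is the ratio of the eigenvalues. -/
structure IsFlag (ω : OneForm) (l : ℂ) (a b p : Fin 3 → ℂ) : Prop where
  frame : IsFrame a b p
  singular : ∀ v, ω.ev p v = 0
  isotropic : ω.der p b b = 0
  ratio : ω.der p a b = l * ω.der p b a
  nondegenerate : ω.der p b a ≠ 0
  transverse : ω.ev (p + b) b ≠ 0

/-- Some frame exhibits an eigendirection of ratio `-l`. -/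
def HasFlag (ω : OneForm) (l : ℂ) : Prop := ∃ a b p, IsFlag ω l a b p

theorem HasFlag.smul {ω : OneForm} {l : ℂ} (h : HasFlag ω l) {c : ℂ} (hc : c ≠ 0) :
    HasFlag (c • ω) l := by
  obtain ⟨a, b, p, h⟩ := h
  refine ⟨a, b, p, h.frame, fun v => ?_, ?_, ?_, ?_, ?_⟩
  · rw [OneForm.ev_smul, h.singular, mul_zero]
  · rw [OneForm.der_smul, h.isotropic, mul_zero]
  · rw [OneForm.der_smul, OneForm.der_smul, h.ratio]
    ring
  · rw [OneForm.der_smul]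
    exact mul_ne_zero hc h.nondegenerate
  · rw [OneForm.ev_smul]
    exact mul_ne_zero hc h.transverse

theorem HasFlag.of_pullback {ω : OneForm} {l : ℂ} {g : GL (Fin 3) ℂ}
    (h : HasFlag (ω.pullback g.1) l) : HasFlag ω l := by
  obtain ⟨a, b, p, h⟩ := h
  refine ⟨g.1.mulVec a, g.1.mulVec b, g.1.mulVec p, h.frame.mulVec g, fun v => ?_, ?_, ?_, ?_, ?_⟩
  · have := h.singular ((g⁻¹).1.mulVec v)
    rwa [OneForm.ev_pullback, Matrix.mulVec_mulVec, ← Units.val_mul, mul_inv_cancel,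
      Units.val_one, Matrix.one_mulVec] at this
  · simpa only [OneForm.der_pullback] using h.isotropic
  · simpa only [OneForm.der_pullback] using h.ratio
  · simpa only [OneForm.der_pullback] using h.nondegenerate
  · simpa only [OneForm.ev_pullback, Matrix.mulVec_add] using h.transverse

theorem Foliation.hasFlag_of_mem_orbit {N : ℕ} {F G : Foliation N} (h : G ∈ F.orbit) {l : ℂ}
    (hl : HasFlag G.form l) : HasFlag F.form l := by
  obtain ⟨g, c, hc, h⟩ := h
  rw [h] at hl
  have := hl.smul (inv_ne_zero hc)
  rw [smul_smul, inv_mul_cancel₀ hc, one_smul] at this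
  exact this.of_pullback

theorem Foliation.hasInvariantLine_of_mem_orbit {N : ℕ} {F G : Foliation N} (h : G ∈ F.orbit)
    (hF : F.HasInvariantLine) : G.HasInvariantLine := by
  obtain ⟨g, c, hc, h⟩ := h
  obtain ⟨a, ha, hF⟩ := hF
  have hdot : ∀ v, Matrix.vecMul a g.1 ⬝ᵥ v = a ⬝ᵥ g.1.mulVec v := fun v =>
    (Matrix.dotProduct_mulVec a g.1 v).symm
  refine ⟨Matrix.vecMul a g.1, fun h0 => ha ?_, fun p v hp hv => ?_⟩
  · have := congrArg (fun x => Matrix.vecMul x (g⁻¹).1) h0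
    simpa only [Matrix.vecMul_vecMul, ← Units.val_mul, mul_inv_cancel, Units.val_one,
      Matrix.vecMul_one, Matrix.zero_vecMul] using this
  · have h1 : G.form.ev p v = 0 := by
      rw [h, OneForm.ev_smul, OneForm.ev_pullback]
      exact mul_eq_zero_of_right _ (hF _ _ (by rw [← hdot, hp]) (by rw [← hdot, hv]))
    exact h1

/-- A line on which the form vanishes to order four is invariant. -/
theorem Foliation.hasInvariantLine_of_isFrame (F : Foliation 2) {a b p : Fin 3 → ℂ}
    (hf : IsFrame a b p) (hs : ∀ v, F.form.ev p v = 0) (hb : F.form.der p b b = 0)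
    (ht : F.form.ev (p + b) b = 0) : F.HasInvariantLine := by
  have hω := F.definesFoliation_form
  have hcub : ∀ t u, F.form.ev (p + t • b) u = F.form.ev p u + t * F.form.der p b u +
      t ^ 2 * F.form.der b p u + t ^ 3 * F.form.ev b u := by
    intro t u
    have := QuadField.ev_form_add_smul' F.form.quadField p b u t
    rwa [F.form_quadField] at this
  -- The value on `b` along the line is a cubic polynomial in `t` of which this is the only
  -- coefficient not yet known to vanish; evaluate at `t = 1`.
  have hbp : F.form.der b p b = 0 := by
    have := hcub 1 b
    rw [one_smul, ht, hs, hb, hω.ev_self] at this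
    linear_combination -this
  have hline : ∀ t, F.form.ev (p + t • b) b = 0 := fun t => by
    rw [hcub, hs, hb, hbp, hω.ev_self]
    ring
  have hevb : ∀ s t : ℂ, F.form.ev (s • b + t • p) b = 0 := by
    intro s t
    by_cases ht0 : t = 0
    · rw [ht0, zero_smul, add_zero, hω.ev_smul_left, hω.ev_self, mul_zero]
    · have : s • b + t • p = t • (p + (s / t) • b) := by
        rw [smul_add, smul_smul, mul_div_cancel₀ _ ht0, add_comm]
      rw [this, hω.ev_smul_left, hline, mul_zero]
  have hevp : ∀ s t : ℂ, F.form.ev (s • b + t • p) p = 0 := by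
    intro s t
    by_cases ht0 : t = 0
    · have h1 : F.form.der b p b = - F.form.ev b p := hω.der_self_right b p
      have h2 : F.form.ev b p = 0 := by rw [← neg_eq_zero, ← h1, hbp]
      rw [ht0, zero_smul, add_zero, hω.ev_smul_left, h2, mul_zero]
    · have h1 := hω.ev_self (s • b + t • p)
      rw [OneForm.ev_add_right, OneForm.ev_smul_right, OneForm.ev_smul_right, hevb, mul_zero,
        zero_add] at h1
      exact (mul_eq_zero.mp h1).resolve_left ht0
  -- The vector product of `b` and `p` is an equation of the line joining them.
  set n : Fin 3 → ℂ := ![b 1 * p 2 - b 2 * p 1, b 2 * p 0 - b 0 * p 2, b 0 * p 1 - b 1 * p 0] with hn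
  have hna : n ⬝ᵥ a ≠ 0 := by
    rw [IsFrame, Matrix.det_fin_three] at hf
    contrapose! hf
    simp [hn, dotProduct, Fin.sum_univ_three] at hf ⊢
    linear_combination hf
  have hnb : n ⬝ᵥ b = 0 := by
    simp [hn, dotProduct, Fin.sum_univ_three]
    ring
  have hnp : n ⬝ᵥ p = 0 := by
    simp [hn, dotProduct, Fin.sum_univ_three]
    ring
  have hcomb : ∀ q : Fin 3 → ℂ, n ⬝ᵥ q = 0 → ∃ s t : ℂ, q = s • b + t • p := by
    intro q hq
    obtain ⟨r, s, t, rfl⟩ := hf.exists_combination q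
    rw [dotProduct_add, dotProduct_add, dotProduct_smul, dotProduct_smul, dotProduct_smul, hnb,
      hnp, smul_zero, smul_zero, add_zero, add_zero, smul_eq_mul] at hq
    have hr := (mul_eq_zero.mp hq).resolve_right hna
    exact ⟨s, t, by rw [hr, zero_smul, zero_add]⟩
  refine ⟨n, fun h0 => hna (by rw [h0, zero_dotProduct]), fun q v hq hv => ?_⟩
  obtain ⟨s, t, rfl⟩ := hcomb q hq
  obtain ⟨s', t', rfl⟩ := hcomb v hv
  change F.form.ev _ _ = 0
  rw [OneForm.ev_add_right, OneForm.ev_smul_right, OneForm.ev_smul_right, hevb, hevp, mul_zero,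
    mul_zero, add_zero]

theorem DefinesFoliation.jac_of_isFrame {N : ℕ} {ω : OneForm} (hω : DefinesFoliation N ω)
    {z : ℂ} {a b a' b' p : Fin 3 → ℂ} (hf : IsFrame a' b' p) (hs : ∀ v, ω.ev p v = 0)
    (h1 : ω.jacDet p a b ≠ 0) (h2 : ω.jacTr p a b ^ 2 = z * ω.jacDet p a b) :
    ω.jacDet p a' b' ≠ 0 ∧ ω.jacTr p a' b' ^ 2 = z * ω.jacDet p a' b' := by
  obtain ⟨δ, h3, h4⟩ := hω.exists_jac_eq hf hs a b
  rw [h3] at h1 h2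
  rw [h4] at h2
  refine ⟨right_ne_zero_of_mul h1, mul_left_cancel₀ (left_ne_zero_of_mul h1) ?_⟩
  linear_combination h2

/-- Isotropic vectors of `v ↦ ω.der p v v` modulo `p` are the eigendirections of the linear part; a
binary quadratic form over `ℂ` always has one. -/
theorem exists_isFrame_isotropic (ω : OneForm) {a b p : Fin 3 → ℂ} (hf : IsFrame a b p) :
    ∃ a' b', IsFrame a' b' p ∧ ω.der p b' b' = 0 := by
  by_cases hb : ω.der p b b = 0
  · exact ⟨a, b, hf, hb⟩
  · obtain ⟨y, hy⟩ := exists_quadratic_eq_zero (b := ω.der p a b + ω.der p b a) (c := ω.der p a a)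
      hb (IsAlgClosed.exists_eq_mul_self _)
    refine ⟨b, a + y • b, hf.swap.add_smul y, ?_⟩
    simp only [OneForm.der_add_left, OneForm.der_add_right, OneForm.der_smul_left,
      OneForm.der_smul_right]
    linear_combination hy

/-- A foliation of degree two without invariant line has an eigendirection of ratio `-l` at each
nondegenerate singular point where the Baum–Bott invariant is `2 - l - 1 / l`. -/
theorem Foliation.hasFlag_of_hasBB {F : Foliation 2} (hF : ¬ F.HasInvariantLine) {l : ℂ}
    (hl : l ≠ 0) (h : F.form.HasBB (2 - l - 1 / l)) : HasFlag F.form l := by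
  obtain ⟨a₀, b₀, p, hf₀, hs, hd₀, ht₀⟩ := h
  obtain ⟨a, b, hf, hb⟩ := exists_isFrame_isotropic F.form hf₀
  obtain ⟨hd, ht⟩ := F.definesFoliation_form.jac_of_isFrame hf hs hd₀ ht₀
  rw [OneForm.jacDet, hb, mul_zero, zero_sub] at hd ht
  rw [OneForm.jacTr] at ht
  have hab : F.form.der p a b ≠ 0 := fun h => hd (by rw [h, zero_mul, neg_zero])
  have hba : F.form.der p b a ≠ 0 := fun h => hd (by rw [h, mul_zero, neg_zero])
  -- The Baum–Bott equation factors: the ratio is `l` or its inverse.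
  have key : (F.form.der p a b - l * F.form.der p b a) *
      (l * F.form.der p a b - F.form.der p b a) = 0 := by
    field_simp at ht
    linear_combination ht
  by_cases h1 : F.form.der p a b = l * F.form.der p b a
  · exact ⟨a, b, p, hf, hs, hb, h1, hba, fun h => hF (F.hasInvariantLine_of_isFrame hf hs hb h)⟩
  · have h2 : F.form.der p b a = l * F.form.der p a b := by
      have := (mul_eq_zero.mp key).resolve_left (sub_ne_zero.mpr h1)
      linear_combination -this
    -- The eigenvalues `der p a b` and `-der p b a` differ: equality would force `l = -1` and return
    -- to the first case.
    have h3 : F.form.der p a b + F.form.der p b a ≠ 0 := by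
      intro h3
      refine h1 (mul_left_cancel₀ hab ?_)
      linear_combination (F.form.der p a b) * h3 - F.form.der p a b * h2 -
        l * F.form.der p a b * h3
    -- `a + s • b` is the second eigendirection; exchanging the two inverts the ratio.
    set s := -F.form.der p a a / (F.form.der p a b + F.form.der p b a) with hsdef
    have hs0 : F.form.der p a a + s * (F.form.der p a b + F.form.der p b a) = 0 := by
      rw [hsdef]
      field_simp
      ring
    have hf' := hf.swap.add_smul s
    have hb' : F.form.der p (a + s • b) (a + s • b) = 0 := by
      simp only [OneForm.der_add_left, OneForm.der_add_right, OneForm.der_smul_left,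
        OneForm.der_smul_right, hb]
      linear_combination hs0
    refine ⟨b, a + s • b, p, hf', hs, hb', ?_, ?_, fun h =>
      hF (F.hasInvariantLine_of_isFrame hf' hs hb' h)⟩
    · simp only [OneForm.der_add_left, OneForm.der_add_right, OneForm.der_smul_left,
        OneForm.der_smul_right, hb, mul_zero, add_zero, h2]
    · simpa only [OneForm.der_add_left, OneForm.der_smul_left, hb, mul_zero, add_zero] using hab

/-! ### The foliations `F₀(l)` and `F₅` -/

/-- The quadratic field `(l XZ + Y², -YZ, 0)`. -/
def quadFieldZero (l : ℂ) : QuadField := fun q =>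
  if q = (0, 0, 2) then l else if q = (0, 1, 1) then 1 else if q = (1, 1, 2) then -1 else 0

theorem quad_quadFieldZero (l : ℂ) (p : Fin 3 → ℂ) :
    (quadFieldZero l).quad p = ![l * p 0 * p 2 + p 1 ^ 2, -(p 1 * p 2), 0] := by
  funext i
  fin_cases i <;> simp [QuadField.quad, quadFieldZero, Fin.sum_univ_three]
  ring

theorem polar_quadFieldZero (l : ℂ) (p q : Fin 3 → ℂ) :
    (quadFieldZero l).polar p q = ![l * (p 0 * q 2 + q 0 * p 2) + 2 * p 1 * q 1,
      -(p 1 * q 2 + q 1 * p 2), 0] := by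
  funext i
  fin_cases i <;> simp [QuadField.polar, quadFieldZero, Fin.sum_univ_three]
  ring

theorem form_quadFieldZero (l : ℂ) : (quadFieldZero l).form = omegaZero l := by
  refine OneForm.ext_ev fun p v => ?_
  rw [QuadField.ev_form, quad_quadFieldZero]
  simp [QuadField.triple, OneForm.ev, omegaZero, Fin.sum_univ_three]
  ring

theorem ev_omegaZero (l : ℂ) (p u : Fin 3 → ℂ) : (omegaZero l).ev p u =
    p 1 * p 2 ^ 2 * u 0 + (l * p 0 * p 2 ^ 2 + p 1 ^ 2 * p 2) * u 1 -
      ((1 + l) * p 0 * p 1 * p 2 + p 1 ^ 3) * u 2 := by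
  simp [OneForm.ev, omegaZero, Fin.sum_univ_three]
  ring

theorem der_omegaZero (l : ℂ) (p q u : Fin 3 → ℂ) : (omegaZero l).der p q u =
    (q 1 * p 2 ^ 2 + 2 * p 1 * p 2 * q 2) * u 0 +
      (l * q 0 * p 2 ^ 2 + 2 * l * p 0 * p 2 * q 2 + 2 * p 1 * q 1 * p 2 + p 1 ^ 2 * q 2) * u 1 -
      ((1 + l) * (q 0 * p 1 * p 2 + p 0 * q 1 * p 2 + p 0 * p 1 * q 2) + 3 * p 1 ^ 2 * q 1) *
        u 2 := by
  rw [← form_quadFieldZero, QuadField.der_form, quad_quadFieldZero, polar_quadFieldZero]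
  simp [QuadField.triple]
  ring

theorem omegaZero_singular {l : ℂ} (hl : l ≠ 0) {p : Fin 3 → ℂ}
    (hs : ∀ v, (omegaZero l).ev p v = 0) : p 1 = 0 ∧ (p 0 = 0 ∨ p 2 = 0) := by
  have h0 := hs (Pi.single 0 1)
  have h1 := hs (Pi.single 1 1)
  have h2 := hs (Pi.single 2 1)
  simp only [ev_omegaZero] at h0 h1 h2
  simp at h0 h1 h2
  rcases h0 with h0 | h0
  · refine ⟨h0, ?_⟩
    rw [h0] at h1
    simpa [hl] using h1
  · rw [h0] at h2
    simpa [h0] using h2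

/-- The only nondegenerate singular point is `(0 : 0 : 1)`. The eigendirection inside the invariant
line `Y = 0` is not transverse, and every other one has ratio `l`. -/
theorem HasFlag.eq_of_omegaZero {l m : ℂ} (hl : l ≠ 0) (h : HasFlag (omegaZero l) m) : m = l := by
  obtain ⟨a, b, p, hf, hs, hb, hr, hn, ht⟩ := h
  obtain ⟨h1, h02⟩ := omegaZero_singular hl hs
  have hp2 : p 2 ≠ 0 := by
    intro h2
    refine hn ?_
    rw [der_omegaZero, h1, h2]
    ring
  have h0 : p 0 = 0 := h02.resolve_right hp2
  simp only [der_omegaZero, h0, h1] at hb hr hn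
  have hb1 : b 1 ≠ 0 := by
    intro hb1
    refine ht ?_
    simp only [ev_omegaZero, Pi.add_apply, h0, h1, hb1]
    ring
  have hp : p 2 ^ 2 ≠ 0 := pow_ne_zero 2 hp2
  have hb' : (1 + l) * b 0 = 0 := by
    refine mul_left_cancel₀ hb1 (mul_left_cancel₀ hp ?_)
    linear_combination hb
  -- For `l = -1` the linear part is scalar and `b 0` stays free; otherwise `b 0 = 0`.
  rcases mul_eq_zero.mp hb' with h | h
  · have hl1 : l = -1 := by linear_combination h
    have hn' : b 1 * a 0 - b 0 * a 1 ≠ 0 := by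
      contrapose! hn
      rw [hl1]
      linear_combination (p 2 ^ 2) * hn
    refine mul_right_cancel₀ hn' (mul_left_cancel₀ hp ?_)
    rw [hl1] at hr ⊢
    linear_combination -hr
  · rw [h] at hr hn
    have hn' : b 1 * a 0 ≠ 0 := by
      contrapose! hn
      linear_combination (p 2 ^ 2) * hn
    refine mul_right_cancel₀ hn' (mul_left_cancel₀ hp ?_)
    linear_combination -hr

theorem hasFlag_omegaZero {l : ℂ} : HasFlag (omegaZero l) l := by
  refine ⟨Pi.single 0 1, Pi.single 1 1, Pi.single 2 1, ?_, fun v => ?_, ?_, ?_, ?_, ?_⟩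
  · rw [IsFrame, Matrix.det_fin_three]
    simp
  all_goals simp [ev_omegaZero, der_omegaZero]

namespace Foliation

theorem exists_form_foliationZero (l : ℂ) (hl : l ≠ 0) :
    ∃ c : ℂ, c ≠ 0 ∧ (foliationZero l hl).form = c • omegaZero l :=
  exists_form_mk (omegaZero l) (definesFoliation_omegaZero hl)

theorem hasInvariantLine_foliationZero (l : ℂ) (hl : l ≠ 0) :
    (foliationZero l hl).HasInvariantLine := by
  obtain ⟨c, hc, h⟩ := exists_form_foliationZero l hl
  refine ⟨Pi.single 1 1, by simp, fun p v hp hv => ?_⟩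
  simp at hp hv
  change (foliationZero l hl).form.ev p v = 0
  rw [h, OneForm.ev_smul, ev_omegaZero, hp, hv]
  ring

/-- Makes `l` a conjugacy invariant of `foliationZero`, distinguishing `l` from `1 / l` although
both give the same Baum–Bott invariant. -/
theorem hasFlag_foliationZero_iff {l m : ℂ} (hl : l ≠ 0) :
    HasFlag (foliationZero l hl).form m ↔ m = l := by
  obtain ⟨c, hc, h⟩ := exists_form_foliationZero l hl
  rw [h]
  constructor
  · intro h1
    have h2 := h1.smul (inv_ne_zero hc)
    rw [smul_smul, inv_mul_cancel₀ hc, one_smul] at h2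
    exact h2.eq_of_omegaZero hl
  · rintro rfl
    exact hasFlag_omegaZero.smul hc

/-- The substitution `(X, Y, Z) ↦ (-Z, Y, X)` turns `omegaZero (-1)` into `omegaFive`. -/
theorem orbit_foliationFive :
    foliationFive.orbit = (foliationZero (-1) (by norm_num)).orbit := by
  refine orbit_eq_of_mem ?_
  refine mk_mem_orbit_iff.mpr ?_
  obtain ⟨c, hc, h⟩ := exists_form_foliationZero (-1) (by norm_num)
  refine ⟨Matrix.GeneralLinearGroup.mkOfDetNeZero !![0, 0, -1; 0, 1, 0; 1, 0, 0] ?_, c⁻¹,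
    inv_ne_zero hc, ?_⟩
  · rw [Matrix.det_fin_three]
    simp
  · rw [h, OneForm.pullback_smul, smul_smul, inv_mul_cancel₀ hc, one_smul]
    refine OneForm.ext_ev fun p v => ?_
    rw [OneForm.ev_pullback, ev_omegaZero]
    simp [Matrix.GeneralLinearGroup.mkOfDetNeZero, OneForm.ev, omegaFive, Fin.sum_univ_three,
      Matrix.mulVec, dotProduct]
    ring

end Foliation

/-! ### Weighted scaling and the degeneration onto `F₀(l)` -/

namespace QuadField

/-- The coefficients of the form attached to a quadratic field, pulled back by a linear map, as a
linear function of the field. -/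
def coordsPullback (h : Matrix (Fin 3) (Fin 3) ℂ) :
    QuadField →ₗ[ℂ] (Fin 3 × (Fin 3 →₀ ℕ) → ℂ) where
  toFun w := (w.form.pullback h).coords
  map_add' w w' := by
    funext q
    simp only [OneForm.coords, form_add, OneForm.pullback_apply, Pi.add_apply, map_add, mul_add,
      Finset.sum_add_distrib, coeff_add]
  map_smul' c w := by
    funext q
    simp only [OneForm.coords, form_smul, OneForm.pullback_smul, Pi.smul_apply, coeff_smul,
      RingHom.id_apply]

theorem continuous_coordsPullback (h : Matrix (Fin 3) (Fin 3) ℂ) :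
    Continuous (coordsPullback h) :=
  LinearMap.continuous_of_finiteDimensional _

/-- The action on quadratic fields of the diagonal maps `(t², t, 1)`, extended to `t = 0` for the
fields with a nondegenerate singularity in normal position. -/
def scale (w : QuadField) (t : ℂ) : QuadField :=
  -- The four excluded indices are exactly those of negative exponent, so the natural subtraction
  -- never truncates.
  fun q => if q = (0, 2, 2) ∨ q = (1, 2, 2) ∨ q = (0, 1, 2) ∨ q = (0, 2, 1) then 0
    else t ^ ((![2, 1, 0] q.2.1 + ![2, 1, 0] q.2.2 - ![2, 1, 0] q.1 : ℕ)) * w q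

theorem continuous_scale (w : QuadField) : Continuous w.scale := by
  refine continuous_pi fun q => ?_
  simp only [scale]
  split_ifs <;> fun_prop

/-- Conjugation by `diag(t², t, 1)` multiplies each coefficient of the field by a power of `t`, and
the determinant `t ^ 3` comes out of the triple product. Only the sum of the coefficients `(0, 1,
2)` and `(0, 2, 1)` matters, so both may be dropped. -/
theorem form_scale (w : QuadField) (h0 : w (0, 2, 2) = 0) (h1 : w (1, 2, 2) = 0)
    (h01 : w (0, 1, 2) + w (0, 2, 1) = 0) (t : ℂ) :
    w.form.pullback (Matrix.diagonal ![t ^ 2, t, 1]) = t ^ 3 • (w.scale t).form := by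
  refine OneForm.ext_ev fun p v => ?_
  rw [OneForm.ev_pullback, OneForm.ev_smul, ev_form, ev_form]
  set D := Matrix.diagonal ![t ^ 2, t, 1] with hD
  have hDv : ∀ x, D.mulVec x = ![t ^ 2 * x 0, t * x 1, x 2] := by
    intro x
    funext i
    rw [hD, Matrix.mulVec_diagonal]
    fin_cases i <;> simp
  have hq : w.quad (D.mulVec p) = D.mulVec ((w.scale t).quad p) := by
    rw [hDv, hDv]
    funext i
    fin_cases i
    · simp [quad, scale, Fin.sum_univ_three, h0]
      linear_combination (t * p 1 * p 2) * h01
    · simp [quad, scale, Fin.sum_univ_three, h1]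
      ring
    · simp [quad, scale, Fin.sum_univ_three]
      ring
  rw [hq, hDv, hDv, hDv]
  simp [triple]
  ring

/-- At `t = 0` only the coefficients of weight zero survive. The remaining field is `f •
quadFieldZero l` plus a multiple of the radial field, which the form does not see. -/
theorem form_scale_zero (w : QuadField) {l f : ℂ} (hf : w (0, 1, 1) = f)
    (h1 : w (2, 2, 2) - (w (1, 2, 1) + w (1, 1, 2)) = f)
    (h2 : w (0, 0, 2) + w (0, 2, 0) - w (2, 2, 2) = l * f) :
    (w.scale 0).form = f • omegaZero l := by
  refine OneForm.ext_ev fun p v => ?_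
  have hq : (w.scale 0).quad p = ![(w (0, 0, 2) + w (0, 2, 0)) * p 0 * p 2 + f * p 1 ^ 2,
      (w (1, 2, 1) + w (1, 1, 2)) * (p 1 * p 2), w (2, 2, 2) * p 2 ^ 2] := by
    funext i
    fin_cases i
    · simp [quad, scale, Fin.sum_univ_three, hf]
      ring
    · simp [quad, scale, Fin.sum_univ_three]
      ring
    · simp [quad, scale, Fin.sum_univ_three, pow_two]
  rw [OneForm.ev_smul, ev_form, hq, ev_omegaZero]
  simp [triple]
  linear_combination (p 1 * p 2 ^ 2 * v 0 - p 0 * p 1 * p 2 * v 2) * h1 +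
    (p 0 * p 2 ^ 2 * v 1 - p 0 * p 1 * p 2 * v 2) * h2

end QuadField

open OneForm QuadField in
/-- In suitable coordinates, a form with an eigendirection of ratio `-l` degenerates onto
`omegaZero l` under the diagonal maps `(t², t, 1)`. -/
theorem IsFlag.exists_scale {ω : OneForm} (hω : DefinesFoliation 2 ω) {l : ℂ} {a b p : Fin 3 → ℂ}
    (h : IsFlag ω l a b p) : ∃ (g : GL (Fin 3) ℂ) (w : QuadField) (f : ℂ), f ≠ 0 ∧
      (∀ t, (ω.pullback g.1).pullback (Matrix.diagonal ![t ^ 2, t, 1]) =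
        t ^ 3 • (w.scale t).form) ∧ (w.scale 0).form = f • omegaZero l := by
  set e := ω.der p b a with he
  set f := ω.ev (p + b) b with hf
  have he0 : e ≠ 0 := h.nondegenerate
  have hf0 : f ≠ 0 := h.transverse
  have hx : f / e ≠ 0 := div_ne_zero hf0 he0
  -- Stretching `a` by `f / e` gives `Y dX` the same coefficient `f` as `Y² dY`.
  have hframe : IsFrame ((f / e) • a) b p := by
    have h1 : (Matrix.of ![(f / e) • a, b, p]).det = f / e * (Matrix.of ![a, b, p]).det := by
      rw [Matrix.det_fin_three, Matrix.det_fin_three]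
      simp only [Matrix.of_apply, Matrix.cons_val, Pi.smul_apply, smul_eq_mul]
      ring
    rw [IsFrame, h1]
    exact mul_ne_zero hx h.frame
  set η := ω.pullback hframe.toGL.1 with hη
  set w := η.quadField with hw
  have hηw : w.form = η := (hω.pullback hframe.toGL).form_quadField
  have g0 : hframe.toGL.1.mulVec (Pi.single 0 1) = (f / e) • a := by
    rw [hframe.toGL_mulVec]
    simp
  have g1 : hframe.toGL.1.mulVec (Pi.single 1 1) = b := by
    rw [hframe.toGL_mulVec]
    simp
  have g2 : hframe.toGL.1.mulVec (Pi.single 2 1) = p := by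
    rw [hframe.toGL_mulVec]
    simp
  have e1 : w.form.ev (Pi.single 2 1) (Pi.single 0 1) = 0 := by
    rw [hηw, hη, ev_pullback, g2, h.singular]
  have e2 : w.form.ev (Pi.single 2 1) (Pi.single 1 1) = 0 := by
    rw [hηw, hη, ev_pullback, g2, h.singular]
  have e3 : w.form.der (Pi.single 2 1) (Pi.single 1 1) (Pi.single 1 1) = 0 := by
    rw [hηw, hη, der_pullback, g2, g1, h.isotropic]
  have e4 : w.form.der (Pi.single 2 1) (Pi.single 0 1) (Pi.single 1 1) = l * f := by
    rw [hηw, hη, der_pullback, g2, g1, g0, der_smul_left, h.ratio, ← he]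
    field_simp
  have e5 : w.form.der (Pi.single 2 1) (Pi.single 1 1) (Pi.single 0 1) = f := by
    rw [hηw, hη, der_pullback, g2, g1, g0, der_smul_right, ← he]
    field_simp
  have e6 : w.form.ev (Pi.single 2 1 + Pi.single 1 1) (Pi.single 1 1) = f := by
    rw [hηw, hη, ev_pullback, Matrix.mulVec_add, g2, g1]
  have e7 := ev_form_add_smul' w (Pi.single 2 1) (Pi.single 1 1) (Pi.single 1 1) 1
  rw [one_smul, e6, e2, e3] at e7
  rw [ev_form] at e1 e2 e7
  rw [der_form] at e3 e4 e5 e7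
  simp [triple, quad, polar, Fin.sum_univ_three] at e1 e2 e3 e4 e5 e7
  refine ⟨hframe.toGL, w, f, hf0, fun t => ?_, form_scale_zero w e7.symm ?_ ?_⟩
  · rw [← hη, ← hηw]
    refine form_scale w e2 e1 ?_ t
    linear_combination e3
  · linear_combination e5
  · linear_combination e4

theorem FoliationForm.continuous_toFoliation (N : ℕ) :
    Continuous (FoliationForm.toFoliation : FoliationForm N → Foliation N) :=
  continuous_quot_mk

namespace Foliation

open QuadField in
-- The scaling curve, followed by an arbitrary `h`, is continuous through `t = 0`. It stays in the
-- orbit of `F` for `t ≠ 0` and ends at the prescribed member of the orbit of `foliationZero`.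
theorem orbit_foliationZero_subset_closure {F : Foliation 2} {l : ℂ} (hl : l ≠ 0)
    (hF : HasFlag F.form l) : (foliationZero l hl).orbit ⊆ closure F.orbit := by
  rintro G ⟨h, c, hc, hG⟩
  obtain ⟨a, b, p, hflag⟩ := hF
  obtain ⟨g, w, f, hf, hw, hw0⟩ := hflag.exists_scale F.definesFoliation_form
  obtain ⟨c', hc', hz⟩ := exists_form_foliationZero l hl
  have hscale : ∀ t, t ≠ 0 → ∃ D : GL (Fin 3) ℂ,
      (w.scale t).form = (t ^ 3)⁻¹ • (F.form.pullback g.1).pullback D.1 := by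
    intro t ht
    refine ⟨Matrix.GeneralLinearGroup.mkOfDetNeZero (Matrix.diagonal ![t ^ 2, t, 1]) ?_, ?_⟩
    · rw [Matrix.det_diagonal, Fin.prod_univ_three]
      simpa using ht
    · have h1 := hw t
      change _ = (t ^ 3)⁻¹ • (F.form.pullback g.1).pullback (Matrix.diagonal ![t ^ 2, t, 1])
      rw [h1, smul_smul, inv_mul_cancel₀ (pow_ne_zero 3 ht), one_smul]
  have hdef : ∀ t, DefinesFoliation 2 ((w.scale t).form.pullback h.1) := by
    intro t
    by_cases ht : t = 0
    · rw [ht, hw0]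
      exact ((definesFoliation_omegaZero hl).smul hf).pullback h
    · obtain ⟨D, hD⟩ := hscale t ht
      rw [hD]
      exact (((F.definesFoliation_form.pullback g).pullback D).smul
        (inv_ne_zero (pow_ne_zero 3 ht))).pullback h
  set Γ : ℂ → FoliationForm 2 := fun t => ⟨_, hdef t⟩ with hΓ
  have hcont : Continuous Γ :=
    continuous_induced_rng.mpr ((continuous_coordsPullback h.1).comp w.continuous_scale)
  have hlim : Filter.Tendsto (fun t => (Γ t).toFoliation) (𝓝[≠] 0) (𝓝 (Γ 0).toFoliation) :=
    (((FoliationForm.continuous_toFoliation 2).comp hcont).tendsto 0).mono_left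
      nhdsWithin_le_nhds
  have hG0 : G = (Γ 0).toFoliation := by
    rw [← mk_form G]
    refine mk_eq_mk_iff.mpr ⟨f * (c * c')⁻¹, mul_ne_zero hf (inv_ne_zero (mul_ne_zero hc hc')), ?_⟩
    rw [hG, hz, hw0, OneForm.pullback_smul, OneForm.pullback_smul, smul_smul, smul_smul, mul_assoc,
      inv_mul_cancel_right₀ (mul_ne_zero hc hc')]
  rw [hG0]
  refine mem_closure_of_tendsto hlim ?_
  filter_upwards [self_mem_nhdsWithin] with t ht
  obtain ⟨D, hD⟩ := hscale t ht
  refine mk_mem_orbit_iff.mpr ⟨g * D * h, (t ^ 3)⁻¹, inv_ne_zero (pow_ne_zero 3 ht), ?_⟩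
  rw [hD, OneForm.pullback_smul, OneForm.pullback_pullback, OneForm.pullback_pullback,
    Units.val_mul, Units.val_mul, Matrix.mul_assoc]

/-- The orbits differ because `foliationZero` has the invariant line `Y = 0`. -/
theorem degeneratesOnto_foliationZero {F : Foliation 2} (hF : ¬ F.HasInvariantLine) {l : ℂ}
    (hl : l ≠ 0) (h : F.form.HasBB (2 - l - 1 / l)) : F.DegeneratesOnto (foliationZero l hl) := by
  refine ⟨orbit_foliationZero_subset_closure hl (hasFlag_of_hasBB hF hl h), fun h1 => hF ?_⟩
  exact hasInvariantLine_of_mem_orbit (mem_of_orbit_eq h1.symm) (hasInvariantLine_foliationZero l hl)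

theorem degeneratesOnto_foliationFive {F : Foliation 2} (hF : ¬ F.HasInvariantLine)
    (h : F.form.HasBB 4) : F.DegeneratesOnto foliationFive := by
  have h1 := degeneratesOnto_foliationZero hF (l := -1) (by norm_num)
    (by convert h using 1; norm_num)
  rwa [DegeneratesOnto, ← orbit_foliationFive] at h1

end Foliation

/-! ### Persistence under perturbation, and specialization -/

/-- Solvability, near a given solution, of equations depending on parameters. -/
theorem HasStrictFDerivAt.eventually_exists_eq_zero {E G : Type*} [NormedAddCommGroup E]
    [NormedSpace ℂ E] [CompleteSpace E] [NormedAddCommGroup G] [NormedSpace ℂ G]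
    [FiniteDimensional ℂ G] {H : E × G → G} {H' : E × G →L[ℂ] G} {w₀ : E}
    (hH : HasStrictFDerivAt H H' (w₀, 0)) (h0 : H (w₀, 0) = 0)
    (hinj : ∀ x, H' (0, x) = 0 → x = 0) {S : E × G → Prop}
    (hS : ∀ᶠ y in 𝓝 (w₀, (0 : G)), S y) : ∀ᶠ w in 𝓝 w₀, ∃ x, S (w, x) ∧ H (w, x) = 0 := by
  have : CompleteSpace G := FiniteDimensional.complete ℂ G
  have hΦ : HasStrictFDerivAt (fun z : E × G => (z.1, H z))
      ((ContinuousLinearMap.fst ℂ E G).prod H') (w₀, 0) := hasStrictFDerivAt_fst.prodMk hH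
  have hsurj : ((ContinuousLinearMap.fst ℂ E G).prod H').range = ⊤ := by
    rw [LinearMap.range_eq_top]
    rintro ⟨u, y⟩
    have hi : Function.Injective ((H' : E × G →ₗ[ℂ] G).comp (LinearMap.inr ℂ E G)) := by
      rw [injective_iff_map_eq_zero]
      exact fun x hx => hinj x hx
    obtain ⟨x, hx⟩ := LinearMap.injective_iff_surjective.mp hi (y - H' (u, 0))
    refine ⟨(u, x), ?_⟩
    have h1 : H' (0, x) = y - H' (u, 0) := hx
    have h2 : ((u, x) : E × G) = (u, 0) + (0, x) := by simp
    have h3 : H' (u, x) = y := by rw [h2, map_add, h1, add_sub_cancel]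
    exact Prod.ext rfl h3
  -- The map `(w, x) ↦ (w, H (w, x))` is open at the base point, so the nearby values `(w, 0)` are
  -- attained.
  have hmap := hΦ.map_nhds_eq_of_surj hsurj
  have himg : (fun z : E × G => (z.1, H z)) '' {y | S y} ∈ 𝓝 (w₀, (0 : G)) := by
    have := Filter.image_mem_map (m := fun z : E × G => (z.1, H z)) hS
    rw [hmap] at this
    simpa only [h0] using this
  have hc : Filter.Tendsto (fun w : E => (w, (0 : G))) (𝓝 w₀) (𝓝 (w₀, 0)) :=
    (Continuous.prodMk_left (0 : G)).tendsto w₀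
  filter_upwards [hc himg] with w hw
  obtain ⟨⟨w', x⟩, hx, h1⟩ := hw
  obtain ⟨h1, h2⟩ := Prod.mk.inj h1
  have h3 : w' = w := h1
  subst h3
  exact ⟨x, hx, h2⟩

namespace QuadField

variable {E : Type*} [NormedAddCommGroup E] [NormedSpace ℂ E] {n : WithTop ℕ∞}
  {W : E → QuadField} {P Q U : E → Fin 3 → ℂ}

theorem contDiff_triple (hP : ContDiff ℂ n P) (hQ : ContDiff ℂ n Q) (hU : ContDiff ℂ n U) :
    ContDiff ℂ n fun z => triple (P z) (Q z) (U z) := by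
  rw [contDiff_pi] at hP hQ hU
  unfold triple
  fun_prop

theorem contDiff_quad (hW : ContDiff ℂ n W) (hP : ContDiff ℂ n P) :
    ContDiff ℂ n fun z => (W z).quad (P z) := by
  rw [contDiff_pi] at hW hP ⊢
  unfold quad
  fun_prop

theorem contDiff_polar (hW : ContDiff ℂ n W) (hP : ContDiff ℂ n P) (hQ : ContDiff ℂ n Q) :
    ContDiff ℂ n fun z => (W z).polar (P z) (Q z) := by
  rw [contDiff_pi] at hW hP hQ ⊢
  unfold polar
  fun_prop

theorem contDiff_ev (hW : ContDiff ℂ n W) (hP : ContDiff ℂ n P) (hU : ContDiff ℂ n U) :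
    ContDiff ℂ n fun z => (W z).form.ev (P z) (U z) := by
  simp only [ev_form]
  exact contDiff_triple hP (contDiff_quad hW hP) hU

theorem contDiff_der (hW : ContDiff ℂ n W) (hP : ContDiff ℂ n P) (hQ : ContDiff ℂ n Q)
    (hU : ContDiff ℂ n U) : ContDiff ℂ n fun z => (W z).form.der (P z) (Q z) (U z) := by
  simp only [der_form]
  exact (contDiff_triple hQ (contDiff_quad hW hP) hU).add
    (contDiff_triple hP (contDiff_polar hW hP hQ) hU)

theorem ev_form_self (w : QuadField) (p : Fin 3 → ℂ) : w.form.ev p p = 0 := by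
  rw [ev_form, triple]
  ring

theorem singular_of_isFrame (w : QuadField) {a b p : Fin 3 → ℂ} (h : IsFrame a b p)
    (ha : w.form.ev p a = 0) (hb : w.form.ev p b = 0) (v : Fin 3 → ℂ) : w.form.ev p v = 0 := by
  obtain ⟨s, t, u, rfl⟩ := h.exists_combination v
  simp only [OneForm.ev_add_right, OneForm.ev_smul_right, ha, hb, ev_form_self, mul_zero, add_zero]

end QuadField

theorem eventually_isFrame {T : Type*} [TopologicalSpace T] {a b p : T → Fin 3 → ℂ} {z : T}
    (ha : Continuous a) (hb : Continuous b) (hp : Continuous p) (h : IsFrame (a z) (b z) (p z)) :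
    ∀ᶠ y in 𝓝 z, IsFrame (a y) (b y) (p y) := by
  have hc : Continuous fun y => (Matrix.of ![a y, b y, p y]).det := by
    simp only [Matrix.det_fin_three, Matrix.of_apply, Matrix.cons_val]
    fun_prop
  exact hc.continuousAt.eventually_ne h

theorem eventually_div_mem {T : Type*} [TopologicalSpace T] {f g : T → ℂ} {z : T} {c : ℂ}
    {U : Set ℂ} (hf : Continuous f) (hg : Continuous g) (hz : g z ≠ 0) (hc : f z = c * g z)
    (hU : U ∈ 𝓝 c) : ∀ᶠ y in 𝓝 z, g y ≠ 0 ∧ f y / g y ∈ U := by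
  refine (hg.continuousAt.eventually_ne hz).and
    ((hf.continuousAt.div hg.continuousAt hz).eventually_mem ?_)
  rwa [Pi.div_apply, hc, mul_div_cancel_right₀ _ hz]

/-- A nondegenerate singular point persists, with a nearby Baum–Bott invariant. -/
theorem eventually_exists_hasBB {w₀ : QuadField} {z₀ : ℂ} (h : w₀.form.HasBB z₀) {U : Set ℂ}
    (hU : U ∈ 𝓝 z₀) : ∀ᶠ w in 𝓝 w₀, ∃ z ∈ U, w.form.HasBB z := by
  obtain ⟨a, b, p, hf, hs, hd, ht⟩ := h
  obtain ⟨P, hP⟩ : ∃ P : QuadField × (Fin 2 → ℂ) → Fin 3 → ℂ,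
      P = fun y => p + (y.2 0 • a + y.2 1 • b) := ⟨_, rfl⟩
  have hP0 : P (w₀, 0) = p := by simp [hP]
  have cW : ContDiff ℂ 1 fun y : QuadField × (Fin 2 → ℂ) => y.1 := contDiff_fst
  have cP : ContDiff ℂ 1 P := by rw [hP]; fun_prop
  have cc : ∀ v : Fin 3 → ℂ, ContDiff ℂ 1 fun _ : QuadField × (Fin 2 → ℂ) => v :=
    fun v => contDiff_const
  have cD : ∀ u v : Fin 3 → ℂ, Continuous fun y : QuadField × (Fin 2 → ℂ) =>
      y.1.form.der (P y) u v := fun u v => (QuadField.contDiff_der cW cP (cc u) (cc v)).continuous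
  have cdet : Continuous fun y : QuadField × (Fin 2 → ℂ) => y.1.form.jacDet (P y) a b :=
    ((cD a a).mul (cD b b)).sub ((cD a b).mul (cD b a))
  have ctr : Continuous fun y : QuadField × (Fin 2 → ℂ) => y.1.form.jacTr (P y) a b :=
    (cD a b).sub (cD b a)
  obtain ⟨H, hH⟩ : ∃ H : QuadField × (Fin 2 → ℂ) → Fin 2 → ℂ,
      H = fun y => ![y.1.form.ev (P y) a, y.1.form.ev (P y) b] := ⟨_, rfl⟩
  have cH : ContDiff ℂ 1 H := by
    rw [hH, contDiff_pi]
    intro i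
    fin_cases i
    · exact QuadField.contDiff_ev cW cP (cc a)
    · exact QuadField.contDiff_ev cW cP (cc b)
  have hstrict := (cH.contDiffAt (x := (w₀, 0))).hasStrictFDerivAt one_ne_zero
  -- The linearized equations for the shift of the singular point have determinant `jacDet`.
  have hinj : ∀ x, fderiv ℂ H (w₀, 0) (0, x) = 0 → x = 0 := by
    intro x hx
    have hline : HasDerivAt (fun t : ℂ => ((w₀, t • x) : QuadField × (Fin 2 → ℂ))) (0, x) 0 := by
      refine (hasDerivAt_const (0 : ℂ) w₀).prodMk ?_
      simpa using (hasDerivAt_id (0 : ℂ)).smul_const x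
    have h1 : HasFDerivAt H (fderiv ℂ H (w₀, 0)) (w₀, (0 : ℂ) • x) := by
      rw [zero_smul]
      exact hstrict.hasFDerivAt
    have h2 := h1.comp_hasDerivAt (0 : ℂ) hline
    rw [hx, hasDerivAt_pi] at h2
    subst hH
    have hPt : ∀ t : ℂ, P (w₀, t • x) = p + t • (x 0 • a + x 1 • b) := fun t => by
      simp only [hP, Pi.smul_apply, smul_eq_mul, smul_add, smul_smul]
    have e0 : HasDerivAt (fun t : ℂ => w₀.form.ev (P (w₀, t • x)) a) 0 0 := h2 0
    have e1 : HasDerivAt (fun t : ℂ => w₀.form.ev (P (w₀, t • x)) b) 0 0 := h2 1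
    simp only [hPt] at e0 e1
    have f0 := e0.unique (OneForm.hasDerivAt_ev _ _ _ _)
    have f1 := e1.unique (OneForm.hasDerivAt_ev _ _ _ _)
    rw [OneForm.der_add_left, OneForm.der_smul_left, OneForm.der_smul_left] at f0 f1
    rw [OneForm.jacDet] at hd
    have x0 : x 0 = 0 := by
      refine (mul_eq_zero.mp ?_).resolve_right hd
      linear_combination w₀.form.der p b a * f1 - w₀.form.der p b b * f0
    have x1 : x 1 = 0 := by
      refine (mul_eq_zero.mp ?_).resolve_right hd
      linear_combination w₀.form.der p a b * f0 - w₀.form.der p a a * f1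
    funext i
    fin_cases i
    · exact x0
    · exact x1
  have h0 : H (w₀, 0) = 0 := by
    simp only [hH, hP0, hs]
    funext i
    fin_cases i <;> rfl
  have hS : ∀ᶠ y : QuadField × (Fin 2 → ℂ) in 𝓝 (w₀, 0), IsFrame a b (P y) ∧
      y.1.form.jacDet (P y) a b ≠ 0 ∧
      y.1.form.jacTr (P y) a b ^ 2 / y.1.form.jacDet (P y) a b ∈ U := by
    have s1 : ∀ᶠ y : QuadField × (Fin 2 → ℂ) in 𝓝 (w₀, 0), IsFrame a b (P y) :=
      eventually_isFrame continuous_const continuous_const cP.continuous (by rwa [hP0])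
    exact s1.and (eventually_div_mem (ctr.pow 2) cdet (by rwa [hP0]) (by rw [hP0, ht]) hU)
  filter_upwards [hstrict.eventually_exists_eq_zero h0 hinj hS] with w hw
  obtain ⟨x, ⟨h1, h2, h3⟩, h4⟩ := hw
  subst hH
  refine ⟨_, h3, a, b, P (w, x), h1, w.singular_of_isFrame h1 (congrFun h4 0) (congrFun h4 1), h2,
    ?_⟩
  rw [div_mul_cancel₀ _ h2]

/-- An eigendirection persists, with a nearby ratio. -/
theorem IsFlag.eventually_exists_hasFlag {w₀ : QuadField} {l₀ : ℂ} {a b p : Fin 3 → ℂ}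
    (h : IsFlag w₀.form l₀ a b p) (hl₀ : l₀ ≠ 0) (hl : l₀ ≠ -1)
    {U : Set ℂ} (hU : U ∈ 𝓝 l₀) :
    ∀ᶠ w in 𝓝 w₀, ∃ l ∈ U, HasFlag w.form l := by
  obtain ⟨P, hP⟩ : ∃ P : QuadField × (Fin 3 → ℂ) → Fin 3 → ℂ,
      P = fun y => p + (y.2 0 • a + y.2 1 • b) := ⟨_, rfl⟩
  obtain ⟨B, hB⟩ : ∃ B : QuadField × (Fin 3 → ℂ) → Fin 3 → ℂ,
      B = fun y => b + y.2 2 • a := ⟨_, rfl⟩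
  have hP0 : P (w₀, 0) = p := by simp [hP]
  have hB0 : B (w₀, 0) = b := by simp [hB]
  have cW : ContDiff ℂ 1 fun y : QuadField × (Fin 3 → ℂ) => y.1 := contDiff_fst
  have cP : ContDiff ℂ 1 P := by rw [hP]; fun_prop
  have cB : ContDiff ℂ 1 B := by rw [hB]; fun_prop
  have ca : ContDiff ℂ 1 fun _ : QuadField × (Fin 3 → ℂ) => a := contDiff_const
  have cb : ContDiff ℂ 1 fun _ : QuadField × (Fin 3 → ℂ) => b := contDiff_const
  obtain ⟨H, hH⟩ : ∃ H : QuadField × (Fin 3 → ℂ) → Fin 3 → ℂ,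
      H = fun y =>
    ![y.1.form.ev (P y) a, y.1.form.ev (P y) b, y.1.form.der (P y) (B y) (B y)] := ⟨_, rfl⟩
  have cH : ContDiff ℂ 1 H := by
    rw [hH, contDiff_pi]
    intro i
    fin_cases i
    · exact QuadField.contDiff_ev cW cP ca
    · exact QuadField.contDiff_ev cW cP cb
    · exact QuadField.contDiff_der cW cP cB cB
  have hstrict := (cH.contDiffAt (x := (w₀, 0))).hasStrictFDerivAt one_ne_zero
  -- The unknowns are two shifts of the point and the tilt of `b` towards `a`. The linearized system
  -- is triangular with pivots `der p a b`, `der p b a` and their sum, all nonzero because `l₀` is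
  -- neither `0` nor `-1`.
  have hinj : ∀ x, fderiv ℂ H (w₀, 0) (0, x) = 0 → x = 0 := by
    intro x hx
    have hline : HasDerivAt (fun t : ℂ => ((w₀, t • x) : QuadField × (Fin 3 → ℂ))) (0, x) 0 := by
      refine (hasDerivAt_const (0 : ℂ) w₀).prodMk ?_
      simpa using (hasDerivAt_id (0 : ℂ)).smul_const x
    have h1 : HasFDerivAt H (fderiv ℂ H (w₀, 0)) (w₀, (0 : ℂ) • x) := by
      rw [zero_smul]
      exact hstrict.hasFDerivAt
    have h2 := h1.comp_hasDerivAt (0 : ℂ) hline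
    rw [hx, hasDerivAt_pi] at h2
    subst hH
    have hPt : ∀ t : ℂ, P (w₀, t • x) = p + t • (x 0 • a + x 1 • b) := fun t => by
      simp only [hP, Pi.smul_apply, smul_eq_mul, smul_add, smul_smul]
    have e0 : HasDerivAt (fun t : ℂ => w₀.form.ev (P (w₀, t • x)) a) 0 0 := h2 0
    have e1 : HasDerivAt (fun t : ℂ => w₀.form.ev (P (w₀, t • x)) b) 0 0 := h2 1
    have e2 : HasDerivAt (fun t : ℂ =>
      w₀.form.der (P (w₀, t • x)) (B (w₀, t • x)) (B (w₀, t • x))) 0 0 := h2 2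
    simp only [hPt] at e0 e1 e2
    have f0 := e0.unique (OneForm.hasDerivAt_ev _ _ _ _)
    have f1 := e1.unique (OneForm.hasDerivAt_ev _ _ _ _)
    rw [OneForm.der_add_left, OneForm.der_smul_left, OneForm.der_smul_left] at f0 f1
    rw [h.isotropic, mul_zero, add_zero] at f1
    have hab : w₀.form.der p a b ≠ 0 := by
      rw [h.ratio]
      intro h0
      rcases mul_eq_zero.mp h0 with h0 | h0
      · exact hl₀ h0
      · exact h.nondegenerate h0
    have x0 : x 0 = 0 := (mul_eq_zero.mp f1.symm).resolve_right hab
    rw [x0, zero_mul, zero_add] at f0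
    have x1 : x 1 = 0 := (mul_eq_zero.mp f0.symm).resolve_right h.nondegenerate
    have e3 : ∀ t : ℂ, w₀.form.der (p + t • (x 0 • a + x 1 • b)) (B (w₀, t • x)) (B (w₀, t • x)) =
        t * (x 2 * (w₀.form.der p a b + w₀.form.der p b a)) +
          t ^ 2 * (x 2 ^ 2 * w₀.form.der p a a) := by
      intro t
      simp only [hB, x0, x1, zero_smul, smul_zero, add_zero, Pi.smul_apply, smul_eq_mul,
        OneForm.der_add_left, OneForm.der_add_right, OneForm.der_smul_left,
        OneForm.der_smul_right, h.isotropic]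
      ring
    simp only [e3] at e2
    have e4 := ((hasDerivAt_id (0 : ℂ)).mul_const
      (x 2 * (w₀.form.der p a b + w₀.form.der p b a))).add
      (((hasDerivAt_id (0 : ℂ)).pow 2).mul_const (x 2 ^ 2 * w₀.form.der p a a))
    have f2 := e2.unique e4
    simp at f2
    have x2 : x 2 = 0 := by
      refine f2.resolve_right fun h3 => ?_
      rw [h.ratio] at h3
      have h4 : (l₀ + 1) * w₀.form.der p b a = 0 := by linear_combination h3
      rcases mul_eq_zero.mp h4 with h4 | h4
      · exact hl (by linear_combination h4)
      · exact h.nondegenerate h4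
    funext i
    fin_cases i
    · exact x0
    · exact x1
    · exact x2
  have h0 : H (w₀, 0) = 0 := by
    simp only [hH, hP0, hB0, h.singular, h.isotropic]
    funext i
    fin_cases i <;> rfl
  have cba : Continuous fun y : QuadField × (Fin 3 → ℂ) => y.1.form.der (P y) (B y) a :=
    (QuadField.contDiff_der cW cP cB ca).continuous
  have cab : Continuous fun y : QuadField × (Fin 3 → ℂ) => y.1.form.der (P y) a (B y) :=
    (QuadField.contDiff_der cW cP ca cB).continuous
  have ctrans : Continuous fun y : QuadField × (Fin 3 → ℂ) => y.1.form.ev (P y + B y) (B y) :=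
    (QuadField.contDiff_ev cW (cP.add cB) cB).continuous
  have hS : ∀ᶠ y : QuadField × (Fin 3 → ℂ) in 𝓝 (w₀, 0), IsFrame a (B y) (P y) ∧
      y.1.form.der (P y) (B y) a ≠ 0 ∧ y.1.form.ev (P y + B y) (B y) ≠ 0 ∧
      y.1.form.der (P y) a (B y) / y.1.form.der (P y) (B y) a ∈ U := by
    have s1 : ∀ᶠ y : QuadField × (Fin 3 → ℂ) in 𝓝 (w₀, 0), IsFrame a (B y) (P y) :=
      eventually_isFrame continuous_const cB.continuous cP.continuous
        (by rw [hP0, hB0]; exact h.frame)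
    have s2 : ∀ᶠ y : QuadField × (Fin 3 → ℂ) in 𝓝 (w₀, 0), y.1.form.der (P y) (B y) a ≠ 0 ∧
        y.1.form.der (P y) a (B y) / y.1.form.der (P y) (B y) a ∈ U :=
      eventually_div_mem cab cba (by rw [hP0, hB0]; exact h.nondegenerate)
        (by rw [hP0, hB0]; exact h.ratio) hU
    have s3 : ∀ᶠ y : QuadField × (Fin 3 → ℂ) in 𝓝 (w₀, 0), y.1.form.ev (P y + B y) (B y) ≠ 0 :=
      ctrans.continuousAt.eventually_ne (by rw [hP0, hB0]; exact h.transverse)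
    filter_upwards [s1, s2, s3] with y h1 h2 h3
    exact ⟨h1, h2.1, h3, h2.2⟩
  filter_upwards [hstrict.eventually_exists_eq_zero h0 hinj hS] with w hw
  obtain ⟨x, ⟨h1, h2, h3, h4⟩, h5⟩ := hw
  subst hH
  have ea : w.form.ev (P (w, x)) a = 0 := congrFun h5 0
  have eb : w.form.ev (P (w, x)) b = 0 := congrFun h5 1
  have eB : w.form.ev (P (w, x)) (B (w, x)) = 0 := by
    simp only [hB, OneForm.ev_add_right, OneForm.ev_smul_right, ea, eb, mul_zero, add_zero]
  exact ⟨_, h4, a, B (w, x), P (w, x), h1, w.singular_of_isFrame h1 ea eB, congrFun h5 2,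
    (div_mul_cancel₀ _ h2).symm, h2, h3⟩

theorem hasBB_omegaZero_neg_one : (omegaZero (-1)).HasBB 4 := by
  refine ⟨Pi.single 0 1, Pi.single 1 1, Pi.single 2 1, ?_, fun v => ?_, ?_, ?_⟩
  · rw [IsFrame, Matrix.det_fin_three]
    simp
  · simp [ev_omegaZero]
  · simp [OneForm.jacDet, der_omegaZero]
  · simp [OneForm.jacTr, OneForm.jacDet, der_omegaZero]
    norm_num

namespace Foliation

theorem hasBB_of_mem_orbit {N : ℕ} {F G : Foliation N} (h : G ∈ F.orbit) {z : ℂ}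
    (hz : G.form.HasBB z) : F.form.HasBB z := by
  obtain ⟨g, c, hc, h⟩ := h
  rw [h] at hz
  have := hz.smul (inv_ne_zero hc)
  rw [smul_smul, inv_mul_cancel₀ hc, one_smul] at this
  exact this.of_pullback

theorem hasBB_foliationFive : foliationFive.form.HasBB 4 := by
  obtain ⟨c, hc, h⟩ := exists_form_foliationZero (-1) (by norm_num)
  refine hasBB_of_mem_orbit (mem_of_orbit_eq orbit_foliationFive) ?_
  rw [h]
  exact hasBB_omegaZero_neg_one.smul hc

theorem isOpen_setOf_exists_hasBB {U : Set ℂ} (hU : IsOpen U) :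
    IsOpen {G : Foliation 2 | ∃ z ∈ U, G.form.HasBB z} := by
  have h1 : IsOpen {w : QuadField | ∃ z ∈ U, w.form.HasBB z} := by
    rw [isOpen_iff_mem_nhds]
    rintro w ⟨z, hz, h⟩
    exact eventually_exists_hasBB h (hU.mem_nhds hz)
  have h2 := h1.preimage FoliationForm.continuous_quadField
  refine isOpen_coinduced.mpr ?_
  convert h2 using 1
  ext ω
  obtain ⟨c, hc, h⟩ := exists_form_mk ω.1 ω.2
  have h3 : ω.1.quadField.form = ω.1 := ω.2.form_quadField
  change (∃ z ∈ U, (mk ω.1 ω.2).form.HasBB z) ↔ ∃ z ∈ U, ω.1.quadField.form.HasBB z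
  rw [h, h3]
  refine exists_congr fun z => and_congr_right fun _ => ⟨fun h4 => ?_, fun h4 => h4.smul hc⟩
  have h5 := h4.smul (inv_ne_zero hc)
  rwa [smul_smul, inv_mul_cancel₀ hc, one_smul] at h5

theorem finite_setOf_hasBB {N : ℕ} (F : Foliation N) :
    {z | F.form.HasBB z}.Finite := by
  refine (F.finite_setOf_isSingular.image F.baumBott).subset fun z hz => ?_
  obtain ⟨m, h1, -, h2⟩ := (F.exists_baumBott_eq_iff z).mpr hz
  exact ⟨m, h1, h2⟩

/-- Baum–Bott invariants at nondegenerate singular points are inherited under specialization. -/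
theorem hasBB_of_mem_closure_orbit {F G : Foliation 2} (h : G ∈ closure F.orbit) {z : ℂ}
    (hz : G.form.HasBB z) : F.form.HasBB z := by
  -- The invariants of `F` are finitely many, so the complement of those other than `z` is an open
  -- neighbourhood of `z`.
  set T : Set ℂ := {y | F.form.HasBB y} \ {z} with hT
  have hTc : IsOpen Tᶜ := ((F.finite_setOf_hasBB).subset Set.sdiff_subset).isClosed.isOpen_compl
  obtain ⟨G', ⟨y, hy, h1⟩, h2⟩ := mem_closure_iff.mp h _ (isOpen_setOf_exists_hasBB hTc)
    ⟨z, by simp [hT], hz⟩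
  have h3 := hasBB_of_mem_orbit h2 h1
  by_contra h4
  refine hy ⟨h3, fun h5 => h4 ?_⟩
  rwa [← Set.mem_singleton_iff.mp h5]

theorem degeneratesOnto_foliationFive_iff {F : Foliation 2} (hF : ¬ F.HasInvariantLine) :
    F.DegeneratesOnto foliationFive ↔ F.form.HasBB 4 :=
  ⟨fun h => hasBB_of_mem_closure_orbit (h.1 (mem_orbit_self _)) hasBB_foliationFive,
    degeneratesOnto_foliationFive hF⟩

end Foliation

/-! ### Stabilizers and orbit dimension -/

/-- The stabilizer of the foliation given by `omegaZero l` is diagonal. -/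
theorem diagonal_of_pullback_omegaZero {l : ℂ} (hl : l ≠ 0) (hl' : l ≠ -1) {h : GL (Fin 3) ℂ}
    {c : ℂ} (hc : c ≠ 0) (hh : (omegaZero l).pullback h.1 = c • omegaZero l) :
    (∀ i j, i ≠ j → h.1 i j = 0) ∧ h.1 0 0 * h.1 2 2 = h.1 1 1 ^ 2 := by
  have hev : ∀ p v, (omegaZero l).ev (h.1.mulVec p) (h.1.mulVec v) = c * (omegaZero l).ev p v := by
    intro p v
    rw [← OneForm.ev_pullback, hh, OneForm.ev_smul]
  have hder : ∀ p w v, (omegaZero l).der (h.1.mulVec p) (h.1.mulVec w) (h.1.mulVec v) =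
      c * (omegaZero l).der p w v := by
    intro p w v
    rw [← OneForm.der_pullback, hh, OneForm.der_smul]
  have hdet : h.1.det ≠ 0 := (h.1.isUnit_iff_isUnit_det.mp h.isUnit).ne_zero
  have hsing : ∀ p, (∀ v, (omegaZero l).ev p v = 0) →
      h.1.mulVec p 1 = 0 ∧ (h.1.mulVec p 0 = 0 ∨ h.1.mulVec p 2 = 0) := by
    intro p hp
    refine omegaZero_singular hl fun v => ?_
    have h1 := hev p ((h⁻¹).1.mulVec v)
    rwa [hp, mul_zero, Matrix.mulVec_mulVec, ← Units.val_mul, mul_inv_cancel, Units.val_one,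
      Matrix.one_mulVec] at h1
  obtain ⟨h12, h02⟩ := hsing (Pi.single 2 1) fun v => by simp [ev_omegaZero]
  obtain ⟨h10, h00⟩ := hsing (Pi.single 0 1) fun v => by simp [ev_omegaZero]
  have d1 := hder (Pi.single 2 1) (Pi.single 1 1) (Pi.single 0 1)
  have d2 := hder (Pi.single 2 1) (Pi.single 1 1) (Pi.single 1 1)
  have d3 := hev (Pi.single 1 1) (Pi.single 2 1)
  have d4 := hev (Pi.single 1 1) (Pi.single 0 1)
  simp only [Matrix.mulVec_single_one, Matrix.col_apply] at h12 h02 h10 h00 d1 d2 d3 d4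
  simp [ev_omegaZero, der_omegaZero] at d1 d2 d3 d4
  rw [Matrix.det_fin_three] at hdet
  generalize h.1 = m at *
  rw [h12, h10] at hdet d1
  -- The two singular points cannot be exchanged: the linear part vanishes on these directions at
  -- `(1 : 0 : 0)`, and `d1` would give `c = 0`.
  have h02' : m 0 2 = 0 := by
    refine h02.resolve_right fun h22 => hc ?_
    rw [← d1, h22]
    ring
  have h20 : m 2 0 = 0 := by
    refine h00.resolve_left fun h00 => hdet ?_
    rw [h00, h02']
    ring
  rw [h02', h20] at hdet
  have hdet' : m 0 0 * m 1 1 * m 2 2 ≠ 0 := fun h0 => hdet (by linear_combination h0)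
  have n0 : m 0 0 ≠ 0 := fun h0 => hdet' (by rw [h0]; ring)
  have n1 : m 1 1 ≠ 0 := fun h0 => hdet' (by rw [h0]; ring)
  have n2 : m 2 2 ≠ 0 := fun h0 => hdet' (by rw [h0]; ring)
  simp only [h12, h02', h10, h20] at d1 d2 d3 d4
  -- For `l ≠ -1` the only eigendirections at `(0 : 0 : 1)` are the two axes, so the second one is
  -- preserved.
  have h01 : m 0 1 = 0 := by
    have h1 : ((1 + l) * m 2 2 ^ 2 * m 1 1) * m 0 1 = 0 := by linear_combination d2
    refine (mul_eq_zero.mp h1).resolve_left ?_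
    refine mul_ne_zero (mul_ne_zero (fun h2 => hl' ?_) (pow_ne_zero 2 n2)) n1
    linear_combination h2
  have h21 : m 2 1 = 0 := by
    have h1 : (m 1 1 * m 0 0) * m 2 1 ^ 2 = 0 := by linear_combination d4
    exact pow_eq_zero_iff two_ne_zero |>.mp
      ((mul_eq_zero.mp h1).resolve_left (mul_ne_zero n1 n0))
  refine ⟨fun i j hij => ?_, ?_⟩
  · fin_cases i <;> fin_cases j <;> first | exact absurd rfl hij | assumption
  · refine mul_left_cancel₀ (mul_ne_zero n1 n2) ?_
    rw [h01, h21] at d3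
    linear_combination d1 + d3

section Exp

attribute [local instance] Matrix.linftyOpNormedRing Matrix.linftyOpNormedAlgebra

theorem Matrix.hasDerivAt_exp_smul_apply (A : Matrix (Fin 3) (Fin 3) ℂ) (i j : Fin 3) :
    HasDerivAt (fun t : ℂ => NormedSpace.exp (t • A) i j) (A i j) 0 := by
  have h1 := hasDerivAt_exp_smul_const A (0 : ℂ)
  rw [zero_smul, NormedSpace.exp_zero, one_mul] at h1
  exact hasDerivAt_pi.mp (hasDerivAt_pi.mp h1 i) j

end Exp

/-- Differentiate the description of the stabilizer at `t = 0`: off-diagonal entries vanish and `A 0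
0 + A 2 2 = 2 * A 1 1`. Trace zero then leaves one parameter. -/
theorem isDiag_of_exp {l : ℂ} (hl : l ≠ 0) (hl' : l ≠ -1) {A : Matrix (Fin 3) (Fin 3) ℂ}
    (htr : A.trace = 0)
    (hA : ∀ t : ℂ, ∃ c : ℂ, c ≠ 0 ∧
      (omegaZero l).pullback (NormedSpace.exp (t • A)) = c • omegaZero l) :
    A = A 0 0 • Matrix.diagonal ![1, 0, -1] := by
  have key : ∀ t : ℂ, (∀ i j, i ≠ j → NormedSpace.exp (t • A) i j = 0) ∧
      NormedSpace.exp (t • A) 0 0 * NormedSpace.exp (t • A) 2 2 =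
        NormedSpace.exp (t • A) 1 1 ^ 2 := by
    intro t
    obtain ⟨c, hc, h⟩ := hA t
    exact diagonal_of_pullback_omegaZero hl hl' (h := (Matrix.isUnit_exp (t • A)).unit) hc h
  have hd := A.hasDerivAt_exp_smul_apply
  have hoff : ∀ i j, i ≠ j → A i j = 0 := by
    intro i j hij
    have h1 := hd i j
    simp only [fun t => (key t).1 i j hij] at h1
    exact h1.unique (hasDerivAt_const _ _)
  have h1 := (hd 0 0).mul (hd 2 2)
  have h2 := (hd 1 1).pow 2
  have h3 : (fun t : ℂ => NormedSpace.exp (t • A) 0 0) * (fun t : ℂ => NormedSpace.exp (t • A) 2 2) =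
      (fun t : ℂ => NormedSpace.exp (t • A) 1 1) ^ 2 := funext fun t => (key t).2
  rw [h3] at h1
  have h4 := h1.unique h2
  simp at h4
  rw [Matrix.trace_fin_three] at htr
  have h11 : A 1 1 = 0 := by linear_combination (htr - h4) / 3
  have h22 : A 2 2 = - A 0 0 := by linear_combination htr - h11
  ext i j
  fin_cases i <;> fin_cases j <;> simp [hoff, h11, h22]

theorem pullback_exp_omegaZero (l t : ℂ) :
    (omegaZero l).pullback (NormedSpace.exp (t • Matrix.diagonal ![1, 0, -1])) =
      Complex.exp (-t) • omegaZero l := by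
  have h1 : NormedSpace.exp (t • Matrix.diagonal ![1, 0, -1]) =
      Matrix.diagonal ![Complex.exp t, 1, Complex.exp (-t)] := by
    rw [← Matrix.diagonal_smul, Matrix.exp_diagonal]
    congr 1
    funext i
    rw [Pi.coe_exp]
    fin_cases i <;> simp [Complex.exp_eq_exp_ℂ]
  have h2 : Complex.exp t * Complex.exp (-t) = 1 := by
    rw [← Complex.exp_add, add_neg_cancel, Complex.exp_zero]
  refine OneForm.ext_ev fun p v => ?_
  rw [OneForm.ev_pullback, OneForm.ev_smul, h1, ev_omegaZero, ev_omegaZero]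
  simp only [Matrix.mulVec_diagonal, Matrix.cons_val]
  generalize Complex.exp t = x at *
  generalize Complex.exp (-t) = y at *
  linear_combination (p 1 * p 2 ^ 2 * v 0 * y + l * p 0 * p 2 ^ 2 * v 1 * y -
    (1 + l) * p 0 * p 1 * p 2 * v 2 * y) * h2

namespace Foliation

theorem isoAlgebra_foliationZero {l : ℂ} (hl : l ≠ 0) (hl' : l ≠ -1) :
    (foliationZero l hl).isoAlgebra = ℂ ∙ Matrix.diagonal ![1, 0, -1] := by
  obtain ⟨c, hc, h⟩ := exists_form_foliationZero l hl
  refine le_antisymm (Submodule.span_le.mpr ?_) ?_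
  · rintro A ⟨htr, hA⟩
    refine Submodule.mem_span_singleton.mpr ⟨A 0 0, (isDiag_of_exp hl hl' htr fun t => ?_).symm⟩
    obtain ⟨e, he, h1⟩ := hA t
    refine ⟨e, he, ?_⟩
    rw [h, OneForm.pullback_smul, smul_comm] at h1
    exact smul_right_injective _ hc h1
  · rw [Submodule.span_singleton_le_iff_mem]
    refine Submodule.subset_span ⟨?_, fun t => ⟨_, Complex.exp_ne_zero (-t), ?_⟩⟩
    · simp [Fin.sum_univ_three]
    · rw [h, OneForm.pullback_smul, pullback_exp_omegaZero, smul_comm]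

theorem orbitDim_foliationZero {l : ℂ} (hl : l ≠ 0) (hl' : l ≠ -1) :
    (foliationZero l hl).orbitDim = 7 := by
  rw [orbitDim, isoAlgebra_foliationZero hl hl', finrank_span_singleton]
  intro h
  simpa using congrFun (congrFun h 0) 0

end Foliation

/-! ### Seven distinct ratios -/

/-- Seven distinct values occur as ratios of eigendirections, none of them `0` or `-1`. -/
def HasSevenFlags (ω : OneForm) : Prop :=
  ∃ l : Fin 7 → ℂ, Function.Injective l ∧ ∀ i, l i ≠ 0 ∧ l i ≠ -1 ∧ HasFlag ω (l i)

theorem HasSevenFlags.smul {ω : OneForm} (h : HasSevenFlags ω) {c : ℂ} (hc : c ≠ 0) :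
    HasSevenFlags (c • ω) := by
  obtain ⟨l, hl, h⟩ := h
  exact ⟨l, hl, fun i => ⟨(h i).1, (h i).2.1, (h i).2.2.smul hc⟩⟩

theorem HasSevenFlags.eventually {w₀ : QuadField} (h : HasSevenFlags w₀.form) :
    ∀ᶠ w in 𝓝 w₀, HasSevenFlags w.form := by
  obtain ⟨l, hl, h⟩ := h
  -- Disjoint neighbourhoods of the seven ratios keep the perturbed ratios distinct.
  obtain ⟨s, hs, hd⟩ := Pairwise.exists_mem_filter_of_disjoint (l := fun i => 𝓝 (l i))
    fun i j hij => disjoint_nhds_nhds.mpr (hl.ne hij)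
  have h1 : ∀ᶠ w in 𝓝 w₀, ∀ i, ∃ m ∈ s i ∩ {0, -1}ᶜ, HasFlag w.form m := by
    refine Filter.eventually_all.mpr fun i => ?_
    obtain ⟨h0, hn, a, b, p, hf⟩ := h i
    refine hf.eventually_exists_hasFlag h0 hn (Filter.inter_mem (hs i) ?_)
    exact (Set.toFinite {0, -1}).isClosed.isOpen_compl.mem_nhds (by simp [h0, hn])
  filter_upwards [h1] with w hw
  choose m hm hf using hw
  refine ⟨m, fun i j hij => ?_, fun i => ?_⟩
  · by_contra hne
    exact Set.disjoint_left.mp (hd hne) (hm i).1 (hij ▸ (hm j).1)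
  · have := (hm i).2
    simp only [Set.mem_compl_iff, Set.mem_insert_iff, Set.mem_singleton_iff, not_or] at this
    exact ⟨this.1, this.2, hf i⟩

namespace Foliation

/-- A foliation with seven ratios degenerates onto seven foliations with orbits of dimension 7. -/
theorem exists_seven_degenerations {F : Foliation 2} (h : HasSevenFlags F.form) :
    ∃ G : Fin 7 → Foliation 2, (∀ i, F.DegeneratesOnto (G i) ∧ (G i).orbitDim = 7) ∧
      ∀ i j, i ≠ j → (G i).orbit ≠ (G j).orbit := by
  obtain ⟨l, hl, h⟩ := h
  have hne : ∀ i j, i ≠ j → (foliationZero (l i) (h i).1).orbit ≠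
      (foliationZero (l j) (h j).1).orbit := by
    intro i j hij h1
    have h2 := hasFlag_of_mem_orbit (mem_of_orbit_eq h1)
      ((hasFlag_foliationZero_iff (h j).1).mpr rfl)
    exact hij (hl ((hasFlag_foliationZero_iff (h i).1).mp h2).symm)
  refine ⟨fun i => foliationZero (l i) (h i).1, fun i => ⟨⟨?_, fun h1 => ?_⟩, ?_⟩, hne⟩
  · exact orbit_foliationZero_subset_closure (h i).1 (h i).2.2
  -- `F` has a second ratio, whereas `foliationZero` has only one.
  · obtain ⟨j, hj⟩ := exists_ne i
    have h2 := hasFlag_of_mem_orbit (mem_of_orbit_eq h1.symm) (h j).2.2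
    exact hj (hl ((hasFlag_foliationZero_iff (h i).1).mp h2))
  · exact orbitDim_foliationZero (h i).1 (h i).2.1

end Foliation

/-! ### Algebraicity of the seven-ratio condition -/

theorem exists_ne_zero_of_isPolyFun {σ τ κ : Type*} [Finite σ] [Finite τ]
    {g : κ → (σ ⊕ τ → ℂ) → ℂ} (hg : ∀ k, IsPolyFun (g k)) (U : Set (σ → ℂ))
    (hU : ∀ P : MvPolynomial σ ℂ, (∀ w ∈ U, eval w P = 0) → P = 0)
    (h : ∀ w ∈ U, ∃ y : τ → ℂ, ∀ k, g k (Sum.elim w y) = 0) :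
    ∃ P : MvPolynomial σ ℂ, P ≠ 0 ∧
      ∀ w, eval w P ≠ 0 → ∃ y : τ → ℂ, ∀ k, g k (Sum.elim w y) = 0 := by
  choose f hf using hg
  obtain ⟨P, hP, h1⟩ := exists_ne_zero_forall_exists_eval_eq_zero (Set.range f) U hU fun w hw => by
    obtain ⟨y, hy⟩ := h w hw
    refine ⟨y, ?_⟩
    rintro _ ⟨k, rfl⟩
    rw [hf, hy]
  refine ⟨P, hP, fun w hw => ?_⟩
  obtain ⟨y, hy⟩ := h1 w hw
  exact ⟨y, fun k => by rw [← hf, hy _ ⟨k, rfl⟩]⟩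

namespace IsPolyFun

variable {ι : Type*} {W : (ι → ℂ) → QuadField} {P Q U : (ι → ℂ) → Fin 3 → ℂ}

theorem triple (hP : ∀ i, IsPolyFun fun x => P x i) (hQ : ∀ i, IsPolyFun fun x => Q x i)
    (hU : ∀ i, IsPolyFun fun x => U x i) :
    IsPolyFun fun x => QuadField.triple (P x) (Q x) (U x) :=
  (((((hP 1).mul (hQ 2)).sub ((hP 2).mul (hQ 1))).mul (hU 0)).add
    ((((hP 2).mul (hQ 0)).sub ((hP 0).mul (hQ 2))).mul (hU 1))).add
    ((((hP 0).mul (hQ 1)).sub ((hP 1).mul (hQ 0))).mul (hU 2))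

theorem quad (hW : ∀ q, IsPolyFun fun x => W x q) (hP : ∀ i, IsPolyFun fun x => P x i) (i : Fin 3) :
    IsPolyFun fun x => (W x).quad (P x) i :=
  sum _ fun j _ => sum _ fun k _ => (hW _).mul ((hP j).mul (hP k))

theorem polar (hW : ∀ q, IsPolyFun fun x => W x q) (hP : ∀ i, IsPolyFun fun x => P x i)
    (hQ : ∀ i, IsPolyFun fun x => Q x i) (i : Fin 3) :
    IsPolyFun fun x => (W x).polar (P x) (Q x) i :=
  sum _ fun j _ => sum _ fun k _ => (hW _).mul (((hP j).mul (hQ k)).add ((hQ j).mul (hP k)))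

theorem ev (hW : ∀ q, IsPolyFun fun x => W x q) (hP : ∀ i, IsPolyFun fun x => P x i)
    (hU : ∀ i, IsPolyFun fun x => U x i) : IsPolyFun fun x => (W x).form.ev (P x) (U x) := by
  simp only [QuadField.ev_form]
  exact triple hP (quad hW hP) hU

theorem der (hW : ∀ q, IsPolyFun fun x => W x q) (hP : ∀ i, IsPolyFun fun x => P x i)
    (hQ : ∀ i, IsPolyFun fun x => Q x i) (hU : ∀ i, IsPolyFun fun x => U x i) :
    IsPolyFun fun x => (W x).form.der (P x) (Q x) (U x) := by
  simp only [QuadField.der_form]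
  exact (triple hQ (quad hW hP) hU).add (triple hP (polar hW hP hQ) hU)

theorem det (hP : ∀ i, IsPolyFun fun x => P x i) (hQ : ∀ i, IsPolyFun fun x => Q x i)
    (hU : ∀ i, IsPolyFun fun x => U x i) :
    IsPolyFun fun x => (Matrix.of ![P x, Q x, U x]).det := by
  have h : ∀ x, (Matrix.of ![P x, Q x, U x]).det = QuadField.triple (P x) (Q x) (U x) := by
    intro x
    simp only [Matrix.det_fin_three, Matrix.of_apply, Matrix.cons_val, QuadField.triple]
    ring
  simp only [h]
  exact triple hP hQ hU

end IsPolyFun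

/-- The equations, in the coefficients of a quadratic field `w` and the entries of frames `a i`,
`b i`, `p i`, ratios `l i` and auxiliary quantities `z i`, of seven flags with distinct ratios. -/
def flagEquation (i : Fin 7) (k : Fin 5) (w : QuadField) (a b p : Fin 7 → Fin 3 → ℂ)
    (l z : Fin 7 → ℂ) : ℂ :=
  ![w.form.ev (p i) (a i), w.form.ev (p i) (b i), w.form.der (p i) (b i) (b i),
    w.form.der (p i) (a i) (b i) - l i * w.form.der (p i) (b i) (a i),
    z i * ((Matrix.of ![a i, b i, p i]).det * w.form.der (p i) (b i) (a i) *
      w.form.ev (p i + b i) (b i) * (l i * (l i + 1)) * ∏ j ∈ Finset.univ.erase i, (l i - l j)) - 1]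
    k

/-- Rabinowitsch's trick: `z i` is the inverse of the product of all quantities required to be
nonzero, so the open conditions become equations and elimination applies. -/
theorem hasSevenFlags_iff (w : QuadField) : HasSevenFlags w.form ↔
    ∃ a b p l z, ∀ i k, flagEquation i k w a b p l z = 0 := by
  constructor
  · rintro ⟨l, hl, h⟩
    choose h0 hn a b p h using h
    refine ⟨a, b, p, l, fun i => ((Matrix.of ![a i, b i, p i]).det * w.form.der (p i) (b i) (a i) *
      w.form.ev (p i + b i) (b i) * (l i * (l i + 1)) *
        ∏ j ∈ Finset.univ.erase i, (l i - l j))⁻¹, fun i k => ?_⟩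
    fin_cases k
    · exact (h i).singular _
    · exact (h i).singular _
    · exact (h i).isotropic
    · exact sub_eq_zero.mpr (h i).ratio
    · refine sub_eq_zero.mpr (inv_mul_cancel₀ ?_)
      refine mul_ne_zero (mul_ne_zero (mul_ne_zero (mul_ne_zero (h i).frame (h i).nondegenerate)
        (h i).transverse) (mul_ne_zero (h0 i) fun h1 => hn i (by linear_combination h1))) ?_
      exact Finset.prod_ne_zero_iff.mpr fun j hj =>
        sub_ne_zero.mpr (hl.ne (Finset.ne_of_mem_erase hj).symm)
  · rintro ⟨a, b, p, l, z, h⟩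
    have h4 : ∀ i, (Matrix.of ![a i, b i, p i]).det * w.form.der (p i) (b i) (a i) *
        w.form.ev (p i + b i) (b i) * (l i * (l i + 1)) *
          ∏ j ∈ Finset.univ.erase i, (l i - l j) ≠ 0 := by
      intro i
      exact right_ne_zero_of_mul (a := z i) (by rw [sub_eq_zero.mp (h i 4)]; exact one_ne_zero)
    simp only [mul_ne_zero_iff, Finset.prod_ne_zero_iff] at h4
    refine ⟨l, fun i j hij => ?_, fun i => ⟨(h4 i).1.2.1, fun h1 => (h4 i).1.2.2 ?_,
      a i, b i, p i, (h4 i).1.1.1.1, ?_, h i 2, sub_eq_zero.mp (h i 3), (h4 i).1.1.1.2,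
      (h4 i).1.1.2⟩⟩
    · by_contra hne
      exact (h4 i).2 j (Finset.mem_erase.mpr ⟨Ne.symm hne, Finset.mem_univ _⟩) (sub_eq_zero.mpr hij)
    · rw [h1]
      norm_num
    · exact w.singular_of_isFrame (h4 i).1.1.1.1 (h i 0) (h i 1)

/-- As soon as one quadratic field has seven flags with distinct ratios, so has the generic one. -/
theorem exists_ne_zero_forall_hasSevenFlags {w₀ : QuadField} (h : HasSevenFlags w₀.form) :
    ∃ P : MvPolynomial (Fin 3 × Fin 3 × Fin 3) ℂ, P ≠ 0 ∧
      ∀ w : QuadField, eval w P ≠ 0 → HasSevenFlags w.form := by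
  -- In the block of index `i`, slots 0, 1, 2 hold `a i`, `b i`, `p i`; slot 3 holds `l i`, `z i`
  -- and a padding entry.
  set g : Fin 7 × Fin 5 → ((Fin 3 × Fin 3 × Fin 3) ⊕ (Fin 7 × Fin 4 × Fin 3) → ℂ) → ℂ := fun κ x =>
    flagEquation κ.1 κ.2 (fun q => x (Sum.inl q)) (fun i k => x (Sum.inr (i, 0, k)))
      (fun i k => x (Sum.inr (i, 1, k))) (fun i k => x (Sum.inr (i, 2, k)))
      (fun i => x (Sum.inr (i, 3, 0))) (fun i => x (Sum.inr (i, 3, 1))) with hg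
  have hpoly : ∀ κ, IsPolyFun (g κ) := by
    rintro ⟨i, k⟩
    have hW : ∀ q, IsPolyFun fun x : (Fin 3 × Fin 3 × Fin 3) ⊕ (Fin 7 × Fin 4 × Fin 3) → ℂ =>
      x (Sum.inl q) := fun q => IsPolyFun.coord _
    have hv : ∀ q, IsPolyFun fun x : (Fin 3 × Fin 3 × Fin 3) ⊕ (Fin 7 × Fin 4 × Fin 3) → ℂ =>
      x (Sum.inr q) := fun q => IsPolyFun.coord _
    have ha := fun k => hv (i, 0, k)
    have hb := fun k => hv (i, 1, k)
    have hp := fun k => hv (i, 2, k)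
    have hl := fun j => hv (j, 3, 0)
    fin_cases k
    · exact IsPolyFun.ev hW hp ha
    · exact IsPolyFun.ev hW hp hb
    · exact IsPolyFun.der hW hp hb hb
    · exact (IsPolyFun.der hW hp ha hb).sub ((hl i).mul (IsPolyFun.der hW hp hb ha))
    · refine ((hv (i, 3, 1)).mul (((((IsPolyFun.det ha hb hp).mul (IsPolyFun.der hW hp hb ha)).mul
        (IsPolyFun.ev hW (fun k => (hp k).add (hb k)) hb)).mul
          ((hl i).mul ((hl i).add (.const 1)))).mul
            (IsPolyFun.prod _ fun j _ => (hl i).sub (hl j)))).sub (.const 1)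
  -- The fields with seven ratios contain a neighbourhood of `w₀`, on which no nonzero polynomial
  -- vanishes.
  obtain ⟨P, hP, h1⟩ := exists_ne_zero_of_isPolyFun hpoly {w : QuadField | HasSevenFlags w.form}
    (fun P hP => eq_zero_of_eventually_eval_eq_zero (w₀ := w₀) (h.eventually.mono hP))
    fun w hw => by
      obtain ⟨a, b, p, l, z, hy⟩ := (hasSevenFlags_iff w).mp hw
      exact ⟨fun q => ![a q.1 q.2.2, b q.1 q.2.2, p q.1 q.2.2, ![l q.1, z q.1, 0] q.2.2] q.2.1,
        fun κ => hy κ.1 κ.2⟩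
  refine ⟨P, hP, fun w hw => ?_⟩
  obtain ⟨y, hy⟩ := h1 w hw
  exact (hasSevenFlags_iff w).mpr ⟨_, _, _, _, _, fun i k => hy (i, k)⟩

/-! ### Homogeneous polynomials and common factors -/

theorem MvPolynomial.homogeneousComponent_mul_of_totalDegree_le {σ : Type*}
    {P Q : MvPolynomial σ ℂ} {m n : ℕ} (hP : P.totalDegree ≤ m) (hQ : Q.totalDegree ≤ n) :
    homogeneousComponent (m + n) (P * Q) =
      homogeneousComponent m P * homogeneousComponent n Q := by
  have hsum : ∀ {R : MvPolynomial σ ℂ} {k : ℕ}, R.totalDegree ≤ k →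
      ∑ i ∈ Finset.range (k + 1), homogeneousComponent i R = R := by
    intro R k hk
    conv_rhs => rw [← sum_homogeneousComponent R]
    refine (Finset.sum_subset (Finset.range_mono (Nat.succ_le_succ hk)) fun i _ hi => ?_).symm
    exact homogeneousComponent_eq_zero _ _ (by simpa using hi)
  conv_lhs => rw [← hsum hP, ← hsum hQ]
  rw [Finset.sum_mul_sum, map_sum, Finset.sum_eq_single m]
  · rw [map_sum, Finset.sum_eq_single n]
    · rw [homogeneousComponent_of_mem
        ((homogeneousComponent_isHomogeneous m P).mul (homogeneousComponent_isHomogeneous n Q)),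
        if_pos rfl]
    · intro j hj hjn
      rw [homogeneousComponent_of_mem
        ((homogeneousComponent_isHomogeneous m P).mul (homogeneousComponent_isHomogeneous j Q)),
        if_neg (by omega)]
    · simp
  · intro i hi him
    rw [map_sum]
    refine Finset.sum_eq_zero fun j hj => ?_
    rw [Finset.mem_range] at hi hj
    rw [homogeneousComponent_of_mem
      ((homogeneousComponent_isHomogeneous i P).mul (homogeneousComponent_isHomogeneous j Q)),
      if_neg (by omega)]
  · simp

theorem MvPolynomial.IsHomogeneous.eval_smul {σ : Type*} {P : MvPolynomial σ ℂ} {n : ℕ}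
    (h : P.IsHomogeneous n) (c : ℂ) (x : σ → ℂ) : eval (c • x) P = c ^ n * eval x P := by
  rw [eval_eq, eval_eq, Finset.mul_sum]
  refine Finset.sum_congr rfl fun d hd => ?_
  have h1 : ∏ i ∈ d.support, (c • x) i ^ d i = c ^ n * ∏ i ∈ d.support, x i ^ d i := by
    rw [h.degree_eq_sum_deg_support hd, ← Finset.prod_pow_eq_pow_sum, ← Finset.prod_mul_distrib]
    exact Finset.prod_congr rfl fun i _ => mul_pow c (x i) (d i)
  rw [h1]
  ring

/-- A divisor of homogeneous polynomials of the same degree has leading component dividing them. -/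
theorem MvPolynomial.homogeneousComponent_totalDegree_dvd {σ : Type*} {P Q : MvPolynomial σ ℂ}
    {n : ℕ} (hQ : Q.IsHomogeneous n) (h : P ∣ Q) :
    homogeneousComponent P.totalDegree P ∣ Q := by
  by_cases h0 : Q = 0
  · rw [h0]
    exact dvd_zero _
  obtain ⟨R, rfl⟩ := h
  have h1 := totalDegree_mul_of_isDomain (left_ne_zero_of_mul h0) (right_ne_zero_of_mul h0)
  rw [hQ.totalDegree h0] at h1
  have h2 := homogeneousComponent_mul_of_totalDegree_le (le_refl P.totalDegree)
    (le_refl R.totalDegree)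
  rw [← h1, homogeneousComponent_of_mem hQ, if_pos rfl] at h2
  rw [h2]
  exact dvd_mul_right _ _

/-- A curve meets the line `Z = 0`. -/
theorem MvPolynomial.IsHomogeneous.exists_eval_eq_zero {P : MvPolynomial (Fin 3) ℂ} {m : ℕ}
    (h : P.IsHomogeneous m) (hm : m ≠ 0) : ∃ p : Fin 3 → ℂ, p ≠ 0 ∧ p 2 = 0 ∧ eval p P = 0 := by
  set q : Polynomial ℂ :=
    MvPolynomial.aeval ![Polynomial.X, 1, 0] P with hq
  have hqe : ∀ t, q.eval t = eval ![t, 1, 0] P := by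
    intro t
    have h1 : (Polynomial.aeval t).comp
        (MvPolynomial.aeval (![Polynomial.X, 1, 0] : Fin 3 → Polynomial ℂ)) =
          MvPolynomial.aeval (![t, 1, 0] : Fin 3 → ℂ) := by
      refine MvPolynomial.algHom_ext fun i => ?_
      fin_cases i <;> simp
    have h2 := DFunLike.congr_fun h1 P
    rwa [AlgHom.comp_apply, Polynomial.coe_aeval_eq_eval, MvPolynomial.aeval_eq_eval] at h2
  -- If `q` is a nonzero constant, homogeneity and continuity produce the zero `(1, 0, 0)`. The zero
  -- polynomial has degree `⊥` and falls in the other case.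
  by_cases hd : q.degree = 0
  · rw [Polynomial.eq_C_of_degree_eq_zero hd] at hqe
    refine ⟨![1, 0, 0], ?_, rfl, ?_⟩
    · exact fun h0 => one_ne_zero (congrFun h0 0)
    have h1 : Continuous fun s : ℂ => eval ![1, s, 0] P := by
      refine (MvPolynomial.continuous_eval P).comp (continuous_pi fun i => ?_)
      fin_cases i
      · exact continuous_const
      · exact continuous_id
      · exact continuous_const
    have h2 : Continuous fun s : ℂ => s ^ m * q.coeff 0 := by fun_prop
    have h3 := h1.ext_on (dense_compl_singleton (0 : ℂ)) h2 fun s hs => by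
      have h4 := h.eval_smul s ![s⁻¹, 1, 0]
      rw [← hqe, Polynomial.eval_C] at h4
      have h5 : s • ![s⁻¹, 1, 0] = ![1, s, 0] := by
        simp [mul_inv_cancel₀ (show s ≠ 0 from hs)]
      rwa [h5] at h4
    have h4 := congrFun h3 0
    simpa [hm] using h4
  · obtain ⟨t, ht⟩ := IsAlgClosed.exists_root q hd
    refine ⟨![t, 1, 0], fun h0 => one_ne_zero (congrFun h0 1), rfl, ?_⟩
    rw [← hqe]
    exact ht

namespace QuadField

/-- A common factor of positive degree has a leading component dividing all coefficients. That
component vanishes somewhere on the line `Z = 0`, which would give a singular point there. -/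
theorem definesFoliation_form {w : QuadField}
    (h : ∀ p : Fin 3 → ℂ, p 2 = 0 → (∀ i, eval p (w.form i) = 0) → p = 0) :
    DefinesFoliation 2 w.form := by
  refine ⟨w.isHomogeneous_form, w.sum_X_mul_form, fun d hd => ?_⟩
  have hd0 : d ≠ 0 := by
    rintro rfl
    have h1 := h (Pi.single 0 1) (by simp) fun i => by rw [zero_dvd_iff.mp (hd i), map_zero]
    simp at h1
  have hdeg : d.totalDegree = 0 := by
    by_contra hm
    obtain ⟨p, hp, hp2, h0⟩ := (homogeneousComponent_isHomogeneous d.totalDegree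
      d).exists_eval_eq_zero hm
    refine hp (h p hp2 fun i => ?_)
    obtain ⟨e, he⟩ := homogeneousComponent_totalDegree_dvd (w.isHomogeneous_form i) (hd i)
    rw [he, map_mul, h0, zero_mul]
  rw [totalDegree_eq_zero_iff_eq_C] at hdeg
  rw [hdeg]
  refine (isUnit_iff_ne_zero.mpr fun h1 => hd0 ?_).map C
  rw [hdeg, h1, C_0]

/-- Having no singular point on the line `Z = 0` is an open condition. -/
theorem eventually_definesFoliation {w₀ : QuadField}
    (h : ∀ p : Fin 3 → ℂ, p 2 = 0 → (∀ i, eval p (w₀.form i) = 0) → p = 0) :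
    ∀ᶠ w in 𝓝 w₀, DefinesFoliation 2 w.form := by
  have hc : Continuous fun z : QuadField × (Fin 3 → ℂ) => fun i => eval z.2 (z.1.form i) := by
    simp only [form, map_sub, map_mul, eval_X, eval_poly, quad]
    fun_prop
  have hK : IsCompact {p : Fin 3 → ℂ | p ∈ Metric.sphere 0 1 ∧ p 2 = 0} :=
    (isCompact_sphere 0 1).inter_right (isClosed_eq (continuous_apply 2) continuous_const)
  -- Compactness of a slice of the unit sphere makes the condition uniform in `p`; homogeneity
  -- reduces the general case to it.
  have h1 := hK.eventually_forall_of_forall_eventually (x₀ := w₀)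
    (P := fun w p => (fun i => eval p (w.form i)) ≠ 0) fun p hp =>
      hc.continuousAt.eventually_ne fun h0 => by
        have := h p hp.2 (congrFun h0)
        simp [this] at hp
  filter_upwards [h1] with w hw
  refine definesFoliation_form fun p hp2 hp => ?_
  by_contra hp0
  have hn : (‖p‖ : ℂ) ≠ 0 := by simpa using hp0
  refine hw ((‖p‖ : ℂ)⁻¹ • p) ⟨?_, ?_⟩ (funext fun i => ?_)
  · rw [mem_sphere_zero_iff_norm, norm_smul, norm_inv, Complex.norm_real, norm_norm,
      inv_mul_cancel₀ (norm_ne_zero_iff.mpr hp0)]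
  · simp [hp2]
  · rw [(w.isHomogeneous_form i).eval_smul, hp, mul_zero]
    rfl

end QuadField

/-! ### An explicit field with seven ratios -/

/-- The quadratic field `(3XY - 3XZ + 2YZ, 2XZ, XY - XZ + 2YZ)`. -/
def quadFieldSeven : QuadField := fun q =>
  if q = (0, 0, 1) then 3 else if q = (0, 0, 2) then -3 else if q = (0, 1, 2) then 2 else
    if q = (1, 0, 2) then 2 else if q = (2, 0, 1) then 1 else if q = (2, 0, 2) then -1 else
      if q = (2, 1, 2) then 2 else 0

theorem quad_quadFieldSeven (p : Fin 3 → ℂ) :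
    quadFieldSeven.quad p = ![3 * p 0 * p 1 - 3 * p 0 * p 2 + 2 * p 1 * p 2, 2 * p 0 * p 2,
      p 0 * p 1 - p 0 * p 2 + 2 * p 1 * p 2] := by
  funext i
  fin_cases i <;> simp [QuadField.quad, quadFieldSeven, Fin.sum_univ_three] <;> ring

theorem polar_quadFieldSeven (p q : Fin 3 → ℂ) :
    quadFieldSeven.polar p q =
      ![3 * (p 0 * q 1 + q 0 * p 1) - 3 * (p 0 * q 2 + q 0 * p 2) + 2 * (p 1 * q 2 + q 1 * p 2),
        2 * (p 0 * q 2 + q 0 * p 2),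
        p 0 * q 1 + q 0 * p 1 - (p 0 * q 2 + q 0 * p 2) + 2 * (p 1 * q 2 + q 1 * p 2)] := by
  funext i
  fin_cases i <;> simp [QuadField.polar, quadFieldSeven, Fin.sum_univ_three] <;> ring

theorem hasFlag_quadFieldSeven {l : ℂ} {a b p : Fin 3 → ℂ}
    (h1 : QuadField.triple a b p ≠ 0)
    (h2 : ∀ v, QuadField.triple p (quadFieldSeven.quad p) v = 0)
    (h3 : quadFieldSeven.form.der p b b = 0)
    (h4 : quadFieldSeven.form.der p a b = l * quadFieldSeven.form.der p b a)
    (h5 : quadFieldSeven.form.der p b a ≠ 0) (h6 : quadFieldSeven.form.ev (p + b) b ≠ 0) :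
    HasFlag quadFieldSeven.form l := by
  refine ⟨a, b, p, ?_, fun v => by rw [QuadField.ev_form, h2], h3, h4, h5, h6⟩
  rw [IsFrame]
  convert h1 using 1
  simp only [Matrix.det_fin_three, Matrix.of_apply, Matrix.cons_val, QuadField.triple]
  ring

/-- The three coordinate points are singular with two transverse eigendirections each; exchanging
`a` and `b` gives the reciprocal ratios. The point `(1 : 1 : 1)` supplies the seventh. -/
theorem hasSevenFlags_quadFieldSeven : HasSevenFlags quadFieldSeven.form := by
  refine ⟨![1 / 2, 2, -1 / 4, -4, 1 / 4, 4, -1 / 6], fun i j hij => ?_, fun i => ⟨?_, ?_,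
    hasFlag_quadFieldSeven
      (a := ![![0, 2, 1], ![0, 1, -1], ![1, 0, -1], ![2, 0, 1], ![1, 2, 0], ![2, -1, 0],
        ![2, 1, 0]] i)
      (b := ![![0, 1, -1], ![0, 2, 1], ![2, 0, 1], ![1, 0, -1], ![2, -1, 0], ![1, 2, 0],
        ![1, -2, 0]] i)
      (p := ![![1, 0, 0], ![1, 0, 0], ![0, 1, 0], ![0, 1, 0], ![0, 0, 1], ![0, 0, 1],
        ![1, 1, 1]] i) ?_ (fun v => ?_) ?_ ?_ ?_ ?_⟩⟩
  · fin_cases i <;> fin_cases j <;> first | rfl | (norm_num at hij)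
  all_goals
    fin_cases i <;> simp [QuadField.triple, QuadField.der_form, QuadField.ev_form,
      quad_quadFieldSeven, polar_quadFieldSeven] <;> norm_num

/-! ### Transfer of genericity from fields to foliations -/

/-- The quadratic field `(-Y², 0, X²)` gives no singular point on the line `Z = 0`. -/
theorem exists_quadField_forall_eq_zero : ∃ w : QuadField,
    ∀ p : Fin 3 → ℂ, p 2 = 0 → (∀ i, eval p (w.form i) = 0) → p = 0 := by
  refine ⟨fun q => if q = (0, 1, 1) then -1 else if q = (2, 0, 0) then 1 else 0, fun p h2 h => ?_⟩
  have h1 := h 1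
  have h3 := h 2
  simp [QuadField.form, QuadField.eval_poly, QuadField.quad, Fin.sum_univ_three, h2] at h1 h3
  funext i
  fin_cases i
  · exact h1
  · exact h3
  · exact h2

/-- `c ↦ eval (c • x) P` is a polynomial whose coefficients are the values at `x` of the homogeneous
components. It is nonzero, so some `c ≠ 0` avoids its roots. -/
theorem MvPolynomial.exists_eval_smul_ne_zero {σ : Type*} {P : MvPolynomial σ ℂ} {x : σ → ℂ} {n : ℕ}
    (h : eval x (homogeneousComponent n P) ≠ 0) : ∃ c : ℂ, c ≠ 0 ∧ eval (c • x) P ≠ 0 := by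
  set q : Polynomial ℂ := ∑ i ∈ Finset.range (P.totalDegree + 1),
    Polynomial.monomial i (eval x (homogeneousComponent i P)) with hq
  have hqe : ∀ c, q.eval c = eval (c • x) P := by
    intro c
    conv_rhs => rw [← sum_homogeneousComponent P]
    simp only [hq, Polynomial.eval_finsetSum, Polynomial.eval_monomial, map_sum,
      (homogeneousComponent_isHomogeneous _ P).eval_smul, mul_comm]
  have hn : n ∈ Finset.range (P.totalDegree + 1) := by
    by_contra hn
    rw [Finset.mem_range, not_lt] at hn
    exact h (by rw [homogeneousComponent_eq_zero _ _ hn, map_zero])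
  have hq0 : q ≠ 0 := by
    intro h0
    have h1 := congrArg (Polynomial.coeff · n) h0
    simp only [hq, Polynomial.finsetSum_coeff, Polynomial.coeff_monomial, Polynomial.coeff_zero,
      Finset.sum_ite_eq', hn, if_true] at h1
    exact h h1
  obtain ⟨c, hc⟩ := Set.Infinite.nonempty
    ((Polynomial.finite_setOfPred_isRoot hq0).union (Set.finite_singleton 0)).infinite_compl
  rw [Set.mem_compl_iff, Set.mem_union, not_or] at hc
  exact ⟨c, hc.2, by rw [← hqe]; exact hc.1⟩

theorem OneForm.coords_smul (c : ℂ) (ω : OneForm) : (c • ω).coords = c • ω.coords := by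
  funext q
  simp [OneForm.coords]

namespace Foliation

/-- A condition on forms which is invariant by scaling and holds for the generic quadratic field
holds for the generic foliation. -/
theorem generically_of_quadField {p : OneForm → Prop}
    (hsmul : ∀ ω (c : ℂ), c ≠ 0 → p ω → p (c • ω))
    {P₀ : MvPolynomial (Fin 3 × Fin 3 × Fin 3) ℂ} (hP₀ : P₀ ≠ 0)
    (h : ∀ w : QuadField, eval w P₀ ≠ 0 → p w.form) :
    Generically fun F : Foliation 2 => p F.form := by
  obtain ⟨w₁, hw₁, hd⟩ : ∃ w : QuadField, eval w P₀ ≠ 0 ∧ DefinesFoliation 2 w.form := by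
    obtain ⟨w₀, h₀⟩ := exists_quadField_forall_eq_zero
    by_contra! hne
    refine hP₀ (eq_zero_of_eventually_eval_eq_zero (w₀ := w₀) ?_)
    filter_upwards [QuadField.eventually_definesFoliation h₀] with w hw
    by_contra h1
    exact hne w h1 hw
  choose c c' r r' hq using OneForm.exists_quadField_eq
  -- `P₀` might vanish on the linear space of all `ω.quadField`. The shift `s` has zero form, so it
  -- changes no foliation, and it moves that space through `w₁`, where `P₀` does not vanish.
  set s : QuadField := w₁ - w₁.form.quadField with hs
  have hform : ∀ ω, DefinesFoliation 2 ω → (ω.quadField + s).form = ω := by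
    intro ω hω
    have h1 : s.form = 0 := by
      have h2 : (s + w₁.form.quadField).form = w₁.form := by rw [hs, sub_add_cancel]
      rw [QuadField.form_add, hd.form_quadField] at h2
      exact add_eq_right.mp h2
    rw [QuadField.form_add, hω.form_quadField, h1, add_zero]
  set P : MvPolynomial (Fin 3 × (Fin 3 →₀ ℕ)) ℂ :=
    bind₁ (fun q => C (c q) * X (r q) + C (c' q) * X (r' q) + C (s q)) P₀ with hP
  have hPe : ∀ ω : OneForm, eval ω.coords P = eval (ω.quadField + s) P₀ := by
    intro ω
    rw [hP, ← MvPolynomial.aeval_eq_eval, aeval_bind₁, ← MvPolynomial.aeval_eq_eval]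
    congr 2
    funext q
    simp [hq]
  -- The shift makes `P` inhomogeneous, so its homogeneous components are taken as equations. If one
  -- of them is nonzero at `F`, then `P` is nonzero at some multiple of the form, and `p` is
  -- invariant under scaling.
  refine ⟨{F | ∀ Q ∈ Set.range fun n => homogeneousComponent n P, eval F.form.coords Q = 0},
    ⟨_, ?_, rfl⟩, fun huniv => ?_, fun F hF => ?_⟩
  · rintro _ ⟨n, rfl⟩
    exact ⟨n, homogeneousComponent_isHomogeneous n P⟩
  · have h1 : mk w₁.form hd ∈ (Set.univ : Set (Foliation 2)) := Set.mem_univ _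
    rw [← huniv] at h1
    obtain ⟨e, he, h2⟩ := exists_form_mk w₁.form hd
    refine hw₁ ?_
    have h3 : w₁.form.quadField + s = w₁ := by rw [hs, add_sub_cancel]
    rw [← h3, ← hPe, ← sum_homogeneousComponent P, map_sum]
    refine Finset.sum_eq_zero fun n _ => ?_
    have h4 := h1 _ ⟨n, rfl⟩
    rw [h2, OneForm.coords_smul, (homogeneousComponent_isHomogeneous n P).eval_smul] at h4
    exact (mul_eq_zero.mp h4).resolve_left (pow_ne_zero n he)
  · simp only [Set.mem_ofPred_eq, Set.forall_mem_range, not_forall] at hF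
    obtain ⟨n, hn⟩ := hF
    obtain ⟨e, he, h1⟩ := exists_eval_smul_ne_zero hn
    rw [← OneForm.coords_smul, hPe] at h1
    have h2 := h _ h1
    rw [hform _ (F.definesFoliation_form.smul he)] at h2
    have h3 := hsmul _ e⁻¹ (inv_ne_zero he) h2
    rwa [smul_smul, inv_mul_cancel₀ he, one_smul] at h3

end Foliation

end

theorem mainTheorem4 :
    (∀ F : Foliation 2, ¬ F.HasInvariantLine →
      ((F.DegeneratesOnto foliationFive ↔
          ∃ m, F.IsSingular m ∧ F.milnorNumber m = 1 ∧ F.baumBott m = 4) ∧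
        ∀ (l : ℂ) (hl : l ≠ 0),
          (∃ m, F.IsSingular m ∧ F.milnorNumber m = 1 ∧ F.baumBott m = 2 - l - 1 / l) →
            F.DegeneratesOnto (foliationZero l hl))) ∧
    Foliation.Generically (fun F : Foliation 2 =>
      ∃ G : Fin 7 → Foliation 2,
        (∀ i, F.DegeneratesOnto (G i) ∧ (G i).orbitDim = 7) ∧
        ∀ i j, i ≠ j → (G i).orbit ≠ (G j).orbit) := by
  refine ⟨fun F hF => ⟨?_, fun l hl h => ?_⟩, ?_⟩
  · rw [Foliation.degeneratesOnto_foliationFive_iff hF, F.exists_baumBott_eq_iff]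
  · exact Foliation.degeneratesOnto_foliationZero hF hl ((F.exists_baumBott_eq_iff _).mp h)
  · obtain ⟨P₀, hP₀, h⟩ := exists_ne_zero_forall_hasSevenFlags hasSevenFlags_quadFieldSeven
    obtain ⟨S, hS, hS', h1⟩ := Foliation.generically_of_quadField (p := HasSevenFlags)
      (fun ω c hc hω => HasSevenFlags.smul hω hc) hP₀ h
    exact ⟨S, hS, hS', fun F hF => Foliation.exists_seven_degenerations (h1 F hF)⟩
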